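/- Let $d$ be a dimension, $\alpha\in(0,1)$ and $\Lambda\ge 1$, and let $Q_1=(-1,0]\times B_1\times B_1\subset\mathbb R\times\mathbb R^d\times\mathbb R^d$, where $B_1$ is the open unit ball centred at $0$. For $\beta,\alpha_1,\alpha_2\in(0,1]$ and a function $h$ on $Q_1$ put $$[h]_{C_x^{\alpha_1}C_v^{\alpha_2}(Q_1)}=\sup\frac{|h(t,x,v)-h(t,x',v')|}{|x-x'|^{\alpha_1}+|v-v'|^{\alpha_2}},\qquad [h]_{C_x^{\beta}(Q_1)}=\sup\frac{|h(t,x,v)-h(t,x',v)|}{|x-x'|^{\beta}},$$ where the suprema are over pairs of distinct points of $Q_1$ of the indicated form (same $t$, and in the second case also same $v$) with $|x-x'|<1/2$ and $|v-v'|<1/2$; let $C_x^{\alpha_1}C_v^{\alpha_2}(Q_1)$ be the space of those $h\in L^\infty(Q_1)$ for which the first seminorm is finite. There is a constant $C$, depending only on $d$, $\alpha$ and $\Lambda$, such that the following holds. Let $a:\mathbb R\to\mathbb R^{d\times d}$ be measurable with $\Lambda^{-1}\,\mathrm{Id}\le a(t)\le\Lambda\,\mathrm{Id}$, in the sense of quadratic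 forms, for all $t$. Let $f$ be a function on $Q_1$ such that $f$, $(\partial_t+v\cdot\nabla_x)f$ and $D_v^2f$ exist and are continuous on $Q_1$, where $(\partial_t+v\cdot\nabla_x)f$ is the derivative of $f$ along the curves $s\mapsto(t+s,x+sv,v)$ (one-sided at $t=0$). Let $g\in C_x^{\alpha/3}C_v^{\alpha}(Q_1)$. Assume that $f$ and $g$ have compact support in $Q_1$ (they need not vanish at $t=0$), and that $$(\partial_t+v\cdot\nabla_x)f=\mathrm{Tr}\big(a(t)D_v^2f\big)+g\qquad\text{for almost every } t\in(-1,0]\text{ and all }(x,v)\in B_1\times B_1 .$$ Then $$[f]_{C_x^{(2+\alpha)/3}(Q_1)}+[D_v^2f]_{C_x^{\alpha/3}C_v^{\alpha}(Q_1)}\le C\,[g]_{C_x^{\alpha/3}C_v^{\alpha}(Q_1)} .$$ -/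

import Mathlib

open MeasureTheory Set
open scoped ENNReal NNReal

/-- Euclidean space `ℝᵈ`. -/
abbrev Vec (d : ℕ) : Type := EuclideanSpace ℝ (Fin d)

/-- Points `z = (t, x, v)` of `ℝ × ℝᵈ × ℝᵈ`. -/
abbrev Phase (d : ℕ) : Type := ℝ × Vec d × Vec d

/-- The kinetic cylinder `Q_r = (-r², 0] × B_{r³} × B_r`. -/
def kineticCylinder (d : ℕ) (r : ℝ) : Set (Phase d) :=
  Ioc (-r ^ 2) 0 ×ˢ (Metric.ball (0 : Vec d) (r ^ 3) ×ˢ Metric.ball (0 : Vec d) r)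

section Holder

variable {d : ℕ} {F : Type*} [NormedAddCommGroup F]

/-- The seminorm `[f]_{C_x^{α₁} C_v^{α₂}(Q)}`: the supremum, over pairs of distinct points of `Q`
at the same time and with `|x - x'|, |v - v'| < 1/2`, of
`|f(t,x,v) - f(t,x',v')| / (|x - x'|^{α₁} + |v - v'|^{α₂})`. It takes values in `[0, ∞]`. -/
noncomputable def holderXV (α₁ α₂ : ℝ) (Q : Set (Phase d)) (f : Phase d → F) : ℝ≥0∞ :=
  ⨆ (t : ℝ) (x : Vec d) (v : Vec d) (x' : Vec d) (v' : Vec d)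
    (_ : (t, x, v) ∈ Q) (_ : (t, x', v') ∈ Q) (_ : (x, v) ≠ (x', v'))
    (_ : ‖x - x'‖ < 1 / 2) (_ : ‖v - v'‖ < 1 / 2),
    ENNReal.ofReal (‖f (t, x, v) - f (t, x', v')‖ / (‖x - x'‖ ^ α₁ + ‖v - v'‖ ^ α₂))

/-- The seminorm `[f]_{C_x^β(Q)}`: the supremum, over pairs of distinct points of `Q` with the same
time and velocity and with `|x - x'| < 1/2`, of `|f(t,x,v) - f(t,x',v)| / |x - x'|^β`. -/
noncomputable def holderX (β : ℝ) (Q : Set (Phase d)) (f : Phase d → F) : ℝ≥0∞ :=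
  ⨆ (t : ℝ) (x : Vec d) (x' : Vec d) (v : Vec d)
    (_ : (t, x, v) ∈ Q) (_ : (t, x', v) ∈ Q) (_ : x ≠ x') (_ : ‖x - x'‖ < 1 / 2),
    ENNReal.ofReal (‖f (t, x, v) - f (t, x', v)‖ / ‖x - x'‖ ^ β)

/-- The space `C_x^{α₁} C_v^{α₂}(Q)`. -/
def MemHolderXV (α₁ α₂ : ℝ) (Q : Set (Phase d)) (f : Phase d → F) : Prop :=
  MemLp f ∞ (volume.restrict Q) ∧ holderXV α₁ α₂ Q f < ∞

end Holder

/-- `f`, as a function on `Q`, has compact support contained in `Q` (values off `Q` are ignored). -/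
def CompactSupportIn {d : ℕ} (Q : Set (Phase d)) (f : Phase d → ℝ) : Prop :=
  ∃ K : Set (Phase d), IsCompact K ∧ K ⊆ Q ∧ ∀ z ∈ Q, z ∉ K → f z = 0

/-- The integral curve `s ↦ (t + s, x + s v, v)` of the field `∂_t + v·∇_x` through `(t, x, v)`. -/
noncomputable def transportCurve {d : ℕ} (z : Phase d) (s : ℝ) : Phase d :=
  (z.1 + s, z.2.1 + s • z.2.2, z.2.2)

/-- `f` has a derivative in the direction `∂_t + v·∇_x` at `z`, relative to `Q`
(so one-sided at the final time of a cylinder). -/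
def TransportDifferentiableAt {d : ℕ} (Q : Set (Phase d)) (f : Phase d → ℝ) (z : Phase d) : Prop :=
  DifferentiableWithinAt ℝ (fun s => f (transportCurve z s)) {s | transportCurve z s ∈ Q} 0

/-- `(∂_t + v·∇_x) f` at `z`, relative to `Q`. -/
noncomputable def transportDeriv {d : ℕ} (Q : Set (Phase d)) (f : Phase d → ℝ) (z : Phase d) : ℝ :=
  derivWithin (fun s => f (transportCurve z s)) {s | transportCurve z s ∈ Q} 0

/-- `D²_v f` at `z`, as a bilinear form on `ℝᵈ` (with the operator norm). -/
noncomputable def hessV {d : ℕ} (f : Phase d → ℝ) (z : Phase d) : Vec d →L[ℝ] Vec d →L[ℝ] ℝ :=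
  fderiv ℝ (fun v => fderiv ℝ (fun w => f (z.1, z.2.1, w)) v) z.2.2

/-- The matrix `(∂_{v_i} ∂_{v_j} f(z))_{ij}` of `D²_v f(z)`. -/
noncomputable def hessVMatrix {d : ℕ} (f : Phase d → ℝ) (z : Phase d) :
    Matrix (Fin d) (Fin d) ℝ :=
  Matrix.of fun i j => hessV f z (EuclideanSpace.single i 1) (EuclideanSpace.single j 1)

/-- `f`, `(∂_t + v·∇_x) f` and `D²_v f` exist and are continuous on `Q_r`. -/
structure KineticC2 {d : ℕ} (r : ℝ) (f : Phase d → ℝ) : Prop where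
  continuousOn : ContinuousOn f (kineticCylinder d r)
  transport_differentiable :
    ∀ z ∈ kineticCylinder d r, TransportDifferentiableAt (kineticCylinder d r) f z
  transport_continuousOn :
    ContinuousOn (transportDeriv (kineticCylinder d r) f) (kineticCylinder d r)
  contDiffOn_v : ∀ t ∈ Ioc (-r ^ 2) 0, ∀ x ∈ Metric.ball (0 : Vec d) (r ^ 3),
    ContDiffOn ℝ 2 (fun v => f (t, x, v)) (Metric.ball (0 : Vec d) r)
  hess_continuousOn : ContinuousOn (hessV f) (kineticCylinder d r)

/-- `a` is (Lebesgue) measurable and `Λ⁻¹ Id ≤ a(t) ≤ Λ Id` for all `t` as quadratic forms. -/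
def IsEllipticCoeff {d : ℕ} (Λ : ℝ) (a : ℝ → Matrix (Fin d) (Fin d) ℝ) : Prop :=
  (∀ i j, AEMeasurable (fun t => a t i j) volume) ∧
    ∀ t, ∀ ξ : Fin d → ℝ,
      Λ⁻¹ * (ξ ⬝ᵥ ξ) ≤ ξ ⬝ᵥ (a t).mulVec ξ ∧ ξ ⬝ᵥ (a t).mulVec ξ ≤ Λ * (ξ ⬝ᵥ ξ)

/-- `(∂_t + v·∇_x) f = Tr(a(t) D²_v f) + g` in `Q_r`, for almost every time `t`
and every `(x, v)`. -/
def SolvesHomogeneousKFP {d : ℕ} (r : ℝ) (a : ℝ → Matrix (Fin d) (Fin d) ℝ)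
    (f g : Phase d → ℝ) : Prop :=
  ∀ᵐ t : ℝ, ∀ x v : Vec d, (t, x, v) ∈ kineticCylinder d r →
    transportDeriv (kineticCylinder d r) f (t, x, v) =
      (a t * hessVMatrix f (t, x, v)).trace + g (t, x, v)

open Filter Topology

/-! Fix a time `t ≤ 0`, extend `f` by zero and follow the transport field backwards: `F τ (x, v) = f
(t - τ, x - τ v, v)`. Transport becomes `-∂_τ`, the velocity gradient becomes `∇_v + τ ∇_x`, and the
coefficients still depend on time only. On symmetric forms the diffusion matrix is `lam Id + ∑ k, u
k ⊗ u k` with `lam = Λ⁻¹`.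

Let `K_τ` be the Gaussian kernel with `∂_τ K = lam |∇_v + τ ∇_x|² K` and let `U τ = K_τ * F τ`,
which is `smooth lam τ (F τ)`. In `∂_τ U` the `lam` part of the equation cancels against `∂_τ K`,
leaving `-∂_τ U = ∑ k, (u_k · (∇_v + τ ∇_x))² U + K_τ * G τ` (`hasDerivAt_smooth`). At a maximum of
`U τ` the squares are nonpositive, whatever the `u_k` are, so the maximum changes only through the
source (`peak_le_add`). Since `F` vanishes for `τ ≥ 1` and `K_τ` tends to a Dirac mass as `τ → 0`,
any nonnegative rate that dominates `sup (K_τ * G τ)` has an integral over `(0, 1)` that dominates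
`sup F 0`. No regularity of `a` in time is needed.

The problem is linear and commutes with translations of `(x, v)`, so the bound applies to finite
differences of `F`. A difference of `K_τ * G τ` with increment `h` gains a factor `|h_x| τ^(-3/2) +
|h_v| τ^(-1/2)`, and the Hölder continuity of `G` gains `τ^(α/2)` because differences of the
Gaussian have mean zero (`exists_smooth_difference_bound`). Integration in `τ`, split at the
parabolic scale of the increments, gives `exists_position_holder_bound` and
`exists_secondDiff_holder_bound`; `0 < α < 1` is what makes each piece of the integral have the
right size.

The equation holds only at almost every time. Continuity of its left side and compactness of the set
of admissible `u` give, at every time, an equation with some matrix of the same form and a source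
with the Hölder constant of `g` (`exists_limit_source`). -/

/-- Pairs `(x, v)` of a position and a velocity. -/
abbrev Slice (d : ℕ) : Type := Vec d × Vec d

/-! ### Second differences in one variable. -/

section SecondDifference

/-- A second difference of a twice differentiable function is a second derivative at an
intermediate point. -/
theorem exists_secondDiff_eq {φ φ₁ φ₂ : ℝ → ℝ} (h₁ : ∀ r, HasDerivAt φ (φ₁ r) r)
    (h₂ : ∀ r, HasDerivAt φ₁ (φ₂ r) r) {ε : ℝ} (hε : 0 < ε) :
    ∃ ξ ∈ Ioo (-ε) ε, φ ε + φ (-ε) - 2 * φ 0 = ε ^ 2 * φ₂ ξ := by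
  have hψ : ∀ r, HasDerivAt (fun r => φ r + φ (-r)) (φ₁ r - φ₁ (-r)) r := by
    intro r
    have h := (h₁ r).add ((h₁ (-r)).comp r (hasDerivAt_neg r))
    exact h.congr_deriv (by ring)
  have hsq : ∀ r : ℝ, HasDerivAt (fun r : ℝ => r ^ 2) (2 * r) r := by
    intro r
    simpa using hasDerivAt_pow 2 r
  -- Cauchy's mean value theorem for `φ r + φ (-r)` against `r ^ 2` leaves a first difference of
  -- `φ₁` over `(-c, c)`, to which the ordinary mean value theorem applies.
  obtain ⟨c, hc, hceq⟩ := exists_ratio_hasDerivAt_eq_ratio_slope (fun r => φ r + φ (-r))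
    (fun r => φ₁ r - φ₁ (-r)) hε (fun r _ => (hψ r).continuousAt.continuousWithinAt)
    (fun r _ => hψ r) (fun r => r ^ 2) (fun r => 2 * r)
    (fun r _ => (hsq r).continuousAt.continuousWithinAt) (fun r _ => hsq r)
  have hcpos : 0 < c := hc.1
  obtain ⟨ξ, hξ, hξeq⟩ := exists_hasDerivAt_eq_slope φ₁ φ₂ (by linarith : -c < c)
    (fun r _ => (h₂ r).continuousAt.continuousWithinAt) (fun r _ => h₂ r)
  refine ⟨ξ, ⟨by linarith [hξ.1, hc.2], by linarith [hξ.2, hc.2]⟩, ?_⟩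
  rw [eq_div_iff (by linarith)] at hξeq
  simp only [neg_zero] at hceq
  have : (φ ε + φ (-ε) - 2 * φ 0 - ε ^ 2 * φ₂ ξ) * (2 * c) = 0 := by
    rw [← hξeq] at hceq
    linear_combination -hceq
  have := (mul_eq_zero.mp this).resolve_right (by linarith)
  linarith

/-- The second difference quotients of a function converge to its second derivative. -/
theorem tendsto_secondDiff {φ φ₁ φ₂ : ℝ → ℝ} (h₁ : ∀ r, HasDerivAt φ (φ₁ r) r)
    (h₂ : ∀ r, HasDerivAt φ₁ (φ₂ r) r) (hc : ContinuousAt φ₂ 0) :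
    Tendsto (fun ε : ℝ => (φ ε + φ (-ε) - 2 * φ 0) / ε ^ 2) (𝓝[>] 0) (𝓝 (φ₂ 0)) := by
  rw [Metric.tendsto_nhdsWithin_nhds]
  intro δ hδ
  obtain ⟨η, hη, hηδ⟩ := Metric.continuousAt_iff.mp hc δ hδ
  refine ⟨η, hη, fun {ε} hε hεη => ?_⟩
  have hε' : 0 < ε := hε
  obtain ⟨ξ, hξ, heq⟩ := exists_secondDiff_eq h₁ h₂ hε'
  rw [heq, mul_div_cancel_left₀ _ (by positivity)]
  apply hηδ
  rw [Real.dist_eq, sub_zero] at hεη ⊢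
  rw [abs_of_pos hε'] at hεη
  exact (abs_lt.mpr hξ).trans hεη

end SecondDifference

/-! ### The Gaussian density on phase space. -/

section Gaussian

variable {d : ℕ}

theorem integrable_exp_neg_mul_sq_norm {b : ℝ} (hb : 0 < b) :
    Integrable (fun v : Vec d => Real.exp (-b * ‖v‖ ^ 2)) := by
  apply Integrable.of_integral_ne_zero
  rw [GaussianFourier.integral_rexp_neg_mul_sq_norm hb]
  positivity

theorem integrable_exp_neg_mul_sq_add_sq {b : ℝ} (hb : 0 < b) :
    Integrable (fun z : Slice d => Real.exp (-b * (‖z.1‖ ^ 2 + ‖z.2‖ ^ 2))) := by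
  have h := (integrable_exp_neg_mul_sq_norm (d := d) hb).mul_prod
    (integrable_exp_neg_mul_sq_norm (d := d) hb)
  refine h.congr (ae_of_all _ fun z => ?_)
  simp only
  rw [← Real.exp_add]
  ring_nf

/-- The Gaussian probability density `π⁻ᵈ exp(-|z₁|² - |z₂|²)` on `ℝᵈ × ℝᵈ`. -/
noncomputable def gaussDensity (z : Slice d) : ℝ :=
  (Real.pi ^ d)⁻¹ * Real.exp (-(‖z.1‖ ^ 2 + ‖z.2‖ ^ 2))

theorem gaussDensity_pos (z : Slice d) : 0 < gaussDensity z := by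
  unfold gaussDensity; positivity

theorem continuous_gaussDensity : Continuous (gaussDensity (d := d)) := by
  unfold gaussDensity; fun_prop

theorem integrable_gaussDensity : Integrable (gaussDensity (d := d)) := by
  have h := (integrable_exp_neg_mul_sq_add_sq (d := d) one_pos).const_mul (Real.pi ^ d)⁻¹
  refine h.congr (ae_of_all _ fun z => ?_)
  simp [gaussDensity]

theorem integral_gaussDensity : ∫ z : Slice d, gaussDensity z = 1 := by
  have h := integral_prod_mul (μ := (volume : Measure (Vec d))) (ν := (volume : Measure (Vec d)))
    (fun v : Vec d => Real.exp (-1 * ‖v‖ ^ 2)) (fun v : Vec d => Real.exp (-1 * ‖v‖ ^ 2))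
  rw [GaussianFourier.integral_rexp_neg_mul_sq_norm one_pos] at h
  have h2 : ∫ z : Slice d, gaussDensity z
      = (Real.pi ^ d)⁻¹ * ∫ z : Slice d, Real.exp (-1 * ‖z.1‖ ^ 2) * Real.exp (-1 * ‖z.2‖ ^ 2) := by
    rw [← integral_const_mul]
    congr 1
    ext z
    rw [gaussDensity, ← Real.exp_add]
    ring_nf
  rw [h2]
  erw [h]
  rw [← Real.rpow_add (by positivity)]
  simp only [div_one, finrank_euclideanSpace, Fintype.card_fin, add_halves, Real.rpow_natCast]
  exact inv_mul_cancel₀ (by positivity)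

theorem integrable_mul_gaussDensity {H : Slice d → ℝ} (hH : Continuous H) {B : ℝ}
    (hB : ∀ y, |H y| ≤ B) : Integrable (fun z => H z * gaussDensity z) :=
  integrable_gaussDensity.bdd_mul hH.aestronglyMeasurable (ae_of_all _ hB)

end Gaussian

/-! ### Averaging against the Kolmogorov kernel. -/

section Smoothing

variable {d : ℕ}

/-- The linear map carrying the standard Gaussian to the law of the Kolmogorov diffusion with
coefficient `lam` at time `τ`. -/
noncomputable def spread (lam τ : ℝ) (z : Slice d) : Slice d :=
  (τ • (√(lam * τ) • z.1 + √(lam * τ / 3) • z.2), (2 * √(lam * τ)) • z.1)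

theorem continuous_spread (lam τ : ℝ) : Continuous (spread (d := d) lam τ) := by
  unfold spread; fun_prop

/-- Averaging against the Kolmogorov kernel with coefficient `lam` at time `τ`. -/
noncomputable def smooth (lam τ : ℝ) (H : Slice d → ℝ) (y : Slice d) : ℝ :=
  ∫ z, H (y - spread lam τ z) * gaussDensity z

theorem integrable_smooth {H : Slice d → ℝ} (hH : Continuous H) {B : ℝ} (hB : ∀ y, |H y| ≤ B)
    (lam τ : ℝ) (y : Slice d) :
    Integrable (fun z => H (y - spread lam τ z) * gaussDensity z) := by
  have := continuous_spread (d := d) lam τ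
  exact integrable_mul_gaussDensity (H := fun z => H (y - spread lam τ z)) (by fun_prop)
    (fun z => hB _)

theorem abs_smooth_le {H : Slice d → ℝ} {B : ℝ} (hB : ∀ y, |H y| ≤ B)
    (lam τ : ℝ) (y : Slice d) : |smooth lam τ H y| ≤ B := by
  have h : ‖∫ z, H (y - spread lam τ z) * gaussDensity z‖ ≤ ∫ z : Slice d, B * gaussDensity z := by
    refine norm_integral_le_of_norm_le (integrable_gaussDensity.const_mul B) (ae_of_all _ fun z => ?_)
    rw [norm_mul, Real.norm_eq_abs, Real.norm_eq_abs, abs_of_pos (gaussDensity_pos z)]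
    exact mul_le_mul_of_nonneg_right (hB _) (gaussDensity_pos z).le
  rwa [integral_const_mul, integral_gaussDensity, mul_one] at h

theorem smooth_sub {H K : Slice d → ℝ} (hH : Continuous H) (hK : Continuous K) {B B' : ℝ}
    (hB : ∀ y, |H y| ≤ B) (hB' : ∀ y, |K y| ≤ B') (lam τ : ℝ) (y : Slice d) :
    smooth lam τ (fun y => H y - K y) y = smooth lam τ H y - smooth lam τ K y := by
  unfold smooth
  rw [← integral_sub (integrable_smooth hH hB lam τ y) (integrable_smooth hK hB' lam τ y)]
  simp only [sub_mul]

/-- The fundamental solution of `∂_τ = lam |∇_v + τ ∇_x|²`. -/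
noncomputable def kolmogorovKernel (lam τ : ℝ) (y : Slice d) : ℝ :=
  (√3 / (2 * Real.pi * lam * τ ^ 2)) ^ d *
    Real.exp (-(‖y.2‖ ^ 2 / τ - 3 * inner ℝ y.2 y.1 / τ ^ 2 + 3 * ‖y.1‖ ^ 2 / τ ^ 3) / lam)

/-- Change of variables formula for densities: the prefactor is the Jacobian of `spread lam τ`, and
the quadratic form in the kernel pulls back to `‖z.1‖ ^ 2 + ‖z.2‖ ^ 2`. -/
theorem kolmogorovKernel_spread {lam τ : ℝ} (hl : 0 < lam) (hτ : 0 < τ) (z : Slice d) :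
    ((2 * √(lam * τ)) * (τ * √(lam * τ / 3))) ^ d * kolmogorovKernel lam τ (spread lam τ z)
      = gaussDensity z := by
  have h3 : √(lam * τ / 3) = √(lam * τ) / √3 := Real.sqrt_div (by positivity) _
  have hs : √(lam * τ) ^ 2 = lam * τ := Real.sq_sqrt (by positivity)
  have hs3 : √(3 : ℝ) ^ 2 = 3 := Real.sq_sqrt (by positivity)
  have hp3 : 0 < √(3 : ℝ) := by positivity
  have hps : 0 < √(lam * τ) := by positivity
  set s := √(lam * τ) with hsdef
  set k := √(3 : ℝ) with hk
  unfold kolmogorovKernel gaussDensity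
  rw [← mul_assoc, ← mul_pow]
  congr 1
  · rw [← inv_pow]
    congr 1
    rw [h3]
    rw [← hk]
    field_simp
    rw [hs]
    ring
  · congr 1
    simp only [spread]
    rw [← hsdef, h3]
    rw [inner_smul_left, inner_smul_right, inner_add_right, inner_smul_right, inner_smul_right,
      real_inner_self_eq_norm_sq, norm_smul, norm_smul, mul_pow, mul_pow, norm_add_sq_real,
      inner_smul_left, inner_smul_right, norm_smul, norm_smul]
    simp only [Real.norm_eq_abs, sq_abs, mul_pow, conj_trivial]
    simp only [div_pow, hs, hs3]
    have e1 : lam * τ = s ^ 2 := hs.symm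
    have e2 : lam = s ^ 2 / τ := by field_simp; linarith
    rw [e2]
    field_simp
    ring

instance : (volume : Measure (Slice d)).IsAddHaarMeasure :=
  inferInstanceAs ((volume : Measure (Vec d)).prod (volume : Measure (Vec d))).IsAddHaarMeasure

theorem integral_comp_sub_left (φ : Slice d → ℝ) (y : Slice d) : ∫ z, φ (y - z) = ∫ z, φ z := by
  have h := Measure.integral_comp_smul (volume : Measure (Slice d)) (fun z => φ (y + z)) (-1)
  rw [integral_add_left_eq_self φ] at h
  simpa [sub_eq_add_neg, abs_inv, abs_pow] using h

/-- The Gaussian form of `smooth` suits limits as `τ → 0` and Hölder estimates; the convolution form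
obtained here lets derivatives in `τ` and in space fall on an explicit kernel. -/
theorem smooth_eq_integral_kernel {lam τ : ℝ} (hl : 0 < lam) (hτ : 0 < τ) {H : Slice d → ℝ}
    (hH : Continuous H) (hs : HasCompactSupport H) (y : Slice d) :
    smooth lam τ H y = ∫ y', H y' * kolmogorovKernel lam τ (y - y') := by
  set k₁ := 2 * √(lam * τ) with hk₁
  set k₂ := τ * √(lam * τ / 3) with hk₂
  have hk₁p : 0 < k₁ := by positivity
  have hk₂p : 0 < k₂ := by positivity
  have hKc : Continuous (kolmogorovKernel (d := d) lam τ) := by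
    unfold kolmogorovKernel; fun_prop
  obtain ⟨B, hB⟩ : ∃ B, ∀ y, |H y| ≤ B := by
    obtain ⟨B, hB⟩ := hs.exists_bound_of_continuous hH
    exact ⟨B, hB⟩
  set φ : Slice d → ℝ := fun y' => H (y - y') * kolmogorovKernel lam τ y' with hφ
  have hφi : Integrable φ := by
    apply Continuous.integrable_of_hasCompactSupport (by fun_prop)
    apply HasCompactSupport.mul_right
    exact hs.comp_homeomorph (Homeomorph.subLeft y)
  have hφs : ∀ z, H (y - spread lam τ z) * gaussDensity z = (k₁ * k₂) ^ d * φ (spread lam τ z) := by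
    intro z
    rw [← kolmogorovKernel_spread hl hτ z]
    simp only [hφ]
    ring
  have hφsi : Integrable (fun z => φ (spread lam τ z)) := by
    have h := (integrable_smooth hH hB lam τ y).const_mul ((k₁ * k₂) ^ d)⁻¹
    refine h.congr (ae_of_all _ fun z => ?_)
    simp only
    rw [hφs z, inv_mul_cancel_left₀ (by positivity)]
  have hR : ∫ y', H y' * kolmogorovKernel lam τ (y - y') = ∫ y', φ y' := by
    rw [← integral_comp_sub_left φ y]
    simp [hφ]
  rw [hR, smooth, integral_congr_ae (ae_of_all _ hφs), integral_const_mul]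
  have h1 : ∫ z, φ (spread lam τ z)
      = ∫ z₁ : Vec d, ∫ z₂ : Vec d, φ (spread lam τ (z₁, z₂)) := integral_prod _ hφsi
  -- The velocity part of `spread` involves only `z.1`, so integrating in `x` first reduces the
  -- change of variables to a translation and two scalings.
  have h2 : ∫ y', φ y' = ∫ v : Vec d, ∫ x : Vec d, φ (x, v) := integral_prod_symm _ hφi
  have h3 : ∀ z₁ : Vec d, ∫ z₂ : Vec d, φ (spread lam τ (z₁, z₂))
      = (k₂ ^ d)⁻¹ * ∫ x : Vec d, φ (x, k₁ • z₁) := by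
    intro z₁
    have e : ∀ z₂ : Vec d, φ (spread lam τ (z₁, z₂))
        = (fun w => φ ((τ * √(lam * τ)) • z₁ + w, k₁ • z₁)) (k₂ • z₂) := by
      intro z₂
      simp only [spread, smul_add, smul_smul, hk₁, hk₂]
    simp_rw [e]
    rw [Measure.integral_comp_smul volume
      (fun w => φ ((τ * √(lam * τ)) • z₁ + w, k₁ • z₁)) k₂,
      integral_add_left_eq_self (fun w => φ (w, k₁ • z₁))]
    rw [abs_of_pos (by positivity)]
    simp
  rw [h1, h2]
  simp_rw [h3]
  rw [integral_const_mul, Measure.integral_comp_smul volume (fun v => ∫ x : Vec d, φ (x, v)) k₁,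
    abs_of_pos (by positivity)]
  simp only [finrank_euclideanSpace, Fintype.card_fin, smul_eq_mul]
  field_simp
  ring

end Smoothing

/-! ### The equation of the kernel and weak second derivatives. -/

section KernelEquation

variable {d : ℕ}

/-- The direction `(τ e, e)`, along which `∇_v + τ ∇_x` differentiates. -/
noncomputable def kineticDir (τ : ℝ) (e : Vec d) : Slice d := (τ • e, e)

/-- First derivative of the Kolmogorov kernel along `kineticDir τ e`. -/
noncomputable def kernelDeriv (lam τ : ℝ) (e : Vec d) (y : Slice d) : ℝ :=
  (inner ℝ y.2 e / τ - 3 * inner ℝ y.1 e / τ ^ 2) / lam * kolmogorovKernel lam τ y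

/-- Second derivative of the Kolmogorov kernel along `kineticDir τ e`. -/
noncomputable def kernelDeriv₂ (lam τ : ℝ) (e : Vec d) (y : Slice d) : ℝ :=
  (((inner ℝ y.2 e / τ - 3 * inner ℝ y.1 e / τ ^ 2) / lam) ^ 2 - 2 * ‖e‖ ^ 2 / (τ * lam)) *
    kolmogorovKernel lam τ y

theorem continuous_kolmogorovKernel (lam τ : ℝ) :
    Continuous (kolmogorovKernel (d := d) lam τ) := by
  unfold kolmogorovKernel; fun_prop

theorem continuous_kernelDeriv₂ (lam τ : ℝ) (e : Vec d) :
    Continuous (kernelDeriv₂ lam τ e) := by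
  have := continuous_kolmogorovKernel (d := d) lam τ
  unfold kernelDeriv₂; fun_prop

theorem hasDerivAt_inner_line (y : Slice d) (τ : ℝ) (e w : Vec d) (r : ℝ) :
    HasDerivAt (fun r : ℝ => inner ℝ (y + r • kineticDir τ e).1 w) (τ * inner ℝ e w) r ∧
    HasDerivAt (fun r : ℝ => inner ℝ (y + r • kineticDir τ e).2 w) (inner ℝ e w) r := by
  constructor
  · simp only [kineticDir, Prod.smul_mk, Prod.fst_add, inner_add_left, inner_smul_left,
      conj_trivial]
    simpa using ((hasDerivAt_id r).mul_const (τ * inner ℝ e w)).const_add (inner ℝ y.1 w)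
  · simp only [kineticDir, Prod.smul_mk, Prod.snd_add, inner_add_left, inner_smul_left,
      conj_trivial]
    simpa using ((hasDerivAt_id r).mul_const (inner ℝ e w)).const_add (inner ℝ y.2 w)

theorem hasDerivAt_kolmogorovKernel_line {lam τ : ℝ} (hl : 0 < lam) (hτ : 0 < τ) (y : Slice d)
    (e : Vec d) (r : ℝ) :
    HasDerivAt (fun r : ℝ => kolmogorovKernel lam τ (y + r • kineticDir τ e))
      (kernelDeriv lam τ e (y + r • kineticDir τ e)) r := by
  have hx : HasDerivAt (fun r : ℝ => (y + r • kineticDir τ e).1) (τ • e) r := by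
    simpa [kineticDir] using ((hasDerivAt_id r).smul_const (τ • e)).const_add y.1
  have hv : HasDerivAt (fun r : ℝ => (y + r • kineticDir τ e).2) e r := by
    simpa [kineticDir] using ((hasDerivAt_id r).smul_const e).const_add y.2
  have h := ((((((hv.norm_sq.div_const τ).sub
    (((hv.inner ℝ hx).const_mul 3).div_const (τ ^ 2))).add
    ((hx.norm_sq.const_mul 3).div_const (τ ^ 3))).neg).div_const lam).exp).const_mul
      ((√3 / (2 * Real.pi * lam * τ ^ 2)) ^ d)
  refine HasDerivAt.congr_deriv h ?_
  unfold kernelDeriv kolmogorovKernel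
  simp only [Pi.add_apply, Pi.sub_apply, Pi.neg_apply]
  set p := (y + r • kineticDir τ e).1
  set q := (y + r • kineticDir τ e).2
  rw [inner_smul_right, inner_smul_right, real_inner_comm p e]
  field_simp
  ring

theorem hasDerivAt_kernelDeriv_line {lam τ : ℝ} (hl : 0 < lam) (hτ : 0 < τ) (y : Slice d)
    (e : Vec d) (r : ℝ) :
    HasDerivAt (fun r : ℝ => kernelDeriv lam τ e (y + r • kineticDir τ e))
      (kernelDeriv₂ lam τ e (y + r • kineticDir τ e)) r := by
  obtain ⟨hx, hv⟩ := hasDerivAt_inner_line y τ e e r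
  have h := ((((hv.div_const τ).sub ((hx.const_mul 3).div_const (τ ^ 2))).div_const lam).mul
    (hasDerivAt_kolmogorovKernel_line hl hτ y e r))
  refine HasDerivAt.congr_deriv h ?_
  unfold kernelDeriv₂ kernelDeriv
  simp only [real_inner_self_eq_norm_sq, Pi.sub_apply]
  field_simp
  ring

theorem sum_inner_single_sq (w : Vec d) :
    ∑ i, (inner ℝ w (EuclideanSpace.single i (1 : ℝ))) ^ 2 = ‖w‖ ^ 2 := by
  rw [EuclideanSpace.real_norm_sq_eq]
  simp [EuclideanSpace.inner_single_right]

/-- The kernel solves `∂_τ K = lam |∇_v + τ ∇_x|² K`. -/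
theorem hasDerivAt_kolmogorovKernel_time {lam τ : ℝ} (hl : 0 < lam) (hτ : 0 < τ) (y : Slice d) :
    HasDerivAt (fun τ => kolmogorovKernel lam τ y)
      (lam * ∑ i, kernelDeriv₂ lam τ (EuclideanSpace.single i 1) y) τ := by
  have hpow : ∀ n : ℕ, HasDerivAt (fun τ : ℝ => (√3 / (2 * Real.pi * lam * τ ^ 2)) ^ n)
      (-2 * n / τ * (√3 / (2 * Real.pi * lam * τ ^ 2)) ^ n) τ := by
    intro n
    have h1 : HasDerivAt (fun τ : ℝ => √3 / (2 * Real.pi * lam * τ ^ 2))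
        (-2 / τ * (√3 / (2 * Real.pi * lam * τ ^ 2))) τ := by
      have h := (hasDerivAt_const τ (√3 : ℝ)).fun_div
        ((hasDerivAt_pow 2 τ).const_mul (2 * Real.pi * lam)) (by positivity)
      refine h.congr_deriv ?_
      simp only [Nat.cast_ofNat, Nat.add_one_sub_one, pow_one]
      field_simp
      ring
    have h := h1.fun_pow n
    refine h.congr_deriv ?_
    rcases n with _ | n
    · simp
    · simp only [Nat.add_sub_cancel, pow_succ]
      push_cast
      ring
  have hexp : HasDerivAt (fun τ : ℝ => Real.exp (-(‖y.2‖ ^ 2 / τ - 3 * inner ℝ y.2 y.1 / τ ^ 2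
      + 3 * ‖y.1‖ ^ 2 / τ ^ 3) / lam))
      ((‖y.2‖ ^ 2 / τ ^ 2 - 6 * inner ℝ y.2 y.1 / τ ^ 3 + 9 * ‖y.1‖ ^ 2 / τ ^ 4) / lam
        * Real.exp (-(‖y.2‖ ^ 2 / τ - 3 * inner ℝ y.2 y.1 / τ ^ 2
      + 3 * ‖y.1‖ ^ 2 / τ ^ 3) / lam)) τ := by
    have h := ((((((hasDerivAt_const τ (‖y.2‖ ^ 2)).fun_div (hasDerivAt_id' τ) hτ.ne').fun_sub
      ((hasDerivAt_const τ (3 * inner ℝ y.2 y.1)).fun_div (hasDerivAt_pow 2 τ)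
        (by positivity))).fun_add
      ((hasDerivAt_const τ (3 * ‖y.1‖ ^ 2)).fun_div (hasDerivAt_pow 3 τ)
        (by positivity))).fun_neg).div_const lam).exp
    refine h.congr_deriv ?_
    rw [mul_comm]
    congr 1
    simp only [Nat.cast_ofNat, Nat.add_one_sub_one, pow_one]
    field_simp
    ring
  have h := (hpow d).fun_mul hexp
  refine h.congr_deriv ?_
  -- Summing over a basis turns the squares into the squared norm of the logarithmic gradient; the
  -- term `2 * d / (τ * lam)` matches the derivative `-2 * d / τ` of the logarithm of the
  -- normalising factor.
  have hsum : ∑ i, kernelDeriv₂ lam τ (EuclideanSpace.single i 1) y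
      = (‖(1 / (τ * lam)) • y.2 - (3 / (τ ^ 2 * lam)) • y.1‖ ^ 2 - 2 * d / (τ * lam))
        * kolmogorovKernel lam τ y := by
    rw [← sum_inner_single_sq]
    unfold kernelDeriv₂
    rw [← Finset.sum_mul]
    congr 1
    rw [Finset.sum_sub_distrib]
    congr 1
    · refine Finset.sum_congr rfl fun i _ => ?_
      rw [inner_sub_left, inner_smul_left, inner_smul_left]
      congr 1
      simp only [conj_trivial]
      field_simp
    · simp
      ring
  rw [hsum, norm_sub_sq_real, norm_smul, norm_smul, inner_smul_left, inner_smul_right, mul_pow,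
    mul_pow]
  simp only [Real.norm_eq_abs, sq_abs, conj_trivial]
  unfold kolmogorovKernel
  field_simp
  ring

theorem smooth_translate (lam τ : ℝ) (H : Slice d → ℝ) (h y : Slice d) :
    smooth lam τ (fun y => H (y + h)) y = smooth lam τ H (y + h) := by
  simp only [smooth, sub_add_eq_add_sub]

/-- `H₂` is the second derivative of `H` in direction `w`, in the sense of second difference
quotients that are uniformly bounded and converge. -/
structure HasSecondDiff (H : Slice d → ℝ) (w : Slice d) (H₂ : Slice d → ℝ) : Prop where
  bound : ∃ C, ∀ y (ε : ℝ), |H (y + ε • w) + H (y - ε • w) - 2 * H y| ≤ C * ε ^ 2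
  tendsto : ∀ y, Tendsto (fun ε : ℝ => (H (y + ε • w) + H (y - ε • w) - 2 * H y) / ε ^ 2)
    (𝓝[>] 0) (𝓝 (H₂ y))

theorem HasSecondDiff.sub {H K H₂ K₂ : Slice d → ℝ} {w : Slice d} (h : HasSecondDiff H w H₂)
    (k : HasSecondDiff K w K₂) :
    HasSecondDiff (fun y => H y - K y) w (fun y => H₂ y - K₂ y) := by
  obtain ⟨C, hC⟩ := h.bound
  obtain ⟨C', hC'⟩ := k.bound
  refine ⟨⟨C + C', fun y ε => ?_⟩, fun y => ?_⟩
  · have := abs_sub (H (y + ε • w) + H (y - ε • w) - 2 * H y)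
      (K (y + ε • w) + K (y - ε • w) - 2 * K y)
    have h1 := hC y ε
    have h2 := hC' y ε
    rw [add_mul]
    refine le_trans (le_of_eq ?_) (this.trans (add_le_add h1 h2))
    congr 1
    ring
  · refine ((h.tendsto y).sub (k.tendsto y)).congr fun ε => ?_
    ring

theorem HasSecondDiff.translate {H H₂ : Slice d → ℝ} {w : Slice d} (h : HasSecondDiff H w H₂)
    (k : Slice d) : HasSecondDiff (fun y => H (y + k)) w (fun y => H₂ (y + k)) := by
  obtain ⟨C, hC⟩ := h.bound
  refine ⟨⟨C, fun y ε => ?_⟩, fun y => ?_⟩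
  · have := hC (y + k) ε
    rwa [add_right_comm y k, add_sub_right_comm y k] at this
  · have := h.tendsto (y + k)
    simpa only [add_right_comm y k, add_sub_right_comm y k] using this

/-- The uniform bound in `HasSecondDiff` dominates the difference quotients under the average. The
limit is used both to integrate by parts and to read off a sign at a maximum. -/
theorem HasSecondDiff.tendsto_smooth {lam τ : ℝ} {H H₂ : Slice d → ℝ} {w : Slice d}
    (h : HasSecondDiff H w H₂) (hH : Continuous H) {B : ℝ} (hB : ∀ y, |H y| ≤ B) (y : Slice d) :
    Tendsto (fun ε : ℝ => (smooth lam τ H (y + ε • w) + smooth lam τ H (y - ε • w)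
      - 2 * smooth lam τ H y) / ε ^ 2) (𝓝[>] 0) (𝓝 (smooth lam τ H₂ y)) := by
  obtain ⟨C, hC⟩ := h.bound
  have hsp := continuous_spread (d := d) lam τ
  have hg := continuous_gaussDensity (d := d)
  have hi := fun y => integrable_smooth hH hB lam τ y
  have key : ∀ ε : ℝ, (smooth lam τ H (y + ε • w) + smooth lam τ H (y - ε • w)
      - 2 * smooth lam τ H y) / ε ^ 2
      = ∫ z, (H (y - spread lam τ z + ε • w) + H (y - spread lam τ z - ε • w)
        - 2 * H (y - spread lam τ z)) / ε ^ 2 * gaussDensity z := by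
    intro ε
    unfold smooth
    rw [← integral_const_mul, ← integral_add (hi _) (hi _),
      ← integral_sub ((hi _).fun_add (hi _)) ((hi _).const_mul 2), ← integral_div]
    congr 1
    ext z
    rw [add_sub_right_comm y, sub_right_comm y]
    ring
  simp_rw [key]
  apply tendsto_integral_filter_of_dominated_convergence (fun z => C * gaussDensity z)
  · refine Eventually.of_forall fun ε => Continuous.aestronglyMeasurable ?_
    fun_prop
  · filter_upwards [self_mem_nhdsWithin] with ε hε
    refine ae_of_all _ fun z => ?_
    have hε' : (0 : ℝ) < ε := hε
    rw [norm_mul, Real.norm_eq_abs, Real.norm_eq_abs, abs_of_pos (gaussDensity_pos z), abs_div,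
      abs_of_pos (by positivity : 0 < ε ^ 2)]
    refine mul_le_mul_of_nonneg_right ?_ (gaussDensity_pos z).le
    rw [div_le_iff₀ (by positivity)]
    exact hC _ _
  · exact integrable_gaussDensity.const_mul C
  · exact ae_of_all _ fun z => (h.tendsto _).mul_const _

/-- A discrete integration by parts. Smoothing commutes with translations, so the second difference
quotient of `smooth lam τ H` can be placed on `H` or on the kernel; the two limits agree. Classical
derivatives of `H` in other directions, which need not exist, are never used. -/
theorem HasSecondDiff.smooth_eq {lam τ : ℝ} (hl : 0 < lam) (hτ : 0 < τ) {H H₂ : Slice d → ℝ}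
    {e : Vec d} (h : HasSecondDiff H (kineticDir τ e) H₂) (hH : Continuous H)
    (hs : HasCompactSupport H) (y : Slice d) :
    smooth lam τ H₂ y = ∫ y', H y' * kernelDeriv₂ lam τ e (y - y') := by
  obtain ⟨B, hB⟩ : ∃ B, ∀ y, |H y| ≤ B := by
    obtain ⟨B, hB⟩ := hs.exists_bound_of_continuous hH
    exact ⟨B, hB⟩
  refine tendsto_nhds_unique (h.tendsto_smooth (lam := lam) (τ := τ) hH hB y) ?_
  have hK := continuous_kolmogorovKernel (d := d) lam τ
  have hK₂ := continuous_kernelDeriv₂ (d := d) lam τ e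
  set w := kineticDir τ e with hw
  have hi : ∀ y, Integrable (fun y' => H y' * kolmogorovKernel lam τ (y - y')) := by
    intro y
    apply Continuous.integrable_of_hasCompactSupport (by fun_prop)
    exact hs.mul_right
  have key : ∀ ε : ℝ, (smooth lam τ H (y + ε • w) + smooth lam τ H (y - ε • w)
      - 2 * smooth lam τ H y) / ε ^ 2
      = ∫ y', H y' * ((kolmogorovKernel lam τ (y - y' + ε • w)
        + kolmogorovKernel lam τ (y - y' - ε • w)
        - 2 * kolmogorovKernel lam τ (y - y')) / ε ^ 2) := by
    intro ε
    simp only [smooth_eq_integral_kernel hl hτ hH hs]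
    rw [← integral_const_mul, ← integral_add (hi _) (hi _),
      ← integral_sub ((hi _).fun_add (hi _)) ((hi _).const_mul 2), ← integral_div]
    congr 1
    ext z
    rw [add_sub_right_comm y, sub_right_comm y]
    ring
  simp_rw [key]
  have hline := fun p : Slice d => hasDerivAt_kolmogorovKernel_line hl hτ p e
  have hline₂ := fun p : Slice d => hasDerivAt_kernelDeriv_line hl hτ p e
  -- A quotient of kernel differences is a second derivative at an intermediate point, so for steps
  -- below `1` a bound over a compact set dominates it.
  obtain ⟨K, hKb⟩ : ∃ K, ∀ p ∈ tsupport H ×ˢ Icc (-1 : ℝ) 1,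
      ‖kernelDeriv₂ lam τ e (y - p.1 + p.2 • w)‖ ≤ K := by
    apply IsCompact.exists_bound_of_continuousOn (hs.isCompact.prod isCompact_Icc)
    exact Continuous.continuousOn (by fun_prop)
  apply tendsto_integral_filter_of_dominated_convergence (fun y' => |H y'| * K)
  · refine Eventually.of_forall fun ε => Continuous.aestronglyMeasurable ?_
    fun_prop
  · filter_upwards [Ioo_mem_nhdsGT (zero_lt_one' ℝ)] with ε hε
    refine ae_of_all _ fun y' => ?_
    have hε' : (0 : ℝ) < ε := hε.1
    rw [norm_mul, Real.norm_eq_abs]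
    by_cases hy : y' ∈ tsupport H
    · refine mul_le_mul_of_nonneg_left ?_ (abs_nonneg _)
      obtain ⟨ξ, hξ, heq⟩ := exists_secondDiff_eq (hline (y - y')) (hline₂ (y - y')) hε'
      simp only [neg_smul, zero_smul, add_zero, ← sub_eq_add_neg] at heq
      rw [heq, mul_div_cancel_left₀ _ (by positivity)]
      exact hKb (y', ξ) ⟨hy, by linarith [hξ.1, hε.2], by linarith [hξ.2, hε.2]⟩
    · simp [image_eq_zero_of_notMem_tsupport hy]
  · apply Integrable.mul_const
    exact (hH.integrable_of_hasCompactSupport hs).abs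
  · refine ae_of_all _ fun y' => Tendsto.const_mul _ ?_
    have := tendsto_secondDiff (hline (y - y')) (hline₂ (y - y'))
      (Continuous.continuousAt (by fun_prop))
    simpa only [neg_smul, zero_smul, add_zero, ← sub_eq_add_neg] using this

end KernelEquation

/-! ### Solutions in straightened coordinates and their smoothing. -/

section StraightSolution

variable {d : ℕ}

/-- Domination for differentiating the convolution in `τ`. The window `[τ / 2, 2 τ]` keeps away from
the singularity at `τ = 0`. -/
theorem exists_kernel_bound {lam τ : ℝ} (hl : 0 < lam) (hτ : 0 < τ) (R : ℝ) (y : Slice d) :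
    ∃ A A₂, ∀ p ∈ Icc (τ / 2) (2 * τ) ×ˢ Metric.closedBall (0 : Slice d) R,
      ‖kolmogorovKernel lam p.1 (y - p.2)‖ ≤ A ∧
      ‖lam * ∑ i, kernelDeriv₂ lam p.1 (EuclideanSpace.single i 1) (y - p.2)‖ ≤ A₂ := by
  have hjoint : ContinuousOn (fun p : ℝ × Slice d => kolmogorovKernel lam p.1 (y - p.2))
      (Icc (τ / 2) (2 * τ) ×ˢ Metric.closedBall 0 R) := by
    have hpos : ∀ p ∈ Icc (τ / 2) (2 * τ) ×ˢ Metric.closedBall (0 : Slice d) R, p.1 ≠ 0 :=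
      fun p hp => by have := hp.1.1; intro h0; rw [h0] at this; linarith
    unfold kolmogorovKernel
    refine ContinuousOn.mul (ContinuousOn.pow (ContinuousOn.div (by fun_prop) (by fun_prop)
      fun p hp => ?_) d) (Real.continuous_exp.comp_continuousOn (ContinuousOn.div_const
      (ContinuousOn.neg (ContinuousOn.add (ContinuousOn.sub
        (ContinuousOn.div (by fun_prop) (by fun_prop) fun p hp => ?_)
        (ContinuousOn.div (by fun_prop) (by fun_prop) fun p hp => ?_))
        (ContinuousOn.div (by fun_prop) (by fun_prop) fun p hp => ?_))) lam))
    all_goals have := hpos p hp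
    all_goals positivity
  have hjoint₂ : ContinuousOn (fun p : ℝ × Slice d =>
      lam * ∑ i, kernelDeriv₂ lam p.1 (EuclideanSpace.single i 1) (y - p.2))
      (Icc (τ / 2) (2 * τ) ×ˢ Metric.closedBall 0 R) := by
    have hpos : ∀ p ∈ Icc (τ / 2) (2 * τ) ×ˢ Metric.closedBall (0 : Slice d) R, p.1 ≠ 0 :=
      fun p hp => by have := hp.1.1; intro h0; rw [h0] at this; linarith
    refine ContinuousOn.mul continuousOn_const (continuousOn_finsetSum _ fun i _ => ?_)
    unfold kernelDeriv₂
    refine ContinuousOn.mul (ContinuousOn.sub (ContinuousOn.pow (ContinuousOn.div_const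
      (ContinuousOn.sub (ContinuousOn.div (by fun_prop) (by fun_prop) fun p hp => ?_)
      (ContinuousOn.div (by fun_prop) (by fun_prop) fun p hp => ?_)) lam) 2)
      (ContinuousOn.div (by fun_prop) (by fun_prop) fun p hp => ?_)) hjoint
    all_goals have := hpos p hp
    all_goals positivity
  have hcpt : IsCompact (Icc (τ / 2) (2 * τ) ×ˢ Metric.closedBall (0 : Slice d) R) :=
    isCompact_Icc.prod (isCompact_closedBall 0 R)
  obtain ⟨A, hA⟩ := hcpt.exists_bound_of_continuousOn hjoint
  obtain ⟨A₂, hA₂⟩ := hcpt.exists_bound_of_continuousOn hjoint₂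
  exact ⟨A, A₂, fun p hp => ⟨hA p hp, hA₂ p hp⟩⟩

/-- Solutions of the kinetic equation in coordinates straightened along the transport field, with
time counted backwards from a final time: `F τ (x, v) = f (t - τ, x - τ v, v)`. Here `F₁` is the
transport derivative, `F₂ τ e` the second derivative in `v` in direction `e`, and the diffusion
matrix at time `τ` is `lam Id + ∑ k, u τ k ⊗ u τ k`. -/
structure StraightSolution (lam : ℝ) (u : ℝ → Fin d → Vec d) (F F₁ G : ℝ → Slice d → ℝ)
    (F₂ : ℝ → Vec d → Slice d → ℝ) : Prop where
  continuousOn : ContinuousOn (fun p : ℝ × Slice d => F p.1 p.2) (Ici 0 ×ˢ univ)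
  continuous₁ : ∀ τ > 0, Continuous (F₁ τ)
  continuous₂ : ∀ τ > 0, ∀ e, Continuous (F₂ τ e)
  bound : ∃ B, ∀ τ ≥ 0, ∀ y, |F τ y| ≤ B
  bound₁ : ∃ B, ∀ τ > 0, ∀ y, |F₁ τ y| ≤ B
  bound₂ : ∀ e, ∃ B, ∀ τ > 0, ∀ y, |F₂ τ e y| ≤ B
  support : ∃ R, ∀ τ ≥ 0, ∀ y, R < ‖y‖ → F τ y = 0 ∧ F₁ τ y = 0 ∧ ∀ e, F₂ τ e y = 0
  hasDerivAt : ∀ τ > 0, ∀ y, HasDerivAt (fun τ => F τ y) (-F₁ τ y) τ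
  secondDiff : ∀ τ > 0, ∀ e, HasSecondDiff (F τ) (kineticDir τ e) (F₂ τ e)
  equation : ∀ τ > 0, ∀ y, F₁ τ y = lam * ∑ i, F₂ τ (EuclideanSpace.single i 1) y
    + ∑ k, F₂ τ (u τ k) y + G τ y
  initial : ∀ τ ≥ 1, ∀ y, F τ y = 0

namespace StraightSolution

variable {lam : ℝ} {u : ℝ → Fin d → Vec d} {F F₁ G K K₁ J : ℝ → Slice d → ℝ}
  {F₂ K₂ : ℝ → Vec d → Slice d → ℝ}

theorem continuous (h : StraightSolution lam u F F₁ G F₂) {τ : ℝ} (hτ : 0 ≤ τ) :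
    Continuous (F τ) := by
  have := h.continuousOn.comp (f := fun y : Slice d => (τ, y)) (s := univ) (by fun_prop)
    (fun y _ => ⟨hτ, mem_univ _⟩)
  exact continuousOn_univ.mp this

theorem sub (h : StraightSolution lam u F F₁ G F₂) (k : StraightSolution lam u K K₁ J K₂) :
    StraightSolution lam u (fun τ y => F τ y - K τ y) (fun τ y => F₁ τ y - K₁ τ y)
      (fun τ y => G τ y - J τ y) (fun τ e y => F₂ τ e y - K₂ τ e y) where
  continuousOn := h.continuousOn.sub k.continuousOn
  continuous₁ τ hτ := (h.continuous₁ τ hτ).sub (k.continuous₁ τ hτ)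
  continuous₂ τ hτ e := (h.continuous₂ τ hτ e).sub (k.continuous₂ τ hτ e)
  bound := by
    obtain ⟨B, hB⟩ := h.bound
    obtain ⟨B', hB'⟩ := k.bound
    exact ⟨B + B', fun τ hτ y => (abs_sub _ _).trans (add_le_add (hB τ hτ y) (hB' τ hτ y))⟩
  bound₁ := by
    obtain ⟨B, hB⟩ := h.bound₁
    obtain ⟨B', hB'⟩ := k.bound₁
    exact ⟨B + B', fun τ hτ y => (abs_sub _ _).trans (add_le_add (hB τ hτ y) (hB' τ hτ y))⟩
  bound₂ e := by
    obtain ⟨B, hB⟩ := h.bound₂ e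
    obtain ⟨B', hB'⟩ := k.bound₂ e
    exact ⟨B + B', fun τ hτ y => (abs_sub _ _).trans (add_le_add (hB τ hτ y) (hB' τ hτ y))⟩
  support := by
    obtain ⟨R, hR⟩ := h.support
    obtain ⟨R', hR'⟩ := k.support
    refine ⟨max R R', fun τ hτ y hy => ?_⟩
    obtain ⟨h0, h1, h2⟩ := hR τ hτ y ((le_max_left _ _).trans_lt hy)
    obtain ⟨k0, k1, k2⟩ := hR' τ hτ y ((le_max_right _ _).trans_lt hy)
    exact ⟨by rw [h0, k0, sub_zero], by rw [h1, k1, sub_zero],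
      fun e => by rw [h2 e, k2 e, sub_zero]⟩
  hasDerivAt τ hτ y :=
    ((h.hasDerivAt τ hτ y).fun_sub (k.hasDerivAt τ hτ y)).congr_deriv (by ring)
  secondDiff τ hτ e := (h.secondDiff τ hτ e).sub (k.secondDiff τ hτ e)
  equation τ hτ y := by
    rw [h.equation τ hτ y, k.equation τ hτ y, Finset.sum_sub_distrib, Finset.sum_sub_distrib]
    ring
  initial τ hτ y := by rw [h.initial τ hτ y, k.initial τ hτ y, sub_zero]

theorem translate (h : StraightSolution lam u F F₁ G F₂) (a : Slice d) :
    StraightSolution lam u (fun τ y => F τ (y + a)) (fun τ y => F₁ τ (y + a))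
      (fun τ y => G τ (y + a)) (fun τ e y => F₂ τ e (y + a)) where
  continuousOn := h.continuousOn.comp (f := fun p : ℝ × Slice d => (p.1, p.2 + a))
    (by fun_prop) (fun p hp => ⟨hp.1, mem_univ _⟩)
  continuous₁ τ hτ := (h.continuous₁ τ hτ).comp (by fun_prop)
  continuous₂ τ hτ e := (h.continuous₂ τ hτ e).comp (by fun_prop)
  bound := h.bound.imp fun B hB τ hτ y => hB τ hτ _
  bound₁ := h.bound₁.imp fun B hB τ hτ y => hB τ hτ _
  bound₂ e := (h.bound₂ e).imp fun B hB τ hτ y => hB τ hτ _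
  support := by
    obtain ⟨R, hR⟩ := h.support
    refine ⟨R + ‖a‖, fun τ hτ y hy => hR τ hτ _ ?_⟩
    have := norm_sub_le (y + a) a
    rw [add_sub_cancel_right] at this
    linarith
  hasDerivAt τ hτ y := h.hasDerivAt τ hτ _
  secondDiff τ hτ e := (h.secondDiff τ hτ e).translate a
  equation τ hτ y := h.equation τ hτ _
  initial τ hτ y := h.initial τ hτ _

theorem hasCompactSupport (h : StraightSolution lam u F F₁ G F₂) {τ : ℝ} (hτ : 0 ≤ τ) :
    HasCompactSupport (F τ) ∧ HasCompactSupport (F₁ τ) ∧ ∀ e, HasCompactSupport (F₂ τ e) := by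
  obtain ⟨R, hR⟩ := h.support
  have key : ∀ y, y ∉ Metric.closedBall (0 : Slice d) R → R < ‖y‖ := by
    intro y hy
    simpa using hy
  refine ⟨?_, ?_, fun e => ?_⟩
  · exact HasCompactSupport.intro (isCompact_closedBall 0 R) fun y hy => (hR τ hτ y (key y hy)).1
  · exact HasCompactSupport.intro (isCompact_closedBall 0 R) fun y hy => (hR τ hτ y (key y hy)).2.1
  · exact HasCompactSupport.intro (isCompact_closedBall 0 R)
      fun y hy => (hR τ hτ y (key y hy)).2.2 e

/-- Integrability of the source is not part of the structure: the source is recovered from the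
equation as a combination of integrable terms. -/
theorem smooth_equation (h : StraightSolution lam u F F₁ G F₂) {τ : ℝ} (hτ : 0 < τ)
    (y : Slice d) :
    smooth lam τ (F₁ τ) y = lam * ∑ i, smooth lam τ (F₂ τ (EuclideanSpace.single i 1)) y
      + ∑ k, smooth lam τ (F₂ τ (u τ k)) y + smooth lam τ (G τ) y := by
  obtain ⟨B₁, hB₁⟩ := h.bound₁
  have hi₁ := integrable_smooth (h.continuous₁ τ hτ) (hB₁ τ hτ) lam τ y
  have hi₂ : ∀ e, Integrable
      (fun z => F₂ τ e (y - spread lam τ z) * gaussDensity z) := by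
    intro e
    obtain ⟨B₂, hB₂⟩ := h.bound₂ e
    exact integrable_smooth (h.continuous₂ τ hτ e) (hB₂ τ hτ) lam τ y
  have hG : ∀ y, G τ y = F₁ τ y - (lam * ∑ i, F₂ τ (EuclideanSpace.single i 1) y
      + ∑ k, F₂ τ (u τ k) y) := by
    intro y
    rw [h.equation τ hτ y]
    ring
  have hs : smooth lam τ (G τ) y = smooth lam τ (F₁ τ) y
      - (lam * ∑ i, smooth lam τ (F₂ τ (EuclideanSpace.single i 1)) y
      + ∑ k, smooth lam τ (F₂ τ (u τ k)) y) := by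
    unfold smooth
    rw [← integral_finsetSum _ fun i _ => hi₂ _, ← integral_finsetSum _ fun i _ => hi₂ _,
      ← integral_const_mul, ← integral_add, ← integral_sub hi₁]
    · congr 1
      ext z
      rw [hG, sub_mul, add_mul, mul_assoc, Finset.sum_mul, Finset.sum_mul]
    · exact ((integrable_finsetSum _ fun i _ => hi₂ _).const_mul lam).add
        (integrable_finsetSum _ fun i _ => hi₂ _)
    · exact (integrable_finsetSum _ fun i _ => hi₂ _).const_mul lam
    · exact integrable_finsetSum _ fun i _ => hi₂ _
  rw [hs]
  ring

/-- The central cancellation. The derivative of the kernel contributes `lam` times the smoothed sum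
of the basic second derivatives, by `smooth_eq`; the derivative of `F` contributes `-smooth lam τ
(F₁ τ)`, which contains the same term with the opposite sign. What remains is the part with the `u τ
k` and the source. -/
theorem hasDerivAt_smooth (hl : 0 < lam) (h : StraightSolution lam u F F₁ G F₂) {τ : ℝ}
    (hτ : 0 < τ) (y : Slice d) :
    HasDerivAt (fun τ => smooth lam τ (F τ) y)
      (-(∑ k, smooth lam τ (F₂ τ (u τ k)) y + smooth lam τ (G τ) y)) τ := by
  obtain ⟨B, hB⟩ := h.bound
  obtain ⟨B₁, hB₁⟩ := h.bound₁
  obtain ⟨R, hR⟩ := h.support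
  have hKc := fun τ => continuous_kolmogorovKernel (d := d) lam τ
  have hK₂c := fun τ (e : Vec d) => continuous_kernelDeriv₂ lam τ e
  set N : ℝ → Slice d → ℝ :=
    fun τ p => lam * ∑ i, kernelDeriv₂ lam τ (EuclideanSpace.single i 1) p with hN
  have hNc : ∀ τ, Continuous (N τ) := fun τ => by simp only [hN]; fun_prop
  obtain ⟨A, A₂, hAA⟩ := exists_kernel_bound hl hτ R y
  have hnhds : Ioo (τ / 2) (2 * τ) ∈ 𝓝 τ := Ioo_mem_nhds (by linarith) (by linarith)
  have hcs := fun {τ : ℝ} (hτ : 0 < τ) => h.hasCompactSupport hτ.le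
  have hI : ∀ {H P : Slice d → ℝ}, Continuous H → HasCompactSupport H → Continuous P →
      Integrable (fun y' => H y' * P (y - y')) := by
    intro H P hH hs hP
    exact Continuous.integrable_of_hasCompactSupport (by fun_prop) hs.mul_right
  have hmain := hasDerivAt_integral_of_dominated_loc_of_deriv_le (μ := (volume : Measure (Slice d)))
    (F := fun τ y' => F τ y' * kolmogorovKernel lam τ (y - y'))
    (F' := fun τ y' => -F₁ τ y' * kolmogorovKernel lam τ (y - y') + F τ y' * N τ (y - y'))
    (bound := (Metric.closedBall (0 : Slice d) R).indicator fun _ => B₁ * A + B * A₂)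
    (x₀ := τ) hnhds ?_ (hI (h.continuous hτ.le) (hcs hτ).1 (hKc τ)) ?_ ?_ ?_ ?_
  · have h2 := hmain.2
    have heq : (fun τ => smooth lam τ (F τ) y) =ᶠ[𝓝 τ]
        fun τ => ∫ y', F τ y' * kolmogorovKernel lam τ (y - y') := by
      filter_upwards [Ioi_mem_nhds hτ] with r hr
      exact smooth_eq_integral_kernel hl hr (h.continuous (le_of_lt hr)) (hcs hr).1 y
    refine (h2.congr_of_eventuallyEq heq).congr_deriv ?_
    have hi2 : ∀ e, Integrable (fun y' => F τ y' * kernelDeriv₂ lam τ e (y - y')) := fun e =>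
      hI (h.continuous hτ.le) (hcs hτ).1 (hK₂c τ e)
    rw [integral_add]
    · have e1 : ∫ y', -F₁ τ y' * kolmogorovKernel lam τ (y - y') = - smooth lam τ (F₁ τ) y := by
        rw [smooth_eq_integral_kernel hl hτ (h.continuous₁ τ hτ) (hcs hτ).2.1, ← integral_neg]
        simp
      have e2 : ∫ y', F τ y' * N τ (y - y')
          = lam * ∑ i, smooth lam τ (F₂ τ (EuclideanSpace.single i 1)) y := by
        simp_rw [fun i => (h.secondDiff τ hτ (EuclideanSpace.single i 1)).smooth_eq hl hτ
          (h.continuous hτ.le) (hcs hτ).1 y]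
        rw [← integral_finsetSum _ fun i _ => hi2 _, ← integral_const_mul]
        congr 1
        ext y'
        simp only [hN]
        rw [← Finset.mul_sum]
        ring
      rw [e1, e2, h.smooth_equation hτ]
      ring
    · exact hI (h.continuous₁ τ hτ).neg (hcs hτ).2.1.neg (hKc τ)
    · exact hI (h.continuous hτ.le) (hcs hτ).1 (hNc τ)
  · filter_upwards [Ioi_mem_nhds hτ] with r hr
    exact (hI (h.continuous (le_of_lt hr)) (hcs hr).1 (hKc r)).aestronglyMeasurable
  · exact ((hI (h.continuous₁ τ hτ).neg (hcs hτ).2.1.neg (hKc τ)).add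
      (hI (h.continuous hτ.le) (hcs hτ).1 (hNc τ))).aestronglyMeasurable
  · refine ae_of_all _ fun y' r hr => ?_
    have hr0 : 0 < r := by linarith [hr.1]
    by_cases hy : y' ∈ Metric.closedBall (0 : Slice d) R
    · rw [indicator_of_mem hy]
      have m : (r, y') ∈ Icc (τ / 2) (2 * τ) ×ˢ Metric.closedBall (0 : Slice d) R :=
        ⟨⟨hr.1.le, hr.2.le⟩, hy⟩
      refine (norm_add_le _ _).trans (add_le_add ?_ ?_)
      · rw [norm_mul, norm_neg]
        exact mul_le_mul (hB₁ r hr0 y') (hAA _ m).1 (norm_nonneg _)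
          ((abs_nonneg _).trans (hB₁ r hr0 y'))
      · rw [norm_mul]
        exact mul_le_mul (hB r hr0.le y') (hAA _ m).2 (norm_nonneg _)
          ((abs_nonneg _).trans (hB r hr0.le y'))
    · rw [indicator_of_notMem hy]
      obtain ⟨h0, h1, -⟩ := hR r hr0.le y' (by simpa using hy)
      simp [h0, h1]
  · rw [integrable_indicator_iff measurableSet_closedBall]
    exact integrableOn_const (isCompact_closedBall _ _).measure_lt_top.ne
  · refine ae_of_all _ fun y' r hr => ?_
    have hr0 : 0 < r := by linarith [hr.1]
    exact (h.hasDerivAt r hr0 y').fun_mul (hasDerivAt_kolmogorovKernel_time hl hr0 (y - y'))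

end StraightSolution

end StraightSolution

/-! ### The maximum principle for the smoothed solution. -/

section MaximumPrinciple

variable {d : ℕ}

theorem continuous_smooth {H : Slice d → ℝ} (hH : Continuous H) {B : ℝ} (hB : ∀ y, |H y| ≤ B)
    (lam τ : ℝ) : Continuous (smooth lam τ H) := by
  have hsp := continuous_spread (d := d) lam τ
  have hg := continuous_gaussDensity (d := d)
  refine continuous_of_dominated (bound := fun z => B * gaussDensity z) (fun y => ?_) (fun y => ?_)
    (integrable_gaussDensity.const_mul B) (ae_of_all _ fun z => by fun_prop)
  · exact (integrable_smooth hH hB lam τ y).aestronglyMeasurable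
  · refine ae_of_all _ fun z => ?_
    rw [norm_mul, Real.norm_eq_abs, Real.norm_eq_abs, abs_of_pos (gaussDensity_pos z)]
    exact mul_le_mul_of_nonneg_right (hB _) (gaussDensity_pos z).le

theorem tendsto_smooth_cocompact {H : Slice d → ℝ} (hH : Continuous H) (hs : HasCompactSupport H)
    (lam τ : ℝ) : Tendsto (smooth lam τ H) (cocompact (Slice d)) (𝓝 0) := by
  obtain ⟨B, hB⟩ := hs.exists_bound_of_continuous hH
  -- Dominated convergence along a filter needs it countably generated.
  have hcg : (cocompact (Slice d)).IsCountablyGenerated := by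
    rw [← Metric.cobounded_eq_cocompact, ← comap_norm_atTop]
    infer_instance
  have h0 : (0 : ℝ) = ∫ z : Slice d, (0 : ℝ) * gaussDensity z := by simp
  rw [h0]
  refine tendsto_integral_filter_of_dominated_convergence (fun z => B * gaussDensity z)
    (Eventually.of_forall fun y => (integrable_smooth hH hB lam τ y).aestronglyMeasurable)
    (Eventually.of_forall fun y => ae_of_all _ fun z => ?_) (integrable_gaussDensity.const_mul B)
    (ae_of_all _ fun z => Tendsto.mul_const _ ?_)
  · rw [norm_mul, Real.norm_eq_abs, Real.norm_eq_abs, abs_of_pos (gaussDensity_pos z)]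
    exact mul_le_mul_of_nonneg_right (hB _) (gaussDensity_pos z).le
  · exact hs.is_zero_at_infty.comp (Homeomorph.subRight (spread lam τ z)).isClosedEmbedding.tendsto_cocompact

/-- The positive part of the maximum of the smoothed solution. -/
noncomputable def peak (lam : ℝ) (F : ℝ → Slice d → ℝ) (τ : ℝ) : ℝ :=
  ⨆ y, max (smooth lam τ (F τ) y) 0

theorem peak_nonneg (lam : ℝ) (F : ℝ → Slice d → ℝ) (τ : ℝ) : 0 ≤ peak lam F τ :=
  Real.iSup_nonneg fun _ => le_max_right _ _

theorem peak_le {lam : ℝ} {F : ℝ → Slice d → ℝ} {τ b : ℝ} (hb : 0 ≤ b)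
    (h : ∀ y, smooth lam τ (F τ) y ≤ b) : peak lam F τ ≤ b :=
  ciSup_le fun y => max_le (h y) hb

namespace StraightSolution

variable {lam : ℝ} {u : ℝ → Fin d → Vec d} {F F₁ G : ℝ → Slice d → ℝ}
  {F₂ : ℝ → Vec d → Slice d → ℝ}

theorem le_peak (h : StraightSolution lam u F F₁ G F₂) {τ : ℝ} (hτ : 0 ≤ τ) (y : Slice d) :
    smooth lam τ (F τ) y ≤ peak lam F τ := by
  obtain ⟨B, hB⟩ := h.bound
  refine (le_max_left _ (0 : ℝ)).trans (le_ciSup (f := fun y => max (smooth lam τ (F τ) y) 0) ?_ y)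
  refine ⟨max B 0, ?_⟩
  rintro _ ⟨y, rfl⟩
  exact max_le_max ((le_abs_self _).trans (abs_smooth_le (hB τ hτ) lam τ y)) le_rfl

/-- The smoothed solution is positive everywhere in general position only where `F` is felt: it
decays at infinity, so a positive supremum is attained. -/
theorem exists_eq_peak (h : StraightSolution lam u F F₁ G F₂) {τ : ℝ} (hτ : 0 ≤ τ)
    (hp : 0 < peak lam F τ) : ∃ y, smooth lam τ (F τ) y = peak lam F τ := by
  obtain ⟨B, hB⟩ := h.bound
  have hc := continuous_smooth (h.continuous hτ) (hB τ hτ) lam τ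
  obtain ⟨y₀, hy₀⟩ : ∃ y₀, 0 < smooth lam τ (F τ) y₀ := by
    by_contra hcon
    push Not at hcon
    exact absurd (peak_le le_rfl hcon) (not_le.mpr hp)
  have hev : ∀ᶠ y in cocompact (Slice d), smooth lam τ (F τ) y ≤ smooth lam τ (F τ) y₀ :=
    ((tendsto_smooth_cocompact (h.continuous hτ) (h.hasCompactSupport hτ).1 lam
      τ).eventually_lt_const hy₀).mono fun _ => le_of_lt
  obtain ⟨y, hy⟩ := hc.exists_forall_ge' y₀ hev
  exact ⟨y, le_antisymm (h.le_peak hτ y) (peak_le (hy₀.le.trans (hy y₀)) hy)⟩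

/-- Second differences centred at a maximum are nonpositive, and their scaled limit is the smoothed
second derivative. -/
theorem smooth_second_nonpos (h : StraightSolution lam u F F₁ G F₂) {τ : ℝ} (hτ : 0 < τ)
    {y : Slice d} (hy : ∀ y', smooth lam τ (F τ) y' ≤ smooth lam τ (F τ) y) (e : Vec d) :
    smooth lam τ (F₂ τ e) y ≤ 0 := by
  obtain ⟨B, hB⟩ := h.bound
  refine le_of_tendsto ((h.secondDiff τ hτ e).tendsto_smooth (lam := lam) (h.continuous hτ.le)
    (hB τ hτ.le) y) (Eventually.of_forall fun ε => ?_)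
  refine div_nonpos_of_nonpos_of_nonneg ?_ (sq_nonneg ε)
  linarith [hy (y + ε • kineticDir τ e), hy (y - ε • kineticDir τ e)]

/-- The smoothed solution is Lipschitz in `τ` uniformly in `y`, and a supremum of such functions is
Lipschitz with the same constant. -/
theorem continuousOn_peak (hl : 0 < lam) (h : StraightSolution lam u F F₁ G F₂) :
    ContinuousOn (peak lam F) (Ioi 0) := by
  obtain ⟨B₁, hB₁⟩ := h.bound₁
  choose B₂ hB₂ using h.bound₂
  set K := B₁ + lam * ∑ i, B₂ (EuclideanSpace.single i 1) with hK
  have hU : ∀ y, ∀ τ ∈ Ioi (0 : ℝ), ∀ σ ∈ Ioi (0 : ℝ),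
      |smooth lam σ (F σ) y - smooth lam τ (F τ) y| ≤ K * |σ - τ| := by
    intro y τ hτ σ hσ
    refine Convex.norm_image_sub_le_of_norm_hasDerivWithin_le
      (fun τ hτ => (h.hasDerivAt_smooth hl hτ y).hasDerivWithinAt) (fun τ hτ => ?_)
      (convex_Ioi 0) hτ hσ
    -- Rewriting the rate through the equation removes `u τ k` and `G τ`, for which no bound uniform
    -- in `τ` is at hand.
    have e : -(∑ k, smooth lam τ (F₂ τ (u τ k)) y + smooth lam τ (G τ) y)
        = lam * ∑ i, smooth lam τ (F₂ τ (EuclideanSpace.single i 1)) y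
          - smooth lam τ (F₁ τ) y := by
      rw [h.smooth_equation hτ]; ring
    rw [e]
    refine (norm_sub_le _ _).trans ?_
    rw [hK, add_comm B₁]
    refine add_le_add ?_ (abs_smooth_le (hB₁ τ hτ) lam τ y)
    rw [norm_mul, Real.norm_of_nonneg hl.le]
    refine mul_le_mul_of_nonneg_left ((norm_sum_le _ _).trans (Finset.sum_le_sum fun i _ => ?_)) hl.le
    exact abs_smooth_le (hB₂ _ τ hτ) lam τ y
  have hK0 : 0 ≤ K := by
    have := hU 0 1 (by simp) 2 (by simp)
    norm_num at this
    exact (abs_nonneg _).trans this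
  have hlip : ∀ τ ∈ Ioi (0 : ℝ), ∀ σ ∈ Ioi (0 : ℝ), peak lam F σ ≤ peak lam F τ + K * |σ - τ| := by
    intro τ hτ σ hσ
    refine peak_le (add_nonneg (peak_nonneg _ _ _) (by positivity)) fun y => ?_
    have h1 := hU y τ hτ σ hσ
    have h2 := h.le_peak (le_of_lt hτ) y
    linarith [le_abs_self (smooth lam σ (F σ) y - smooth lam τ (F τ) y)]
  refine (LipschitzOnWith.of_dist_le_mul (K := K.toNNReal) fun σ hσ τ hτ => ?_).continuousOn
  rw [Real.coe_toNNReal K hK0, Real.dist_eq, Real.dist_eq, abs_sub_le_iff]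
  have h1 := hlip τ hτ σ hσ
  have h2 := hlip σ hσ τ hτ
  rw [abs_sub_comm] at h2
  exact ⟨by linarith, by linarith⟩

/-- The maximum principle: the peak of the smoothed solution grows at most at the rate of the
smoothed source. -/
theorem peak_le_add (hl : 0 < lam) (h : StraightSolution lam u F F₁ G F₂) {τ₁ τ₂ : ℝ}
    (h1 : 0 < τ₁) (h12 : τ₁ ≤ τ₂) {β β' : ℝ → ℝ}
    (hβ : ∀ τ ∈ Icc τ₁ τ₂, HasDerivAt β (β' τ) τ) (hβ' : ∀ τ ∈ Icc τ₁ τ₂, 0 ≤ β' τ)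
    (hG : ∀ τ ∈ Icc τ₁ τ₂, ∀ y, smooth lam τ (G τ) y ≤ β' τ) :
    peak lam F τ₁ ≤ peak lam F τ₂ + (β τ₂ - β τ₁) := by
  -- The supremum need not be differentiable, so `-peak` is compared with a primitive of the rate by
  -- bounding its right slopes.
  have key := image_le_of_liminf_slope_right_le_deriv_boundary (f := fun τ => -peak lam F τ)
    (a := τ₁) (b := τ₂) (B := fun τ => β τ - β τ₁ - peak lam F τ₁) (B' := β')
    ((h.continuousOn_peak hl).neg.mono fun τ hτ => h1.trans_le hτ.1) (by simp)
    (fun τ hτ => (((hβ τ hτ).continuousAt.sub continuousAt_const).sub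
      continuousAt_const).continuousWithinAt)
    (fun τ hτ => (((hβ τ ⟨hτ.1, hτ.2.le⟩).sub_const (β τ₁)).sub_const
      (peak lam F τ₁)).hasDerivWithinAt) ?_ (right_mem_Icc.mpr h12)
  · linarith [key]
  intro τ hτ r hr
  have hτ0 : 0 < τ := h1.trans_le hτ.1
  have hτI : τ ∈ Icc τ₁ τ₂ := ⟨hτ.1, hτ.2.le⟩
  apply Eventually.frequently
  -- If the peak is zero, nonnegativity of later peaks makes the right slope of `-peak` nonpositive.
  -- Otherwise it is attained at some `y`, and the slope is at most that of minus the smoothed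
  -- solution at this fixed `y`.
  rcases (peak_nonneg lam F τ).eq_or_lt with hp | hp
  · filter_upwards [self_mem_nhdsWithin] with z hz
    have hz' : 0 < z - τ := sub_pos.mpr hz
    rw [slope_def_field, ← hp]
    refine lt_of_le_of_lt ?_ ((hβ' τ hτI).trans_lt hr)
    refine div_nonpos_of_nonpos_of_nonneg ?_ hz'.le
    linarith [peak_nonneg lam F z]
  · obtain ⟨y, hy⟩ := h.exists_eq_peak hτ0.le hp
    have hmax : ∀ y', smooth lam τ (F τ) y' ≤ smooth lam τ (F τ) y := fun y' => by
      rw [hy]; exact h.le_peak hτ0.le y'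
    have hd := (h.hasDerivAt_smooth hl hτ0 y).neg
    have hlt : -(-(∑ k, smooth lam τ (F₂ τ (u τ k)) y + smooth lam τ (G τ) y)) < r := by
      have : ∑ k, smooth lam τ (F₂ τ (u τ k)) y ≤ 0 :=
        Finset.sum_nonpos fun k _ => h.smooth_second_nonpos hτ0 hmax _
      linarith [hG τ hτI y]
    have hs := (hasDerivAt_iff_tendsto_slope.mp hd).mono_left
      (nhdsWithin_mono τ fun z hz => (ne_of_gt hz : z ≠ τ))
    filter_upwards [hs.eventually_lt_const hlt, self_mem_nhdsWithin] with z hz hzτ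
    refine lt_of_le_of_lt ?_ hz
    have hz' : 0 < z - τ := sub_pos.mpr hzτ
    rw [slope_def_field, slope_def_field]
    refine div_le_div_of_nonneg_right ?_ hz'.le
    simp only [Pi.neg_apply]
    rw [hy]
    linarith [h.le_peak (hτ0.trans hzτ).le y]

theorem peak_eq_zero (h : StraightSolution lam u F F₁ G F₂) {τ : ℝ} (hτ : 1 ≤ τ) :
    peak lam F τ = 0 := by
  refine le_antisymm (peak_le le_rfl fun y => ?_) (peak_nonneg _ _ _)
  simp [smooth, h.initial τ hτ]

/-- As `τ → 0` the map `spread lam τ` shrinks to zero, so the averages converge to `F 0 y` by joint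
continuity up to `τ = 0`. -/
theorem le_of_peak_le (h : StraightSolution lam u F F₁ G F₂) {b δ : ℝ} (hδ : 0 < δ)
    (hb : ∀ τ ∈ Ioo 0 δ, peak lam F τ ≤ b) (y : Slice d) : F 0 y ≤ b := by
  obtain ⟨B, hB⟩ := h.bound
  have hlim : Tendsto (fun τ => smooth lam τ (F τ) y) (𝓝[>] 0)
      (𝓝 (∫ z : Slice d, F 0 y * gaussDensity z)) := by
    refine tendsto_integral_filter_of_dominated_convergence (fun z => B * gaussDensity z)
      ?_ ?_ (integrable_gaussDensity.const_mul B) (ae_of_all _ fun z => Tendsto.mul_const _ ?_)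
    · filter_upwards [self_mem_nhdsWithin] with τ hτ
      exact (integrable_smooth (h.continuous (le_of_lt hτ)) (hB τ (le_of_lt hτ)) lam τ
        y).aestronglyMeasurable
    · filter_upwards [self_mem_nhdsWithin] with τ hτ
      refine ae_of_all _ fun z => ?_
      rw [norm_mul, Real.norm_eq_abs, Real.norm_eq_abs, abs_of_pos (gaussDensity_pos z)]
      exact mul_le_mul_of_nonneg_right (hB τ (le_of_lt hτ) _) (gaussDensity_pos z).le
    · have hc : Tendsto (fun p : ℝ × Slice d => F p.1 p.2) (𝓝[Ici 0 ×ˢ univ] (0, y))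
          (𝓝 (F 0 y)) := h.continuousOn (0, y) ⟨self_mem_Ici, mem_univ _⟩
      refine hc.comp (f := fun τ : ℝ => (τ, y - spread lam τ z)) ?_
      refine tendsto_nhdsWithin_iff.mpr ⟨?_, ?_⟩
      · have hcont : Continuous fun τ : ℝ => (τ, y - spread lam τ z) := by
          unfold spread; fun_prop
        have := hcont.tendsto 0
        have h0 : spread lam 0 z = 0 := by simp [spread]
        rw [h0, sub_zero] at this
        exact this.mono_left nhdsWithin_le_nhds
      · filter_upwards [self_mem_nhdsWithin] with τ hτ
        exact ⟨Ioi_subset_Ici_self hτ, mem_univ _⟩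
  rw [integral_const_mul, integral_gaussDensity, mul_one] at hlim
  refine le_of_tendsto hlim ?_
  filter_upwards [Ioo_mem_nhdsGT hδ] with τ hτ
  exact (h.le_peak hτ.1.le y).trans (hb τ hτ)

end StraightSolution

end MaximumPrinciple

/-! ### Finite differences of the Gaussian. -/

section GaussianDifferences

variable {d : ℕ}

/-- The Euclidean inner product on `ℝᵈ × ℝᵈ`. -/
noncomputable def sliceInner (a z : Slice d) : ℝ := inner ℝ a.1 z.1 + inner ℝ a.2 z.2

theorem abs_sliceInner_le (a z : Slice d) : |sliceInner a z| ≤ 2 * ‖a‖ * ‖z‖ := by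
  have h1 : |inner ℝ a.1 z.1| ≤ ‖a‖ * ‖z‖ := (abs_real_inner_le_norm _ _).trans
    (mul_le_mul (norm_fst_le a) (norm_fst_le z) (norm_nonneg _) (norm_nonneg _))
  have h2 : |inner ℝ a.2 z.2| ≤ ‖a‖ * ‖z‖ := (abs_real_inner_le_norm _ _).trans
    (mul_le_mul (norm_snd_le a) (norm_snd_le z) (norm_nonneg _) (norm_nonneg _))
  have := abs_add_le (inner ℝ a.1 z.1) (inner ℝ a.2 z.2)
  unfold sliceInner
  linarith

theorem hasDerivAt_sliceInner_line (a z w : Slice d) (r : ℝ) :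
    HasDerivAt (fun r : ℝ => sliceInner a (z + r • w)) (sliceInner a w) r := by
  have e : (fun r : ℝ => sliceInner a (z + r • w))
      = fun r => sliceInner a z + r * sliceInner a w := by
    ext r
    simp only [sliceInner, Prod.fst_add, Prod.snd_add, Prod.smul_fst, Prod.smul_snd,
      inner_add_right, inner_smul_right]
    ring
  rw [e]
  simpa using ((hasDerivAt_id r).mul_const (sliceInner a w)).const_add (sliceInner a z)

theorem hasDerivAt_gaussDensity_line (z a : Slice d) (r : ℝ) :
    HasDerivAt (fun r : ℝ => gaussDensity (z + r • a))
      (-2 * sliceInner a (z + r • a) * gaussDensity (z + r • a)) r := by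
  have hx : HasDerivAt (fun r : ℝ => (z + r • a).1) a.1 r := by
    simpa using ((hasDerivAt_id r).smul_const a.1).const_add z.1
  have hv : HasDerivAt (fun r : ℝ => (z + r • a).2) a.2 r := by
    simpa using ((hasDerivAt_id r).smul_const a.2).const_add z.2
  have h := ((hx.norm_sq.fun_add hv.norm_sq).fun_neg.exp).const_mul (Real.pi ^ d)⁻¹
  refine HasDerivAt.congr_deriv h ?_
  unfold gaussDensity sliceInner
  rw [real_inner_comm a.1, real_inner_comm a.2]
  ring

theorem hasDerivAt_gaussDensity_line₂ (z k a : Slice d) (r : ℝ) :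
    HasDerivAt (fun r : ℝ => -2 * sliceInner k (z + r • a) * gaussDensity (z + r • a))
      ((4 * sliceInner k (z + r • a) * sliceInner a (z + r • a) - 2 * sliceInner k a) *
        gaussDensity (z + r • a)) r := by
  refine HasDerivAt.congr_deriv (((hasDerivAt_sliceInner_line k z a r).const_mul (-2)).fun_mul
    (hasDerivAt_gaussDensity_line z a r)) ?_
  ring

theorem hasDerivAt_gaussDensity_line₃ (z k a : Slice d) (r : ℝ) :
    HasDerivAt (fun r : ℝ => (4 * sliceInner k (z + r • a) * sliceInner a (z + r • a)
        - 2 * sliceInner k a) * gaussDensity (z + r • a))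
      ((8 * sliceInner k a * sliceInner a (z + r • a) + 4 * sliceInner k (z + r • a) *
        sliceInner a a - 8 * sliceInner k (z + r • a) * sliceInner a (z + r • a) ^ 2) *
        gaussDensity (z + r • a)) r := by
  refine HasDerivAt.congr_deriv (((((hasDerivAt_sliceInner_line k z a r).const_mul 4).fun_mul
    (hasDerivAt_sliceInner_line a z a r)).sub_const (2 * sliceInner k a)).fun_mul
    (hasDerivAt_gaussDensity_line z a r)) ?_
  ring

/-- Here and in the two bounds that follow, `64 * (1 + ‖z‖) ^ 3` is one common majorant for the
polynomial factors of the directional derivatives of order one to three. -/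
theorem abs_gauss_deriv₁_le (k z : Slice d) :
    |-2 * sliceInner k z * gaussDensity z| ≤ 64 * (1 + ‖z‖) ^ 3 * gaussDensity z * ‖k‖ := by
  rw [abs_mul, abs_mul, abs_of_pos (gaussDensity_pos z)]
  have h1 := abs_sliceInner_le k z
  have hg := (gaussDensity_pos z).le
  have hz := norm_nonneg z
  have hk := norm_nonneg k
  have : |(-2 : ℝ)| * |sliceInner k z| ≤ 64 * (1 + ‖z‖) ^ 3 * ‖k‖ := by
    norm_num
    have : 4 * ‖z‖ * ‖k‖ ≤ 64 * (1 + ‖z‖) ^ 3 * ‖k‖ := by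
      refine mul_le_mul_of_nonneg_right ?_ hk
      nlinarith [pow_nonneg hz 2, pow_nonneg hz 3]
    linarith
  calc _ ≤ 64 * (1 + ‖z‖) ^ 3 * ‖k‖ * gaussDensity z := mul_le_mul_of_nonneg_right this hg
    _ = _ := by ring

theorem abs_gauss_deriv₂_le (k a z : Slice d) :
    |(4 * sliceInner k z * sliceInner a z - 2 * sliceInner k a) * gaussDensity z|
      ≤ 64 * (1 + ‖z‖) ^ 3 * gaussDensity z * (‖k‖ * ‖a‖) := by
  rw [abs_mul, abs_of_pos (gaussDensity_pos z)]
  have hg := (gaussDensity_pos z).le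
  have hz := norm_nonneg z
  have h1 : |4 * sliceInner k z * sliceInner a z| ≤ 16 * ‖z‖ ^ 2 * (‖k‖ * ‖a‖) := by
    rw [abs_mul, abs_mul, abs_of_pos (by norm_num : (0 : ℝ) < 4)]
    calc 4 * |sliceInner k z| * |sliceInner a z| ≤ 4 * (2 * ‖k‖ * ‖z‖) * (2 * ‖a‖ * ‖z‖) := by
          gcongr <;> exact abs_sliceInner_le _ _
      _ = _ := by ring
  have h2 : |2 * sliceInner k a| ≤ 4 * (‖k‖ * ‖a‖) := by
    rw [abs_mul, abs_of_pos (by norm_num : (0 : ℝ) < 2)]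
    linarith [abs_sliceInner_le k a]
  have h3 : |4 * sliceInner k z * sliceInner a z - 2 * sliceInner k a|
      ≤ 64 * (1 + ‖z‖) ^ 3 * (‖k‖ * ‖a‖) := by
    refine (abs_sub _ _).trans ((add_le_add h1 h2).trans ?_)
    rw [← add_mul]
    refine mul_le_mul_of_nonneg_right ?_ (by positivity)
    nlinarith [pow_nonneg hz 2, pow_nonneg hz 3]
  calc _ ≤ 64 * (1 + ‖z‖) ^ 3 * (‖k‖ * ‖a‖) * gaussDensity z := mul_le_mul_of_nonneg_right h3 hg
    _ = _ := by ring

theorem abs_gauss_deriv₃_le (k a z : Slice d) :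
    |(8 * sliceInner k a * sliceInner a z + 4 * sliceInner k z * sliceInner a a
        - 8 * sliceInner k z * sliceInner a z ^ 2) * gaussDensity z|
      ≤ 64 * (1 + ‖z‖) ^ 3 * gaussDensity z * (‖k‖ * ‖a‖ ^ 2) := by
  rw [abs_mul, abs_of_pos (gaussDensity_pos z)]
  have hg := (gaussDensity_pos z).le
  have hz := norm_nonneg z
  have h1 : |8 * sliceInner k a * sliceInner a z| ≤ 32 * ‖z‖ * (‖k‖ * ‖a‖ ^ 2) := by
    rw [abs_mul, abs_mul, abs_of_pos (by norm_num : (0 : ℝ) < 8)]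
    calc 8 * |sliceInner k a| * |sliceInner a z| ≤ 8 * (2 * ‖k‖ * ‖a‖) * (2 * ‖a‖ * ‖z‖) := by
          gcongr <;> exact abs_sliceInner_le _ _
      _ = _ := by ring
  have h2 : |4 * sliceInner k z * sliceInner a a| ≤ 16 * ‖z‖ * (‖k‖ * ‖a‖ ^ 2) := by
    rw [abs_mul, abs_mul, abs_of_pos (by norm_num : (0 : ℝ) < 4)]
    calc 4 * |sliceInner k z| * |sliceInner a a| ≤ 4 * (2 * ‖k‖ * ‖z‖) * (2 * ‖a‖ * ‖a‖) := by
          gcongr <;> exact abs_sliceInner_le _ _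
      _ = _ := by ring
  have h3 : |8 * sliceInner k z * sliceInner a z ^ 2| ≤ 64 * ‖z‖ ^ 3 * (‖k‖ * ‖a‖ ^ 2) := by
    rw [abs_mul, abs_mul, abs_pow, abs_of_pos (by norm_num : (0 : ℝ) < 8)]
    calc 8 * |sliceInner k z| * |sliceInner a z| ^ 2
        ≤ 8 * (2 * ‖k‖ * ‖z‖) * (2 * ‖a‖ * ‖z‖) ^ 2 := by
          gcongr <;> exact abs_sliceInner_le _ _
      _ = _ := by ring
  have h4 : |8 * sliceInner k a * sliceInner a z + 4 * sliceInner k z * sliceInner a a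
        - 8 * sliceInner k z * sliceInner a z ^ 2| ≤ 64 * (1 + ‖z‖) ^ 3 * (‖k‖ * ‖a‖ ^ 2) := by
    refine (abs_sub _ _).trans ((add_le_add ((abs_add_le _ _).trans (add_le_add h1 h2)) h3).trans ?_)
    rw [← add_mul, ← add_mul]
    refine mul_le_mul_of_nonneg_right ?_ (by positivity)
    nlinarith [pow_nonneg hz 2, pow_nonneg hz 3]
  calc _ ≤ 64 * (1 + ‖z‖) ^ 3 * (‖k‖ * ‖a‖ ^ 2) * gaussDensity z :=
        mul_le_mul_of_nonneg_right h4 hg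
    _ = _ := by ring

theorem norm_sq_le_sum_sq (z : Slice d) : ‖z‖ ^ 2 ≤ ‖z.1‖ ^ 2 + ‖z.2‖ ^ 2 := by
  rw [Prod.norm_def]
  rcases max_choice ‖z.1‖ ‖z.2‖ with h | h <;> rw [h] <;> nlinarith [sq_nonneg ‖z.1‖, sq_nonneg ‖z.2‖]

theorem half_norm_sq_sub_le {E : Type*} [NormedAddCommGroup E] (z s : E) :
    ‖z‖ ^ 2 / 2 - ‖s‖ ^ 2 ≤ ‖z + s‖ ^ 2 := by
  have h : ‖z‖ ≤ ‖z + s‖ + ‖s‖ := by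
    have := norm_sub_le (z + s) s
    rwa [add_sub_cancel_right] at this
  nlinarith [norm_nonneg z, norm_nonneg s, norm_nonneg (z + s), sq_nonneg (‖z + s‖ - ‖s‖)]

/-- Budget of exponents: the cubic factor costs `‖z + s‖ ^ 2 / 2`, half of the Gaussian decay. The
other half yields `1 / 4` of the sum of squares of `z`, up to `4 * R ^ 2`; the weight `1 + ‖z.1‖ +
‖z.2‖` costs `1 / 8`, so `1 / 8` survives. The constant `25 / 2` is `8 + 9 / 2`. -/
theorem weight_mul_gauss_le {R : ℝ} {s : Slice d} (hs : ‖s‖ ≤ 2 * R) (z : Slice d) :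
    (1 + ‖z.1‖ + ‖z.2‖) * (64 * (1 + ‖z + s‖) ^ 3 * gaussDensity (z + s))
      ≤ 64 * (Real.pi ^ d)⁻¹ * Real.exp (4 * R ^ 2 + 25 / 2) *
        Real.exp (-(1 / 8) * (‖z.1‖ ^ 2 + ‖z.2‖ ^ 2)) := by
  have hw : 1 + ‖z.1‖ + ‖z.2‖ ≤ Real.exp (‖z‖ ^ 2 / 8 + 8) := by
    have h1 := norm_fst_le z
    have h2 := norm_snd_le z
    calc 1 + ‖z.1‖ + ‖z.2‖ ≤ 2 * ‖z‖ + 1 := by linarith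
      _ ≤ Real.exp (2 * ‖z‖) := Real.add_one_le_exp _
      _ ≤ _ := Real.exp_le_exp.mpr (by nlinarith [sq_nonneg (‖z‖ - 8)])
  have hp : (1 + ‖z + s‖) ^ 3 ≤ Real.exp (‖z + s‖ ^ 2 / 2 + 9 / 2) := by
    calc (1 + ‖z + s‖) ^ 3 ≤ Real.exp ‖z + s‖ ^ 3 := by
          gcongr
          linarith [Real.add_one_le_exp ‖z + s‖]
      _ = Real.exp (3 * ‖z + s‖) := by rw [← Real.exp_nat_mul]; norm_num
      _ ≤ _ := Real.exp_le_exp.mpr (by nlinarith [sq_nonneg (‖z + s‖ - 3)])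
  have hs1 : ‖s.1‖ ^ 2 ≤ 4 * R ^ 2 := by
    have := (norm_fst_le s).trans hs
    nlinarith [norm_nonneg s.1]
  have hs2 : ‖s.2‖ ^ 2 ≤ 4 * R ^ 2 := by
    have := (norm_snd_le s).trans hs
    nlinarith [norm_nonneg s.2]
  have hq1 := half_norm_sq_sub_le z.1 s.1
  have hq2 := half_norm_sq_sub_le z.2 s.2
  have hn := norm_sq_le_sum_sq (z + s)
  have hn' := norm_sq_le_sum_sq z
  simp only [Prod.fst_add, Prod.snd_add] at hn
  calc (1 + ‖z.1‖ + ‖z.2‖) * (64 * (1 + ‖z + s‖) ^ 3 * gaussDensity (z + s))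
      ≤ Real.exp (‖z‖ ^ 2 / 8 + 8) * (64 * Real.exp (‖z + s‖ ^ 2 / 2 + 9 / 2) *
        ((Real.pi ^ d)⁻¹ * Real.exp (-(‖z.1 + s.1‖ ^ 2 + ‖z.2 + s.2‖ ^ 2)))) := by
        unfold gaussDensity
        simp only [Prod.fst_add, Prod.snd_add]
        gcongr
    _ = 64 * (Real.pi ^ d)⁻¹ * Real.exp ((‖z‖ ^ 2 / 8 + 8) + (‖z + s‖ ^ 2 / 2 + 9 / 2)
        + (-(‖z.1 + s.1‖ ^ 2 + ‖z.2 + s.2‖ ^ 2))) := by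
        rw [Real.exp_add (_ + _) (-_), Real.exp_add (‖z‖ ^ 2 / 8 + 8)]
        ring
    _ ≤ 64 * (Real.pi ^ d)⁻¹ * Real.exp (4 * R ^ 2 + 25 / 2
        + -(1 / 8) * (‖z.1‖ ^ 2 + ‖z.2‖ ^ 2)) := by
        refine mul_le_mul_of_nonneg_left (Real.exp_le_exp.mpr ?_) (by positivity)
        linarith
    _ = _ := by rw [Real.exp_add]; ring

theorem exists_hasDerivAt_eq_diff {φ φ₁ : ℝ → ℝ} (h : ∀ r, HasDerivAt φ (φ₁ r) r) :
    ∃ ξ ∈ Ioo (0 : ℝ) 1, φ 1 - φ 0 = φ₁ ξ := by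
  obtain ⟨ξ, hξ, he⟩ := exists_hasDerivAt_eq_slope φ φ₁ (zero_lt_one' ℝ)
    (fun r _ => (h r).continuousAt.continuousWithinAt) (fun r _ => h r)
  exact ⟨ξ, hξ, by rw [he]; simp⟩

/-- Weighted `L¹` bounds for differences of the Gaussian of order one, two and three. -/
theorem exists_gauss_difference_bound (d : ℕ) (R : ℝ) :
    ∃ K > 0, ∀ a k : Slice d, ‖a‖ ≤ R → ‖k‖ ≤ R →
      (∀ z : Slice d, (1 + ‖z.1‖ + ‖z.2‖) * |gaussDensity (z + k) - gaussDensity z|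
        ≤ K * Real.exp (-(1 / 8) * (‖z.1‖ ^ 2 + ‖z.2‖ ^ 2)) * ‖k‖) ∧
      (∀ z : Slice d, (1 + ‖z.1‖ + ‖z.2‖) *
          |gaussDensity (z + a) + gaussDensity (z - a) - 2 * gaussDensity z|
        ≤ K * Real.exp (-(1 / 8) * (‖z.1‖ ^ 2 + ‖z.2‖ ^ 2)) * ‖a‖ ^ 2) ∧
      (∀ z : Slice d, (1 + ‖z.1‖ + ‖z.2‖) *
          |(gaussDensity (z + k + a) + gaussDensity (z + k - a) - 2 * gaussDensity (z + k))
            - (gaussDensity (z + a) + gaussDensity (z - a) - 2 * gaussDensity z)|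
        ≤ K * Real.exp (-(1 / 8) * (‖z.1‖ ^ 2 + ‖z.2‖ ^ 2)) * (‖k‖ * ‖a‖ ^ 2)) := by
  refine ⟨64 * (Real.pi ^ d)⁻¹ * Real.exp (4 * R ^ 2 + 25 / 2), by positivity,
    fun a k ha hk => ⟨fun z => ?_, fun z => ?_, fun z => ?_⟩⟩
  · obtain ⟨ξ, hξ, he⟩ := exists_hasDerivAt_eq_diff (hasDerivAt_gaussDensity_line z k)
    simp only [one_smul, zero_smul, add_zero] at he
    have hs : ‖ξ • k‖ ≤ 2 * R := by
      rw [norm_smul, Real.norm_of_nonneg hξ.1.le]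
      nlinarith [norm_nonneg k, hξ.1, hξ.2]
    rw [he]
    calc _ ≤ (1 + ‖z.1‖ + ‖z.2‖) * (64 * (1 + ‖z + ξ • k‖) ^ 3 * gaussDensity (z + ξ • k) * ‖k‖) :=
          mul_le_mul_of_nonneg_left (abs_gauss_deriv₁_le k _) (by positivity)
      _ ≤ _ := by
          rw [← mul_assoc]
          exact mul_le_mul_of_nonneg_right (weight_mul_gauss_le hs z) (norm_nonneg _)
  · obtain ⟨ξ, hξ, he⟩ := exists_secondDiff_eq (hasDerivAt_gaussDensity_line z a)
      (hasDerivAt_gaussDensity_line₂ z a a) zero_lt_one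
    simp only [one_smul, zero_smul, add_zero, neg_smul, ← sub_eq_add_neg, one_pow, one_mul] at he
    have hs : ‖ξ • a‖ ≤ 2 * R := by
      rw [norm_smul, Real.norm_eq_abs]
      have := abs_lt.mpr hξ
      nlinarith [norm_nonneg a, abs_nonneg ξ]
    rw [he]
    calc _ ≤ (1 + ‖z.1‖ + ‖z.2‖) *
          (64 * (1 + ‖z + ξ • a‖) ^ 3 * gaussDensity (z + ξ • a) * (‖a‖ * ‖a‖)) :=
          mul_le_mul_of_nonneg_left (abs_gauss_deriv₂_le a a _) (by positivity)
      _ ≤ _ := by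
          rw [← mul_assoc, ← sq]
          exact mul_le_mul_of_nonneg_right (weight_mul_gauss_le hs z) (by positivity)
  · have hline : ∀ r : ℝ, HasDerivAt (fun r : ℝ => gaussDensity (z + a + r • k)
        + gaussDensity (z - a + r • k) - 2 * gaussDensity (z + r • k))
        (-2 * sliceInner k (z + a + r • k) * gaussDensity (z + a + r • k)
          + -2 * sliceInner k (z - a + r • k) * gaussDensity (z - a + r • k)
          - 2 * (-2 * sliceInner k (z + r • k) * gaussDensity (z + r • k))) r := fun r =>
      ((hasDerivAt_gaussDensity_line (z + a) k r).fun_add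
        (hasDerivAt_gaussDensity_line (z - a) k r)).fun_sub
        ((hasDerivAt_gaussDensity_line z k r).const_mul 2)
    -- The mean value theorem in the direction `k` is applied to the whole second difference in `a`;
    -- the resulting second difference of a first derivative is then a third derivative.
    obtain ⟨ξ, hξ, he⟩ := exists_hasDerivAt_eq_diff hline
    obtain ⟨η, hη, he'⟩ := exists_secondDiff_eq (hasDerivAt_gaussDensity_line₂ (z + ξ • k) k a)
      (hasDerivAt_gaussDensity_line₃ (z + ξ • k) k a) zero_lt_one
    simp only [one_smul, zero_smul, add_zero, neg_smul, ← sub_eq_add_neg, one_pow, one_mul]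
      at he he'
    rw [add_right_comm z a, sub_add_eq_add_sub z a, add_right_comm z a, sub_add_eq_add_sub z a,
      he'] at he
    have hs : ‖ξ • k + η • a‖ ≤ 2 * R := by
      refine (norm_add_le _ _).trans ?_
      rw [norm_smul, norm_smul, Real.norm_of_nonneg hξ.1.le, Real.norm_eq_abs]
      have := abs_lt.mpr hη
      nlinarith [norm_nonneg a, abs_nonneg η, norm_nonneg k, hξ.1, hξ.2]
    rw [he, add_assoc z]
    calc _ ≤ (1 + ‖z.1‖ + ‖z.2‖) * (64 * (1 + ‖z + (ξ • k + η • a)‖) ^ 3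
          * gaussDensity (z + (ξ • k + η • a)) * (‖k‖ * ‖a‖ ^ 2)) :=
          mul_le_mul_of_nonneg_left (abs_gauss_deriv₃_le k a _) (by positivity)
      _ ≤ _ := by
          rw [← mul_assoc]
          exact mul_le_mul_of_nonneg_right (weight_mul_gauss_le hs z) (by positivity)

end GaussianDifferences

/-! ### Smoothing of Hölder sources. -/

section HolderSource

variable {d : ℕ}

/-- `G` is Hölder continuous with constant `N` and exponents `α / 3` in `x - τ v` and `α`
in `v`. -/
def ShearHolder (α N τ : ℝ) (G : Slice d → ℝ) : Prop :=
  ∀ y h : Slice d, |G (y + h) - G y| ≤ N * (‖h.1 - τ • h.2‖ ^ (α / 3) + ‖h.2‖ ^ α)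

theorem rpow_le_one_add {s p : ℝ} (hs : 0 ≤ s) (hp : 0 ≤ p) (hp1 : p ≤ 1) : s ^ p ≤ 1 + s := by
  rcases le_total s 1 with h | h
  · linarith [Real.rpow_le_one hs h hp]
  · have := Real.rpow_le_rpow_of_exponent_le h hp1
    rw [Real.rpow_one] at this
    linarith

/-- Under `spread lam τ` the sheared position moves by order `τ ^ (3 / 2)` and the velocity by order
`τ ^ (1 / 2)`; the exponents `α / 3` and `α` turn both into `τ ^ (α / 2)`. -/
theorem ShearHolder.abs_sub_spread_le {lam τ α N : ℝ} (hl : 0 < lam) (hl1 : lam ≤ 1) (hτ : 0 < τ)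
    (hα : 0 < α) (hα1 : α ≤ 1) (hN : 0 ≤ N) {G : Slice d → ℝ} (hG : ShearHolder α N τ G)
    (y z : Slice d) :
    |G (y - spread lam τ z) - G y| ≤ 3 * N * τ ^ (α / 2) * (1 + ‖z.1‖ + ‖z.2‖) := by
  have h := hG y (-spread lam τ z)
  rw [← sub_eq_add_neg] at h
  refine h.trans ?_
  have hs1 : √(lam * τ) ≤ √τ := Real.sqrt_le_sqrt (by nlinarith)
  have hs3 : √(lam * τ / 3) ≤ √τ := Real.sqrt_le_sqrt (by nlinarith)
  set S := ‖z.1‖ + ‖z.2‖ with hS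
  have hS0 : 0 ≤ S := by positivity
  have hx : ‖(-spread lam τ z).1 - τ • (-spread lam τ z).2‖ ≤ τ * √τ * S := by
    have e : (-spread lam τ z).1 - τ • (-spread lam τ z).2
        = (τ * √(lam * τ)) • z.1 - (τ * √(lam * τ / 3)) • z.2 := by
      simp only [spread, Prod.fst_neg, Prod.snd_neg]
      module
    rw [e]
    refine (norm_sub_le _ _).trans ?_
    rw [norm_smul, norm_smul, Real.norm_of_nonneg (by positivity),
      Real.norm_of_nonneg (by positivity), hS, mul_add]
    gcongr
  have hv : ‖(-spread lam τ z).2‖ ≤ √τ * (2 * S) := by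
    rw [Prod.snd_neg, norm_neg]
    simp only [spread]
    rw [norm_smul, Real.norm_of_nonneg (by positivity)]
    have h1 : ‖z.1‖ ≤ S := by rw [hS]; linarith [norm_nonneg z.2]
    calc 2 * √(lam * τ) * ‖z.1‖ ≤ 2 * √τ * S := by gcongr
      _ = _ := by ring
  have p1 : ‖(-spread lam τ z).1 - τ • (-spread lam τ z).2‖ ^ (α / 3)
      ≤ τ ^ (α / 2) * (1 + S) := by
    calc _ ≤ (τ * √τ * S) ^ (α / 3) := Real.rpow_le_rpow (norm_nonneg _) hx (by positivity)
      _ = τ ^ (α / 2) * S ^ (α / 3) := by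
          rw [Real.mul_rpow (by positivity) hS0, Real.sqrt_eq_rpow]
          nth_rewrite 1 [← Real.rpow_one τ]
          rw [← Real.rpow_add hτ, ← Real.rpow_mul hτ.le]
          congr 2
          ring
      _ ≤ _ := by
          gcongr
          exact rpow_le_one_add hS0 (by positivity) (by linarith)
  have p2 : ‖(-spread lam τ z).2‖ ^ α ≤ τ ^ (α / 2) * (1 + 2 * S) := by
    calc _ ≤ (√τ * (2 * S)) ^ α := Real.rpow_le_rpow (norm_nonneg _) hv hα.le
      _ = τ ^ (α / 2) * (2 * S) ^ α := by
          rw [Real.mul_rpow (by positivity) (by positivity), Real.sqrt_eq_rpow,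
            ← Real.rpow_mul hτ.le]
          congr 2
          ring
      _ ≤ _ := by
          gcongr
          exact rpow_le_one_add (by positivity) hα.le hα1
  have hp : 0 ≤ τ ^ (α / 2) := by positivity
  calc _ ≤ N * (τ ^ (α / 2) * (1 + S) + τ ^ (α / 2) * (1 + 2 * S)) := by gcongr
    _ ≤ N * (τ ^ (α / 2) * (3 * (1 + S))) := by
        gcongr
        nlinarith
    _ = _ := by rw [hS]; ring

/-- The inverse of `spread`. -/
noncomputable def unspread (lam τ : ℝ) (h : Slice d) : Slice d :=
  ((2 * √(lam * τ))⁻¹ • h.2, (√(lam * τ / 3))⁻¹ • (τ⁻¹ • h.1 - (2⁻¹ : ℝ) • h.2))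

theorem spread_unspread {lam τ : ℝ} (hl : 0 < lam) (hτ : 0 < τ) (h : Slice d) :
    spread lam τ (unspread lam τ h) = h := by
  have hs : √(lam * τ) ≠ 0 := by positivity
  have hs3 : √(lam * τ / 3) ≠ 0 := by positivity
  ext1
  · simp only [spread, unspread, smul_smul, mul_inv, smul_add, smul_sub]
    rw [show τ * (√(lam * τ) * (2⁻¹ * (√(lam * τ))⁻¹)) = τ * 2⁻¹ by field_simp,
      show τ * (√(lam * τ / 3) * ((√(lam * τ / 3))⁻¹ * τ⁻¹)) = 1 by field_simp,
      show τ * (√(lam * τ / 3) * ((√(lam * τ / 3))⁻¹ * 2⁻¹)) = τ * 2⁻¹ by field_simp, one_smul]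
    abel
  · simp only [spread, unspread, smul_smul]
    rw [mul_inv_cancel₀ (by positivity), one_smul]

theorem spread_add (lam τ : ℝ) (z w : Slice d) :
    spread lam τ (z + w) = spread lam τ z + spread lam τ w := by
  ext1
  · simp only [spread, Prod.fst_add, Prod.snd_add]; module
  · simp only [spread, Prod.fst_add, Prod.snd_add]; module

theorem unspread_neg (lam τ : ℝ) (z : Slice d) : unspread lam τ (-z) = -unspread lam τ z := by
  ext1
  · simp only [unspread, Prod.fst_neg, Prod.snd_neg]; module
  · simp only [unspread, Prod.fst_neg, Prod.snd_neg]; module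

theorem unspread_add (lam τ : ℝ) (z w : Slice d) :
    unspread lam τ (z + w) = unspread lam τ z + unspread lam τ w := by
  ext1
  · simp only [unspread, Prod.fst_add, Prod.snd_add]; module
  · simp only [unspread, Prod.fst_add, Prod.snd_add]; module

/-- This is the smoothing rate: an increment counts as `τ ^ (-3 / 2)` in position and `τ ^ (-1 / 2)`
in velocity. -/
theorem norm_unspread_le {lam τ : ℝ} (hl : 0 < lam) (hτ : 0 < τ) (h : Slice d) :
    ‖unspread lam τ h‖ ≤ 2 / (√lam * √τ) * (‖h.1‖ / τ + ‖h.2‖) := by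
  have h3 : √(lam * τ / 3) = √lam * √τ / √3 := by
    rw [Real.sqrt_div (by positivity), Real.sqrt_mul hl.le]
  have h32 : √(3 : ℝ) ≤ 2 := Real.sqrt_le_iff.mpr ⟨by norm_num, by norm_num⟩
  have hsl : 0 < √lam := by positivity
  have hst : 0 < √τ := by positivity
  have hp := norm_nonneg h.1
  have hq := norm_nonneg h.2
  refine norm_prod_le_iff.mpr ⟨?_, ?_⟩
  · simp only [unspread]
    rw [norm_smul, Real.norm_of_nonneg (by positivity), Real.sqrt_mul hl.le, mul_inv,
      ← div_eq_mul_inv]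
    gcongr
    · norm_num
    · exact le_add_of_nonneg_left (by positivity)
  · simp only [unspread]
    rw [norm_smul, Real.norm_of_nonneg (by positivity), h3, inv_div]
    have hn : ‖τ⁻¹ • h.1 - (2⁻¹ : ℝ) • h.2‖ ≤ ‖h.1‖ / τ + ‖h.2‖ := by
      refine (norm_sub_le _ _).trans ?_
      rw [norm_smul, norm_smul, Real.norm_of_nonneg (by positivity), Real.norm_of_nonneg (by positivity)]
      rw [inv_mul_eq_div]
      linarith
    gcongr

/-- Translating the argument amounts to translating the Gaussian by `unspread lam τ h`, so finite
differences never fall on `G`. -/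
theorem smooth_add_eq {lam τ : ℝ} (hl : 0 < lam) (hτ : 0 < τ) (G : Slice d → ℝ) (y h : Slice d) :
    smooth lam τ G (y + h)
      = ∫ z, G (y - spread lam τ z) * gaussDensity (z + unspread lam τ h) := by
  unfold smooth
  rw [← integral_add_right_eq_self _ (unspread lam τ h)]
  congr 1
  ext z
  rw [spread_add, spread_unspread hl hτ, add_sub_add_right_eq_sub]

/-- Since `Ψ` has mean zero, `G y` may be subtracted from `G`, and the Hölder bound replaces the
size of `G` by its oscillation. -/
theorem abs_integral_mul_le {lam τ α N : ℝ} (hl : 0 < lam) (hl1 : lam ≤ 1) (hτ : 0 < τ)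
    (hα : 0 < α) (hα1 : α ≤ 1) (hN : 0 ≤ N) {G : Slice d → ℝ} (hG : ShearHolder α N τ G)
    (y : Slice d) {Ψ : Slice d → ℝ} {K : ℝ}
    (hi : Integrable (fun z => G (y - spread lam τ z) * Ψ z)) (hΨi : Integrable Ψ)
    (h0 : ∫ z, Ψ z = 0)
    (hb : ∀ z : Slice d, (1 + ‖z.1‖ + ‖z.2‖) * |Ψ z|
      ≤ K * Real.exp (-(1 / 8) * (‖z.1‖ ^ 2 + ‖z.2‖ ^ 2))) :
    |∫ z, G (y - spread lam τ z) * Ψ z| ≤ 3 * N * τ ^ (α / 2) *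
      (K * ∫ z : Slice d, Real.exp (-(1 / 8) * (‖z.1‖ ^ 2 + ‖z.2‖ ^ 2))) := by
  have e : ∫ z, G (y - spread lam τ z) * Ψ z
      = ∫ z, (G (y - spread lam τ z) - G y) * Ψ z := by
    simp_rw [sub_mul]
    rw [integral_sub hi (hΨi.const_mul _), integral_const_mul, h0]
    simp
  rw [e, ← Real.norm_eq_abs]
  simp only [← integral_const_mul]
  refine norm_integral_le_of_norm_le (((integrable_exp_neg_mul_sq_add_sq
    (by norm_num : (0 : ℝ) < 1 / 8)).const_mul K).const_mul _) (ae_of_all _ fun z => ?_)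
  rw [norm_mul]
  have hp : 0 ≤ 3 * N * τ ^ (α / 2) := by positivity
  calc _ ≤ 3 * N * τ ^ (α / 2) * (1 + ‖z.1‖ + ‖z.2‖) * |Ψ z| :=
        mul_le_mul_of_nonneg_right (hG.abs_sub_spread_le hl hl1 hτ hα hα1 hN y z) (abs_nonneg _)
    _ = 3 * N * τ ^ (α / 2) * ((1 + ‖z.1‖ + ‖z.2‖) * |Ψ z|) := by ring
    _ ≤ _ := mul_le_mul_of_nonneg_left (hb z) hp

/-- Smoothing a Hölder source gains derivatives: bounds for differences of order one, two and
three. -/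
theorem exists_smooth_difference_bound (d : ℕ) (R : ℝ) :
    ∃ K > 0, ∀ (lam τ α N : ℝ), 0 < lam → lam ≤ 1 → 0 < τ → 0 < α → α ≤ 1 → 0 ≤ N →
      ∀ G : Slice d → ℝ, Continuous G → (∃ B, ∀ y, |G y| ≤ B) → ShearHolder α N τ G →
      ∀ e h y : Slice d, ‖unspread lam τ e‖ ≤ R → ‖unspread lam τ h‖ ≤ R →
      |smooth lam τ G (y + h) - smooth lam τ G y| ≤ N * K * τ ^ (α / 2) * ‖unspread lam τ h‖ ∧
      |smooth lam τ G (y + e) + smooth lam τ G (y - e) - 2 * smooth lam τ G y|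
        ≤ N * K * τ ^ (α / 2) * ‖unspread lam τ e‖ ^ 2 ∧
      |(smooth lam τ G (y + h + e) + smooth lam τ G (y + h - e) - 2 * smooth lam τ G (y + h))
        - (smooth lam τ G (y + e) + smooth lam τ G (y - e) - 2 * smooth lam τ G y)|
        ≤ N * K * τ ^ (α / 2) * (‖unspread lam τ h‖ * ‖unspread lam τ e‖ ^ 2) := by
  obtain ⟨K, hK, hKb⟩ := exists_gauss_difference_bound d R
  set I := ∫ z : Slice d, Real.exp (-(1 / 8) * (‖z.1‖ ^ 2 + ‖z.2‖ ^ 2)) with hI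
  have hI0 : 0 ≤ I := integral_nonneg fun z => (Real.exp_pos _).le
  -- The `3` comes from `abs_sub_spread_le`; `I + 1` instead of `I` makes positivity immediate.
  refine ⟨3 * K * (I + 1), by positivity, ?_⟩
  intro lam τ α N hl hl1 hτ hα hα1 hN G hGc ⟨B, hB⟩ hG e h y he hh
  obtain ⟨b1, b2, b3⟩ := hKb (unspread lam τ e) (unspread lam τ h) he hh
  have hsp := continuous_spread (d := d) lam τ
  have hgi : ∀ k : Slice d, Integrable (fun z => gaussDensity (z + k)) := fun k =>
    integrable_gaussDensity.comp_add_right k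
  have hgI : ∀ k : Slice d, ∫ z : Slice d, gaussDensity (z + k) = 1 := fun k => by
    rw [integral_add_right_eq_self (gaussDensity (d := d)), integral_gaussDensity]
  have hGi : ∀ k : Slice d, Integrable (fun z => G (y - spread lam τ z) * gaussDensity (z + k)) :=
    fun k => (hgi k).bdd_mul (Continuous.aestronglyMeasurable (by fun_prop))
      (ae_of_all _ fun z => hB _)
  have hG3 : ∀ p q r : Slice d, Integrable (fun z => G (y - spread lam τ z) * gaussDensity (z + p)
      + G (y - spread lam τ z) * gaussDensity (z + q)
      - 2 * (G (y - spread lam τ z) * gaussDensity (z + r))) :=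
    fun p q r => ((hGi p).add (hGi q)).sub ((hGi r).const_mul 2)
  have hg3 : ∀ p q r : Slice d, Integrable (fun z => gaussDensity (z + p)
      + gaussDensity (z + q) - 2 * gaussDensity (z + r)) :=
    fun p q r => ((hgi p).add (hgi q)).sub ((hgi r).const_mul 2)
  have hrep := smooth_add_eq hl hτ G y
  have hrep0 : smooth lam τ G y = ∫ z, G (y - spread lam τ z) * gaussDensity (z + 0) := by
    simp [smooth]
  have hfin : ∀ m, 0 ≤ m → ∀ Ψ : Slice d → ℝ,
      Integrable (fun z => G (y - spread lam τ z) * Ψ z) → Integrable Ψ → ∫ z, Ψ z = 0 →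
      (∀ z : Slice d, (1 + ‖z.1‖ + ‖z.2‖) * |Ψ z|
        ≤ K * Real.exp (-(1 / 8) * (‖z.1‖ ^ 2 + ‖z.2‖ ^ 2)) * m) →
      |∫ z, G (y - spread lam τ z) * Ψ z| ≤ N * (3 * K * (I + 1)) * τ ^ (α / 2) * m := by
    intro m hm Ψ h1 h2 h3 h4
    refine (abs_integral_mul_le (K := K * m) hl hl1 hτ hα hα1 hN hG y h1 h2 h3
      fun z => (h4 z).trans (le_of_eq (by ring))).trans ?_
    rw [← hI]
    have hp : 0 ≤ 3 * N * τ ^ (α / 2) * (K * m) := by positivity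
    nlinarith
  set k := unspread lam τ h with hk
  set a := unspread lam τ e with ha
  have hne : unspread lam τ (-e) = -a := unspread_neg lam τ e
  have hrepm : smooth lam τ G (y - e) = ∫ z, G (y - spread lam τ z) * gaussDensity (z + -a) := by
    rw [sub_eq_add_neg, hrep, hne]
  refine ⟨?_, ?_, ?_⟩
  · have e1 : smooth lam τ G (y + h) - smooth lam τ G y
        = ∫ z, G (y - spread lam τ z) * (gaussDensity (z + k) - gaussDensity (z + 0)) := by
      rw [hrep, hrep0, ← integral_sub (hGi _) (hGi _)]
      simp only [mul_sub, hk]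
    rw [e1]
    apply hfin _ (norm_nonneg _)
    · simp only [mul_sub]
      exact (hGi _).sub (hGi _)
    · exact (hgi _).sub (hgi _)
    · rw [integral_sub (hgi _) (hgi _), hgI, hgI, sub_self]
    · simpa only [add_zero] using b1
  · have e1 : smooth lam τ G (y + e) + smooth lam τ G (y - e) - 2 * smooth lam τ G y
        = ∫ z, G (y - spread lam τ z) * (gaussDensity (z + a) + gaussDensity (z + -a)
          - 2 * gaussDensity (z + 0)) := by
      rw [hrep, hrepm, hrep0, ← integral_add (hGi _) (hGi _), ← integral_const_mul,
        ← integral_sub ((hGi _).fun_add (hGi _)) ((hGi _).const_mul 2)]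
      congr 1
      ext z
      ring
    rw [e1]
    apply hfin _ (by positivity)
    · refine (hG3 a (-a) 0).congr (ae_of_all _ fun z => ?_)
      ring
    · exact hg3 _ _ _
    · rw [integral_sub ((hgi _).fun_add (hgi _)) ((hgi _).const_mul 2),
        integral_add (hgi _) (hgi _), integral_const_mul, hgI, hgI, hgI]
      norm_num
    · simpa only [add_zero, ← sub_eq_add_neg] using b2
  · have ep : smooth lam τ G (y + h + e)
        = ∫ z, G (y - spread lam τ z) * gaussDensity (z + (k + a)) := by
      rw [add_assoc, hrep, unspread_add]
    have em : smooth lam τ G (y + h - e)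
        = ∫ z, G (y - spread lam τ z) * gaussDensity (z + (k + -a)) := by
      rw [sub_eq_add_neg, add_assoc, hrep, unspread_add, hne]
    have e1 : (smooth lam τ G (y + h + e) + smooth lam τ G (y + h - e)
          - 2 * smooth lam τ G (y + h))
          - (smooth lam τ G (y + e) + smooth lam τ G (y - e) - 2 * smooth lam τ G y)
        = ∫ z, G (y - spread lam τ z) * ((gaussDensity (z + (k + a)) + gaussDensity (z + (k + -a))
          - 2 * gaussDensity (z + k)) - (gaussDensity (z + a) + gaussDensity (z + -a)
          - 2 * gaussDensity (z + 0))) := by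
      rw [ep, em, hrep e, hrep h, hrepm, hrep0, ← integral_add (hGi _) (hGi _),
        ← integral_const_mul,
        ← integral_sub ((hGi _).fun_add (hGi _)) ((hGi _).const_mul 2),
        ← integral_add (hGi _) (hGi _), ← integral_const_mul,
        ← integral_sub ((hGi _).fun_add (hGi _)) ((hGi _).const_mul 2),
        ← integral_sub (hG3 _ _ _) (hG3 _ _ _)]
      congr 1
      ext z
      ring
    rw [e1]
    apply hfin _ (by positivity)
    · refine ((hG3 (k + a) (k + -a) k).sub (hG3 a (-a) 0)).congr (ae_of_all _ fun z => ?_)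
      simp only [Pi.sub_apply]
      ring
    · exact (hg3 _ _ _).sub (hg3 _ _ _)
    · rw [integral_sub (hg3 _ _ _) (hg3 _ _ _),
        integral_sub ((hgi _).fun_add (hgi _)) ((hgi _).const_mul 2),
        integral_sub ((hgi _).fun_add (hgi _)) ((hgi _).const_mul 2),
        integral_add (hgi _) (hgi _), integral_add (hgi _) (hgi _), integral_const_mul,
        integral_const_mul, hgI, hgI, hgI, hgI, hgI, hgI]
      norm_num
    · simpa only [add_zero, ← sub_eq_add_neg, ← add_assoc, ← add_sub_assoc] using b3

/-- Smoothing preserves Hölder continuity. -/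
theorem ShearHolder.abs_smooth_sub_le {lam τ α N : ℝ} {G : Slice d → ℝ} (hG : ShearHolder α N τ G)
    (hGc : Continuous G) {B : ℝ} (hB : ∀ y, |G y| ≤ B) (y h : Slice d) :
    |smooth lam τ G (y + h) - smooth lam τ G y|
      ≤ N * (‖h.1 - τ • h.2‖ ^ (α / 3) + ‖h.2‖ ^ α) := by
  rw [← smooth_translate, ← smooth_sub (by fun_prop) hGc (fun y => hB _) hB]
  exact abs_smooth_le (fun y => hG y h) lam τ y

end HolderSource

/-! ### Schauder estimates in straightened coordinates. -/

section Schauder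

variable {d : ℕ}

/-- The nested differences on the left are the form in which repeated `StraightSolution.translate`
and `StraightSolution.sub` present the source. -/
theorem smooth_secondDiff_sub {lam τ : ℝ} {G : Slice d → ℝ} (hG : Continuous G) {B : ℝ}
    (hB : ∀ y, |G y| ≤ B) (e h y : Slice d) :
    smooth lam τ (fun y => G (y + h + e) - G (y + h) - (G (y + h) - G (y + h + -e))
        - (G (y + e) - G y - (G y - G (y + -e)))) y
      = (smooth lam τ G (y + h + e) + smooth lam τ G (y + h - e) - 2 * smooth lam τ G (y + h))
        - (smooth lam τ G (y + e) + smooth lam τ G (y - e) - 2 * smooth lam τ G y) := by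
  have hi : ∀ y, Integrable (fun z => G (y - spread lam τ z) * gaussDensity z) := fun y =>
    integrable_smooth hG hB lam τ y
  have hi3 : ∀ p q r : Slice d, Integrable (fun z => G (p - spread lam τ z) * gaussDensity z
      + G (q - spread lam τ z) * gaussDensity z - 2 * (G (r - spread lam τ z) * gaussDensity z)) :=
    fun p q r => ((hi p).add (hi q)).sub ((hi r).const_mul 2)
  unfold smooth
  rw [← integral_add (hi _) (hi _), ← integral_const_mul,
    ← integral_sub ((hi _).fun_add (hi _)) ((hi _).const_mul 2),
    ← integral_add (hi _) (hi _), ← integral_const_mul,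
    ← integral_sub ((hi _).fun_add (hi _)) ((hi _).const_mul 2),
    ← integral_sub (hi3 _ _ _) (hi3 _ _ _)]
  congr 1
  ext z
  simp only [sub_add_eq_add_sub, ← sub_eq_add_neg, sub_right_comm _ (spread lam τ z) e]
  ring

namespace StraightSolution

variable {lam : ℝ} {u : ℝ → Fin d → Vec d} {F F₁ G : ℝ → Slice d → ℝ}
  {F₂ : ℝ → Vec d → Slice d → ℝ}

theorem continuous_source (h : StraightSolution lam u F F₁ G F₂) {τ : ℝ} (hτ : 0 < τ) :
    Continuous (G τ) := by
  have hG : G τ = fun y => F₁ τ y - (lam * ∑ i, F₂ τ (EuclideanSpace.single i 1) y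
      + ∑ k, F₂ τ (u τ k) y) := by
    ext y
    rw [h.equation τ hτ y]
    ring
  have h1 := h.continuous₁ τ hτ
  have h2 := h.continuous₂ τ hτ
  rw [hG]
  fun_prop

theorem bound_source (h : StraightSolution lam u F F₁ G F₂) {τ : ℝ} (hτ : 0 < τ) :
    ∃ B, ∀ y, |G τ y| ≤ B := by
  refine HasCompactSupport.exists_bound_of_continuous ?_ (h.continuous_source hτ)
  obtain ⟨R, hR⟩ := h.support
  refine HasCompactSupport.intro (isCompact_closedBall 0 R) fun y hy => ?_
  obtain ⟨-, h1, h2⟩ := hR τ hτ.le y (by simpa using hy)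
  have := h.equation τ hτ y
  simp only [h1, h2, Finset.sum_const_zero, mul_zero, zero_add] at this
  exact this.symm

/-- Power rates suffice below: `p = 1` when `G` is bounded by its oscillation, `p = α / 2` after two
differences in velocity, and `p = (α - 1) / 2 < 0` beyond the scale `ρ ^ 2`. -/
theorem peak_le_add_rpow (hl : 0 < lam) (h : StraightSolution lam u F F₁ G F₂) {τ₁ τ₂ c p : ℝ}
    (h1 : 0 < τ₁) (h12 : τ₁ ≤ τ₂) (hc : 0 ≤ c) (hp : p ≠ 0)
    (hG : ∀ τ ∈ Icc τ₁ τ₂, ∀ y, smooth lam τ (G τ) y ≤ c * τ ^ (p - 1)) :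
    peak lam F τ₁ ≤ peak lam F τ₂ + (c / p * τ₂ ^ p - c / p * τ₁ ^ p) := by
  refine h.peak_le_add hl h1 h12 (β := fun τ => c / p * τ ^ p) (β' := fun τ => c * τ ^ (p - 1))
    (fun τ hτ => ?_) (fun τ hτ => ?_) hG
  · have hτ0 : τ ≠ 0 := (h1.trans_le hτ.1).ne'
    refine ((Real.hasDerivAt_rpow_const (Or.inl hτ0)).const_mul (c / p)).congr_deriv ?_
    field_simp
  · have hτ0 : 0 < τ := h1.trans_le hτ.1
    positivity

end StraightSolution

theorem norm_unspread_vel_le {lam τ : ℝ} (hl : 0 < lam) (hτ : 0 < τ) (e : Vec d) :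
    ‖unspread lam τ ((0, e) : Slice d)‖ ≤ 2 * ‖e‖ / (√lam * √τ) := by
  refine (norm_unspread_le hl hτ _).trans (le_of_eq ?_)
  simp
  ring

/-- Schauder estimate in the position variable. -/
theorem exists_position_holder_bound (d : ℕ) {α lam : ℝ} (hα : 0 < α) (hα1 : α < 1)
    (hl : 0 < lam) (hl1 : lam ≤ 1) :
    ∃ C > 0, ∀ (u : ℝ → Fin d → Vec d) (F F₁ G : ℝ → Slice d → ℝ)
      (F₂ : ℝ → Vec d → Slice d → ℝ) (N : ℝ), StraightSolution lam u F F₁ G F₂ → 0 ≤ N →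
      (∀ τ > 0, ShearHolder α N τ (G τ)) → ∀ (h : Vec d) (y : Slice d) (ρ : ℝ), 0 < ρ → ρ ≤ 1 →
      ‖h‖ = ρ ^ 3 → F 0 (y + (h, 0)) - F 0 y ≤ C * N * ρ ^ (2 + α) := by
  -- For `τ ≥ ρ ^ 2` a position increment of length `ρ ^ 3` unspreads to at most `2 / √lam`, within
  -- the radius `4 / √lam`.
  obtain ⟨K, hK, hKb⟩ := exists_smooth_difference_bound d (4 / √lam)
  have hsl : 0 < √lam := by positivity
  have hα' : 0 < 1 - α := by linarith
  refine ⟨1 + 4 * K / ((1 - α) * √lam), by positivity, ?_⟩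
  intro u F F₁ G F₂ N hF hN hG h y ρ hρ hρ1 hh
  have hsol := (hF.translate ((h, 0) : Slice d)).sub hF
  refine hsol.le_of_peak_le (δ := ρ ^ 2) (by positivity) (fun τ hτ => ?_) y
  have hsm : ∀ τ > 0, ∀ y, smooth lam τ (fun y => G τ (y + (h, 0)) - G τ y) y
      = smooth lam τ (G τ) (y + (h, 0)) - smooth lam τ (G τ) y := by
    intro τ hτ y
    obtain ⟨B, hB⟩ := hF.bound_source hτ
    have hc := hF.continuous_source hτ
    rw [smooth_sub (by fun_prop) hc (fun y => hB _) hB, smooth_translate]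
  -- For `τ ≤ ρ ^ 2` the Hölder bound is used directly: rate `N * ρ ^ α` over a time `ρ ^ 2`.
  have hshort := hsol.peak_le_add_rpow hl (c := N * ρ ^ α) (p := 1) hτ.1 hτ.2.le (by positivity)
    one_ne_zero (fun τ' hτ' y => by
      have hτ0 : 0 < τ' := hτ.1.trans_le hτ'.1
      obtain ⟨B, hB⟩ := hF.bound_source hτ0
      rw [hsm τ' hτ0]
      refine (le_abs_self _).trans (((hG τ' hτ0).abs_smooth_sub_le (hF.continuous_source hτ0) hB
        y (h, 0)).trans (le_of_eq ?_))
      simp only [smul_zero, sub_zero, norm_zero, sub_self, Real.rpow_zero, mul_one]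
      rw [Real.zero_rpow hα.ne', add_zero, hh, ← Real.rpow_natCast ρ 3, ← Real.rpow_mul hρ.le]
      congr 2
      push_cast
      ring)
  -- For `τ ≥ ρ ^ 2` the first difference gives the rate `ρ ^ 3 * τ ^ (α / 2 - 3 / 2)`, whose
  -- integral is dominated by its lower endpoint because `α < 1`.
  have hlong := hsol.peak_le_add_rpow hl (c := N * K * (2 * ρ ^ 3 / √lam)) (p := (α - 1) / 2)
    (τ₁ := ρ ^ 2) (τ₂ := 1) (by positivity) (by nlinarith) (by positivity) (by linarith)
    (fun τ' hτ' y => by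
      have hτ0 : 0 < τ' := (by positivity : 0 < ρ ^ 2).trans_le hτ'.1
      have hst : 0 < √τ' := by positivity
      have hρτ : ρ ≤ √τ' := Real.le_sqrt_of_sq_le hτ'.1
      have hk : ‖unspread lam τ' ((h, 0) : Slice d)‖ ≤ 2 * ρ ^ 3 / √lam * (τ' * √τ')⁻¹ := by
        refine (norm_unspread_le hl hτ0 _).trans (le_of_eq ?_)
        simp only [norm_zero, add_zero, hh]
        field_simp
      have hkR : ‖unspread lam τ' ((h, 0) : Slice d)‖ ≤ 4 / √lam := by
        refine hk.trans ?_
        have : ρ ^ 3 ≤ τ' * √τ' := by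
          calc ρ ^ 3 = ρ ^ 2 * ρ := by ring
            _ ≤ τ' * √τ' := mul_le_mul hτ'.1 hρτ hρ.le hτ0.le
        rw [← div_eq_mul_inv, div_le_iff₀ (by positivity), div_mul_eq_mul_div]
        gcongr
        linarith
      have hb := (hKb lam τ' α N hl hl1 hτ0 hα hα1.le hN (G τ') (hF.continuous_source hτ0)
        (hF.bound_source hτ0) (hG τ' hτ0) 0 (h, 0) y
        (by simp [unspread]; positivity) hkR).1
      rw [hsm τ' hτ0]
      refine (le_abs_self _).trans (hb.trans ?_)
      calc _ ≤ N * K * τ' ^ (α / 2) * (2 * ρ ^ 3 / √lam * (τ' * √τ')⁻¹) := by gcongr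
        _ = N * K * (2 * ρ ^ 3 / √lam) * (τ' ^ (α / 2) * (τ' * √τ')⁻¹) := by ring
        _ = _ := by
          congr 1
          rw [Real.sqrt_eq_rpow]
          nth_rewrite 2 [← Real.rpow_one τ']
          rw [← Real.rpow_add hτ0, ← Real.rpow_neg hτ0.le, ← Real.rpow_add hτ0]
          congr 1
          ring)
  rw [hsol.peak_eq_zero le_rfl, zero_add] at hlong
  simp only [div_one, Real.rpow_one, Real.one_rpow, mul_one] at hshort hlong
  have hρα : ρ ^ α * ρ ^ 2 = ρ ^ (2 + α) := by
    rw [← Real.rpow_natCast ρ 2, ← Real.rpow_add hρ]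
    congr 1
    push_cast
    ring
  have hρα' : ρ ^ 3 * (ρ ^ 2) ^ ((α - 1) / 2) = ρ ^ (2 + α) := by
    rw [← Real.rpow_natCast ρ 2, ← Real.rpow_natCast ρ 3, ← Real.rpow_mul hρ.le,
      ← Real.rpow_add hρ]
    congr 1
    push_cast
    ring
  have e1 : N * ρ ^ α * ρ ^ 2 = N * ρ ^ (2 + α) := by rw [mul_assoc, hρα]
  have e2 : -(N * K * (2 * ρ ^ 3 / √lam) / ((α - 1) / 2) * (ρ ^ 2) ^ ((α - 1) / 2))
      = 4 * K / ((1 - α) * √lam) * N * ρ ^ (2 + α) := by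
    rw [← hρα']
    have : α - 1 ≠ 0 := by linarith
    field_simp
    ring
  -- The exponent is negative, so the primitive at `τ = 1` is nonpositive and can be dropped.
  have e3 : N * K * (2 * ρ ^ 3 / √lam) / ((α - 1) / 2) ≤ 0 :=
    div_nonpos_of_nonneg_of_nonpos (by positivity) (by linarith)
  have e4 : 0 ≤ N * ρ ^ α * τ := by have := hτ.1; positivity
  calc _ ≤ _ := hshort
    _ ≤ N * ρ ^ (2 + α) + 4 * K / ((1 - α) * √lam) * N * ρ ^ (2 + α) := by linarith
    _ = _ := by ring

/-- Schauder estimate for the second velocity derivatives, in terms of second differences. -/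
theorem exists_secondDiff_holder_bound (d : ℕ) {α lam : ℝ} (hα : 0 < α) (hα1 : α < 1)
    (hl : 0 < lam) (hl1 : lam ≤ 1) :
    ∃ C > 0, ∀ (u : ℝ → Fin d → Vec d) (F F₁ G : ℝ → Slice d → ℝ)
      (F₂ : ℝ → Vec d → Slice d → ℝ) (N : ℝ), StraightSolution lam u F F₁ G F₂ → 0 ≤ N →
      (∀ τ > 0, ShearHolder α N τ (G τ)) → ∀ (h y : Slice d) (e : Vec d) (ρ : ℝ), 0 < ρ → ρ ≤ 1 →
      ‖h.1‖ ≤ ρ ^ 3 → ‖h.2‖ ≤ ρ → e ≠ 0 → ‖e‖ ≤ ρ →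
      (F 0 (y + h + (0, e)) + F 0 (y + h - (0, e)) - 2 * F 0 (y + h))
        - (F 0 (y + (0, e)) + F 0 (y - (0, e)) - 2 * F 0 y) ≤ C * N * ρ ^ α * ‖e‖ ^ 2 := by
  obtain ⟨K, hK, hKb⟩ := exists_smooth_difference_bound d (4 / √lam)
  have hsl : 0 < √lam := by positivity
  have hα' : 0 < 1 - α := by linarith
  -- One term for each range of `τ`: below `‖e‖ ^ 2`, between `‖e‖ ^ 2` and `ρ ^ 2`, and above `ρ ^
  -- 2`.
  refine ⟨8 + 16 * K / (α * lam) + 32 * K / ((1 - α) * (lam * √lam)), by positivity, ?_⟩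
  intro u F F₁ G F₂ N hF hN hG h y e ρ hρ hρ1 hh1 hh2 he0 he
  set w : Slice d := (0, e) with hw
  have hep : 0 < ‖e‖ := norm_pos_iff.mpr he0
  -- The second difference in the direction `w` is again a solution, and so is its increment under
  -- translation by `h`.
  have hδ := ((hF.translate w).sub hF).sub (hF.sub (hF.translate (-w)))
  have hsol := (hδ.translate h).sub hδ
  have hsm : ∀ τ > 0, ∀ y, smooth lam τ (fun y => G τ (y + h + w) - G τ (y + h)
      - (G τ (y + h) - G τ (y + h + -w)) - (G τ (y + w) - G τ y - (G τ y - G τ (y + -w)))) y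
      = (smooth lam τ (G τ) (y + h + w) + smooth lam τ (G τ) (y + h - w)
        - 2 * smooth lam τ (G τ) (y + h))
        - (smooth lam τ (G τ) (y + w) + smooth lam τ (G τ) (y - w)
        - 2 * smooth lam τ (G τ) y) := by
    intro τ hτ y
    obtain ⟨B, hB⟩ := hF.bound_source hτ
    exact smooth_secondDiff_sub (hF.continuous_source hτ) hB w h y
  have hwa : ∀ τ > 0, ‖unspread lam τ w‖ ≤ 2 * ‖e‖ / (√lam * √τ) := fun τ hτ =>
    norm_unspread_vel_le hl hτ e
  have hwR : ∀ τ, ‖e‖ ^ 2 ≤ τ → ‖unspread lam τ w‖ ≤ 4 / √lam := by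
    intro τ hτ
    have hτ0 : 0 < τ := (by positivity : 0 < ‖e‖ ^ 2).trans_le hτ
    refine (hwa τ hτ0).trans ?_
    have : ‖e‖ ≤ √τ := Real.le_sqrt_of_sq_le hτ
    have hst : 0 < √τ := by positivity
    rw [div_le_div_iff₀ (by positivity) (by positivity)]
    nlinarith [mul_le_mul_of_nonneg_left this hsl.le, mul_pos hsl hst]
  have hwa2 : ∀ τ > 0, ‖unspread lam τ w‖ ^ 2 ≤ 4 * ‖e‖ ^ 2 / lam * τ⁻¹ := by
    intro τ hτ
    refine (pow_le_pow_left₀ (norm_nonneg _) (hwa τ hτ) 2).trans (le_of_eq ?_)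
    rw [div_pow, mul_pow, mul_pow, Real.sq_sqrt hl.le, Real.sq_sqrt hτ.le]
    field_simp
    norm_num
  have heρ : ‖e‖ ^ 2 ≤ ρ ^ 2 := pow_le_pow_left₀ hep.le he 2
  have hvalue : (F 0 (y + h + w) + F 0 (y + h - w) - 2 * F 0 (y + h))
        - (F 0 (y + w) + F 0 (y - w) - 2 * F 0 y)
      = F 0 (y + h + w) - F 0 (y + h) - (F 0 (y + h) - F 0 (y + h + -w))
        - (F 0 (y + w) - F 0 y - (F 0 y - F 0 (y + -w))) := by
    simp only [← sub_eq_add_neg]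
    ring
  rw [hvalue]
  refine hsol.le_of_peak_le (δ := ‖e‖ ^ 2) (by positivity) (fun τ hτ => ?_) y
  -- Up to time `‖e‖ ^ 2` the source is split into four first differences, each at most `2 * N * ‖e‖
  -- ^ α`: the shear displacement `τ ‖e‖` is at most `‖e‖ ^ 3`.
  have hshort := hsol.peak_le_add_rpow hl (c := 8 * N * ‖e‖ ^ α) (p := 1) hτ.1 hτ.2.le
    (by positivity) one_ne_zero (fun τ' hτ' y => by
      have hτ0 : 0 < τ' := hτ.1.trans_le hτ'.1
      obtain ⟨B, hB⟩ := hF.bound_source hτ0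
      rw [hsm τ' hτ0]
      have hd : ∀ y s, s = w ∨ s = -w →
          |smooth lam τ' (G τ') (y + s) - smooth lam τ' (G τ') y| ≤ 2 * N * ‖e‖ ^ α := by
        intro y s hs
        refine ((hG τ' hτ0).abs_smooth_sub_le (hF.continuous_source hτ0) hB y s).trans ?_
        have h1 : ‖s.1 - τ' • s.2‖ = τ' * ‖e‖ := by
          rcases hs with rfl | rfl <;> simp [hw, norm_smul, abs_of_pos hτ0]
        have h2 : ‖s.2‖ = ‖e‖ := by rcases hs with rfl | rfl <;> simp [hw]
        have h3 : (τ' * ‖e‖) ^ (α / 3) ≤ ‖e‖ ^ α := by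
          calc (τ' * ‖e‖) ^ (α / 3) ≤ (‖e‖ ^ 3) ^ (α / 3) := by
                refine Real.rpow_le_rpow (by positivity) ?_ (by positivity)
                calc τ' * ‖e‖ ≤ ‖e‖ ^ 2 * ‖e‖ := by gcongr; exact hτ'.2
                  _ = _ := by ring
            _ = _ := by
                rw [← Real.rpow_natCast ‖e‖ 3, ← Real.rpow_mul hep.le]
                congr 1
                push_cast
                ring
        rw [h1, h2]
        nlinarith
      have d1 := abs_le.mp (hd (y + h) w (Or.inl rfl))
      have d2 := abs_le.mp (hd (y + h) (-w) (Or.inr rfl))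
      have d3 := abs_le.mp (hd y w (Or.inl rfl))
      have d4 := abs_le.mp (hd y (-w) (Or.inr rfl))
      simp only [← sub_eq_add_neg] at d1 d2 d3 d4
      simp only [sub_self, Real.rpow_zero, mul_one]
      linarith [d1.2, d2.2, d3.1, d4.1])
  -- Between the scales, the second differences at `y + h` and at `y` are bounded separately by `‖e‖
  -- ^ 2 * τ ^ (α / 2 - 1)`, integrable at zero because `α > 0`; hence no loss as `e → 0`.
  have hmid := hsol.peak_le_add_rpow hl (c := 2 * N * K * (4 * ‖e‖ ^ 2 / lam)) (p := α / 2)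
    (τ₁ := ‖e‖ ^ 2) (τ₂ := ρ ^ 2) (by positivity) heρ (by positivity) (by positivity)
    (fun τ' hτ' y => by
      have hτ0 : 0 < τ' := (by positivity : 0 < ‖e‖ ^ 2).trans_le hτ'.1
      have hb : ∀ y, |smooth lam τ' (G τ') (y + w) + smooth lam τ' (G τ') (y - w)
          - 2 * smooth lam τ' (G τ') y| ≤ N * K * (4 * ‖e‖ ^ 2 / lam) * τ' ^ (α / 2 - 1) := by
        intro y
        refine (hKb lam τ' α N hl hl1 hτ0 hα hα1.le hN (G τ') (hF.continuous_source hτ0)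
          (hF.bound_source hτ0) (hG τ' hτ0) w 0 y (hwR τ' hτ'.1)
          (by simp [unspread]; positivity)).2.1.trans ?_
        rw [Real.rpow_sub_one hτ0.ne']
        calc _ ≤ N * K * τ' ^ (α / 2) * (4 * ‖e‖ ^ 2 / lam * τ'⁻¹) :=
              mul_le_mul_of_nonneg_left (hwa2 τ' hτ0) (by positivity)
          _ = _ := by ring
      rw [hsm τ' hτ0]
      have b1 := abs_le.mp (hb (y + h))
      have b2 := abs_le.mp (hb y)
      linarith [b1.2, b2.1])
  -- Beyond `ρ ^ 2` the increment `h` is exploited as a third difference, for an extra factor of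
  -- order `ρ / √τ`.
  have hlong := hsol.peak_le_add_rpow hl (c := N * K * (16 * ρ * ‖e‖ ^ 2 / (lam * √lam)))
    (p := (α - 1) / 2) (τ₁ := ρ ^ 2) (τ₂ := 1) (by positivity) (by nlinarith) (by positivity)
    (by linarith)
    (fun τ' hτ' y => by
      have hτ0 : 0 < τ' := (by positivity : 0 < ρ ^ 2).trans_le hτ'.1
      have hst : 0 < √τ' := by positivity
      have hρτ : ρ ≤ √τ' := Real.le_sqrt_of_sq_le hτ'.1
      have hk : ‖unspread lam τ' h‖ ≤ 4 * ρ / √lam * (√τ')⁻¹ := by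
        refine (norm_unspread_le hl hτ0 _).trans ?_
        have : ‖h.1‖ / τ' ≤ ρ := by
          rw [div_le_iff₀ hτ0]
          calc ‖h.1‖ ≤ ρ ^ 3 := hh1
            _ = ρ * ρ ^ 2 := by ring
            _ ≤ _ := by gcongr; exact hτ'.1
        calc _ ≤ 2 / (√lam * √τ') * (ρ + ρ) := by gcongr
          _ = _ := by field_simp; ring
      have hkR : ‖unspread lam τ' h‖ ≤ 4 / √lam := by
        refine hk.trans ?_
        rw [← div_eq_mul_inv, div_le_iff₀ hst, div_mul_eq_mul_div]
        gcongr
      have hb := (hKb lam τ' α N hl hl1 hτ0 hα hα1.le hN (G τ') (hF.continuous_source hτ0)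
        (hF.bound_source hτ0) (hG τ' hτ0) w h y (hwR τ' (heρ.trans hτ'.1)) hkR).2.2
      rw [hsm τ' hτ0]
      refine (le_abs_self _).trans (hb.trans ?_)
      calc _ ≤ N * K * τ' ^ (α / 2) * ((4 * ρ / √lam * (√τ')⁻¹) * (4 * ‖e‖ ^ 2 / lam * τ'⁻¹)) := by
            gcongr
            exact hwa2 τ' hτ0
        _ = N * K * (16 * ρ * ‖e‖ ^ 2 / (lam * √lam)) * (τ' ^ (α / 2) * (τ' * √τ')⁻¹) := by
            field_simp
            ring
        _ = _ := by
          congr 1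
          rw [Real.sqrt_eq_rpow]
          nth_rewrite 2 [← Real.rpow_one τ']
          rw [← Real.rpow_add hτ0, ← Real.rpow_neg hτ0.le, ← Real.rpow_add hτ0]
          congr 1
          ring)
  rw [hsol.peak_eq_zero le_rfl, zero_add] at hlong
  simp only [div_one, Real.rpow_one, Real.one_rpow, mul_one] at hshort hlong
  have hρα : (ρ ^ 2) ^ (α / 2) = ρ ^ α := by
    rw [← Real.rpow_natCast ρ 2, ← Real.rpow_mul hρ.le]
    congr 1
    push_cast
    ring
  have hρα' : ρ * (ρ ^ 2) ^ ((α - 1) / 2) = ρ ^ α := by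
    rw [← Real.rpow_natCast ρ 2, ← Real.rpow_mul hρ.le]
    nth_rewrite 1 [← Real.rpow_one ρ]
    rw [← Real.rpow_add hρ]
    congr 1
    push_cast
    ring
  have e1 : 8 * N * ‖e‖ ^ α * ‖e‖ ^ 2 ≤ 8 * N * ρ ^ α * ‖e‖ ^ 2 := by
    gcongr
  have e2 : 2 * N * K * (4 * ‖e‖ ^ 2 / lam) / (α / 2) * (ρ ^ 2) ^ (α / 2)
      = 16 * K / (α * lam) * N * ρ ^ α * ‖e‖ ^ 2 := by
    rw [hρα]
    field_simp
    ring
  have e3 : -(N * K * (16 * ρ * ‖e‖ ^ 2 / (lam * √lam)) / ((α - 1) / 2)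
        * (ρ ^ 2) ^ ((α - 1) / 2))
      = 32 * K / ((1 - α) * (lam * √lam)) * N * ρ ^ α * ‖e‖ ^ 2 := by
    rw [← hρα']
    have : α - 1 ≠ 0 := by linarith
    field_simp
    ring
  have e4 : N * K * (16 * ρ * ‖e‖ ^ 2 / (lam * √lam)) / ((α - 1) / 2) ≤ 0 :=
    div_nonpos_of_nonneg_of_nonpos (by positivity) (by linarith)
  have e5 : 0 ≤ 8 * N * ‖e‖ ^ α * τ := by have := hτ.1; positivity
  have e6 : 0 ≤ 2 * N * K * (4 * ‖e‖ ^ 2 / lam) / (α / 2) * (‖e‖ ^ 2) ^ (α / 2) := by positivity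
  calc _ ≤ _ := hshort
    _ ≤ 8 * N * ρ ^ α * ‖e‖ ^ 2 + 16 * K / (α * lam) * N * ρ ^ α * ‖e‖ ^ 2
        + 32 * K / ((1 - α) * (lam * √lam)) * N * ρ ^ α * ‖e‖ ^ 2 := by linarith
    _ = _ := by ring

end Schauder

/-! ### From local to global Hölder continuity. -/

section GlobalHolder

variable {d : ℕ}

/-- A function on `B₁ × B₁` which is Hölder continuous at small distances and has compact support
is globally Hölder continuous after extension by zero. -/
theorem holder_of_local_of_compact_support {p q N : ℝ} (hp : 0 ≤ p) (hq : 0 ≤ q) (hN : 0 ≤ N)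
    {G : Slice d → ℝ} {K : Set (Slice d)} (hK : IsCompact K)
    (hKB : K ⊆ Metric.ball 0 1) (hG0 : ∀ y, y ∉ K → G y = 0)
    (hloc : ∀ y ∈ Metric.ball (0 : Slice d) 1, ∀ y' ∈ Metric.ball (0 : Slice d) 1,
      ‖y.1 - y'.1‖ < 1 / 2 → ‖y.2 - y'.2‖ < 1 / 2 →
      |G y - G y'| ≤ N * (‖y.1 - y'.1‖ ^ p + ‖y.2 - y'.2‖ ^ q)) (y y' : Slice d) :
    |G y - G y'| ≤ 4 * N * (‖y.1 - y'.1‖ ^ p + ‖y.2 - y'.2‖ ^ q) := by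
  have hin : ∀ y ∈ Metric.ball (0 : Slice d) 1, ∀ y' ∈ Metric.ball (0 : Slice d) 1,
      |G y - G y'| ≤ 4 * N * (‖y.1 - y'.1‖ ^ p + ‖y.2 - y'.2‖ ^ q) := by
    intro y hy y' hy'
    -- The ball has diameter `2` in the maximum norm, so a quarter of a chord is shorter than `1 /
    -- 2`; four steps give the factor `4`.
    have hstep : ∀ r ∈ Icc (0 : ℝ) (3 / 4),
        |G (y + r • (y' - y)) - G (y + (r + 1 / 4) • (y' - y))|
          ≤ N * (‖y.1 - y'.1‖ ^ p + ‖y.2 - y'.2‖ ^ q) := by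
      intro r hr
      have hmem : ∀ s ∈ Icc (0 : ℝ) 1, y + s • (y' - y) ∈ Metric.ball (0 : Slice d) 1 :=
        fun s hs => (convex_ball 0 1).add_smul_sub_mem hy hy' hs
      have hd : (y + r • (y' - y)) - (y + (r + 1 / 4) • (y' - y)) = (1 / 4 : ℝ) • (y - y') := by
        module
      have hd1 : ‖(y + r • (y' - y)).1 - (y + (r + 1 / 4) • (y' - y)).1‖
          = 1 / 4 * ‖y.1 - y'.1‖ := by
        rw [← Prod.fst_sub, hd, Prod.smul_fst, norm_smul, Prod.fst_sub]
        norm_num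
      have hd2 : ‖(y + r • (y' - y)).2 - (y + (r + 1 / 4) • (y' - y)).2‖
          = 1 / 4 * ‖y.2 - y'.2‖ := by
        rw [← Prod.snd_sub, hd, Prod.smul_snd, norm_smul, Prod.snd_sub]
        norm_num
      have hlt : ‖y - y'‖ < 2 := by
        have h1 := norm_sub_le y y'
        have h2 := mem_ball_zero_iff.mp hy
        have h3 := mem_ball_zero_iff.mp hy'
        linarith
      have hlt1 : ‖y.1 - y'.1‖ < 2 := (norm_fst_le (y - y')).trans_lt hlt
      have hlt2 : ‖y.2 - y'.2‖ < 2 := (norm_snd_le (y - y')).trans_lt hlt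
      have := hloc _ (hmem r ⟨hr.1, by linarith [hr.2]⟩) _
        (hmem (r + 1 / 4) ⟨by linarith [hr.1], by linarith [hr.2]⟩)
        (by rw [hd1]; linarith) (by rw [hd2]; linarith)
      rw [hd1, hd2] at this
      refine this.trans ?_
      have n1 := norm_nonneg (y.1 - y'.1)
      have n2 := norm_nonneg (y.2 - y'.2)
      gcongr <;> linarith
    have s0 := hstep 0 ⟨by norm_num, by norm_num⟩
    have s1 := hstep (1 / 4) ⟨by norm_num, by norm_num⟩
    have s2 := hstep (1 / 2) ⟨by norm_num, by norm_num⟩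
    have s3 := hstep (3 / 4) ⟨by norm_num, by norm_num⟩
    norm_num at s0 s1 s2 s3
    rw [abs_le] at s0 s1 s2 s3 ⊢
    constructor
    · linarith [s0.1, s1.1, s2.1, s3.1]
    · linarith [s0.2, s1.2, s2.2, s3.2]
  have hout : ∀ y ∈ Metric.ball (0 : Slice d) 1, ∀ y' ∉ Metric.ball (0 : Slice d) 1,
      |G y - G y'| ≤ 4 * N * (‖y.1 - y'.1‖ ^ p + ‖y.2 - y'.2‖ ^ q) := by
    intro y hy y' hy'
    rw [hG0 y' fun h => hy' (hKB h)]
    have hrhs : 0 ≤ 4 * N * (‖y.1 - y'.1‖ ^ p + ‖y.2 - y'.2‖ ^ q) := by positivity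
    by_cases hyK : y ∈ K
    swap
    · rw [hG0 y hyK]
      simpa using hrhs
    -- A segment leaving the ball from a point of `K` must cross the gap between `K` and the
    -- complement of the ball, two disjoint closed sets. The function vanishes there, and only a
    -- shorter chord remains.
    obtain ⟨w, hw, hwB, hwK⟩ : ∃ w ∈ segment ℝ y y', w ∈ Metric.ball (0 : Slice d) 1 ∧ w ∉ K := by
      by_contra hcon
      push Not at hcon
      have hconn := isPreconnected_closed_iff.mp (convex_segment (𝕜 := ℝ) y y').isPreconnected K
        (Metric.ball (0 : Slice d) 1)ᶜ hK.isClosed Metric.isOpen_ball.isClosed_compl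
        (fun w hw => by
          by_cases hwB : w ∈ Metric.ball (0 : Slice d) 1
          · exact Or.inl (hcon w hw hwB)
          · exact Or.inr hwB)
        ⟨y, left_mem_segment ℝ y y', hyK⟩ ⟨y', right_mem_segment ℝ y y', hy'⟩
      obtain ⟨w, -, hwK, hwB⟩ := hconn
      exact hwB (hKB hwK)
    rw [segment_eq_image'] at hw
    obtain ⟨r, hr, rfl⟩ := hw
    have h := hin y hy _ hwB
    rw [hG0 _ hwK] at h
    refine h.trans ?_
    have hd : y - (y + r • (y' - y)) = r • (y - y') := by module
    have hd1 : ‖y.1 - (y + r • (y' - y)).1‖ ≤ ‖y.1 - y'.1‖ := by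
      rw [← Prod.fst_sub, hd, Prod.smul_fst, norm_smul, Prod.fst_sub, Real.norm_of_nonneg hr.1]
      exact mul_le_of_le_one_left (norm_nonneg _) hr.2
    have hd2 : ‖y.2 - (y + r • (y' - y)).2‖ ≤ ‖y.2 - y'.2‖ := by
      rw [← Prod.snd_sub, hd, Prod.smul_snd, norm_smul, Prod.snd_sub, Real.norm_of_nonneg hr.1]
      exact mul_le_of_le_one_left (norm_nonneg _) hr.2
    gcongr
  by_cases hy : y ∈ Metric.ball (0 : Slice d) 1 <;> by_cases hy' : y' ∈ Metric.ball (0 : Slice d) 1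
  · exact hin y hy y' hy'
  · exact hout y hy y' hy'
  · have := hout y' hy' y hy
    rwa [abs_sub_comm, norm_sub_rev, norm_sub_rev y'.2] at this
  · rw [hG0 y fun h => hy (hKB h), hG0 y' fun h => hy' (hKB h)]
    simp only [sub_self, abs_zero]
    positivity

end GlobalHolder

/-! ### Decomposition of an elliptic matrix into squares. -/

section MatrixSquareRoot

variable {d : ℕ}

open scoped MatrixOrder Matrix.Norms.L2Operator in
theorem exists_eq_transpose_mul_self {S : Matrix (Fin d) (Fin d) ℝ} (hS : S.PosSemidef) :
    ∃ B : Matrix (Fin d) (Fin d) ℝ, S = B.transpose * B := by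
  obtain ⟨B, hB⟩ := CStarAlgebra.nonneg_iff_eq_star_mul_self.mp hS.nonneg
  refine ⟨B, ?_⟩
  rw [hB, Matrix.star_eq_conjTranspose, Matrix.conjTranspose_eq_transpose_of_trivial]

theorem bilinear_apply_eq_sum (H : Vec d →L[ℝ] Vec d →L[ℝ] ℝ) (w : Vec d) :
    H w w = ∑ i, ∑ j, w i * w j * H (EuclideanSpace.single i 1) (EuclideanSpace.single j 1) := by
  have hw : w = ∑ i, w i • (EuclideanSpace.single i (1 : ℝ) : Vec d) := by
    ext j
    simp [Finset.sum_apply, Pi.single_apply]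
  conv_lhs => rw [hw]
  simp only [map_sum, map_smul, sum_apply, smul_apply,
    smul_eq_mul, Finset.mul_sum]
  refine Finset.sum_comm.trans ?_
  refine Finset.sum_congr rfl fun i _ => Finset.sum_congr rfl fun j _ => ?_
  ring

/-- An elliptic matrix acts on symmetric forms as `Λ⁻¹ Id` plus a sum of squares. -/
theorem exists_trace_eq_sum_squares {Λ : ℝ} (hΛ : 0 < Λ) {A : Matrix (Fin d) (Fin d) ℝ}
    (hA : ∀ ξ : Fin d → ℝ, Λ⁻¹ * (ξ ⬝ᵥ ξ) ≤ ξ ⬝ᵥ A.mulVec ξ ∧ ξ ⬝ᵥ A.mulVec ξ ≤ Λ * (ξ ⬝ᵥ ξ)) :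
    ∃ u : Fin d → Vec d, (∀ k, ‖u k‖ ^ 2 ≤ d * Λ) ∧
      ∀ H : Vec d →L[ℝ] Vec d →L[ℝ] ℝ, (∀ x y, H x y = H y x) →
        (A * Matrix.of fun i j => H (EuclideanSpace.single i 1) (EuclideanSpace.single j 1)).trace
          = Λ⁻¹ * ∑ i, H (EuclideanSpace.single i 1) (EuclideanSpace.single i 1)
            + ∑ k, H (u k) (u k) := by
  -- Only the symmetric part of `A` acts on symmetric forms. After removal of `Λ⁻¹` it is
  -- nonnegative, and the rows of a factor `B` with `S = Bᵀ B` are the vectors sought.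
  set S : Matrix (Fin d) (Fin d) ℝ := (1 / 2 : ℝ) • (A + A.transpose) - Λ⁻¹ • 1 with hS
  have hquad : ∀ ξ : Fin d → ℝ, ξ ⬝ᵥ S.mulVec ξ = ξ ⬝ᵥ A.mulVec ξ - Λ⁻¹ * (ξ ⬝ᵥ ξ) := by
    intro ξ
    have ht : ξ ⬝ᵥ A.transpose.mulVec ξ = ξ ⬝ᵥ A.mulVec ξ := by
      rw [Matrix.mulVec_transpose, dotProduct_comm, ← Matrix.dotProduct_mulVec]
    simp only [hS, Matrix.sub_mulVec, Matrix.smul_mulVec, Matrix.add_mulVec, Matrix.one_mulVec,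
      dotProduct_sub, dotProduct_smul, dotProduct_add, ht, smul_eq_mul]
    ring
  have hpsd : S.PosSemidef := by
    refine Matrix.PosSemidef.of_dotProduct_mulVec_nonneg ?_ fun ξ => ?_
    · rw [Matrix.IsHermitian, Matrix.conjTranspose_eq_transpose_of_trivial, hS]
      simp [add_comm]
    · rw [star_trivial, hquad]
      linarith [(hA ξ).1]
  obtain ⟨B, hB⟩ := exists_eq_transpose_mul_self hpsd
  refine ⟨fun k => WithLp.toLp 2 (B k), fun k => ?_, fun H hH => ?_⟩
  · have htr : S.trace ≤ d * Λ := by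
      have hdiag : ∀ i, S i i ≤ Λ := by
        intro i
        have h1 := hquad (Pi.single i 1)
        have h2 := (hA (Pi.single i 1)).2
        simp only [Matrix.mulVec_single, MulOpposite.op_one, one_smul, single_dotProduct, one_mul,
          Matrix.col_apply, Pi.single_eq_same, mul_one] at h1 h2
        have : 0 < Λ⁻¹ := by positivity
        linarith
      calc S.trace = ∑ i, S i i := rfl
        _ ≤ ∑ _i : Fin d, Λ := Finset.sum_le_sum fun i _ => hdiag i
        _ = d * Λ := by simp
    have htr2 : S.trace = ∑ k, ‖(WithLp.toLp 2 (B k) : Vec d)‖ ^ 2 := by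
      rw [hB]
      simp only [Matrix.trace, Matrix.diag, Matrix.mul_apply, Matrix.transpose_apply,
        EuclideanSpace.real_norm_sq_eq]
      rw [Finset.sum_comm]
      refine Finset.sum_congr rfl fun i _ => Finset.sum_congr rfl fun j _ => ?_
      ring
    rw [htr2] at htr
    exact (Finset.single_le_sum (f := fun k => ‖(WithLp.toLp 2 (B k) : Vec d)‖ ^ 2)
      (fun i _ => sq_nonneg _) (Finset.mem_univ k)).trans htr
  · set M : Matrix (Fin d) (Fin d) ℝ :=
      Matrix.of fun i j => H (EuclideanSpace.single i 1) (EuclideanSpace.single j 1) with hM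
    have hMt : M.transpose = M := by
      ext i j
      simp only [hM, Matrix.transpose_apply, Matrix.of_apply]
      exact hH _ _
    have hAS : (A * M).trace = (S * M).trace + Λ⁻¹ * M.trace := by
      have ht : (A.transpose * M).trace = (A * M).trace := by
        rw [← Matrix.trace_transpose, Matrix.transpose_mul, hMt, Matrix.transpose_transpose,
          Matrix.trace_mul_comm]
      simp only [hS, Matrix.sub_mul, Matrix.smul_mul, Matrix.add_mul, Matrix.one_mul,
        Matrix.trace_sub, Matrix.trace_smul, Matrix.trace_add, ht, smul_eq_mul]
      ring
    have hSM : (S * M).trace = ∑ k, H (WithLp.toLp 2 (B k)) (WithLp.toLp 2 (B k)) := by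
      simp_rw [bilinear_apply_eq_sum]
      rw [hB]
      simp only [Matrix.trace, Matrix.diag, Matrix.mul_apply, Matrix.transpose_apply,
        Finset.sum_mul]
      have e : ∀ i, ∑ x, ∑ i_1, B i_1 i * B i_1 x * M x i
          = ∑ k, ∑ x, B k i * B k x * M x i := fun i => Finset.sum_comm
      simp_rw [e]
      rw [Finset.sum_comm]
      refine Finset.sum_congr rfl fun k _ => Finset.sum_congr rfl fun i _ =>
        Finset.sum_congr rfl fun j _ => ?_
      rw [← hMt]
      rfl
    rw [hAS, hSM]
    have : M.trace = ∑ i, H (EuclideanSpace.single i 1) (EuclideanSpace.single i 1) := rfl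
    rw [this]
    ring

end MatrixSquareRoot

/-! ### Extension by zero and second derivatives in velocity. -/

section ZeroExtension

variable {d : ℕ}

theorem mem_kineticCylinder_one {z : Phase d} :
    z ∈ kineticCylinder d 1 ↔ (-1 < z.1 ∧ z.1 ≤ 0) ∧ ‖z.2.1‖ < 1 ∧ ‖z.2.2‖ < 1 := by
  simp [kineticCylinder, Set.mem_prod]

/-- The cylinder contains its final time, so it is open only relative to `{t ≤ 0}`. -/
theorem kineticCylinder_mem_nhdsWithin {z : Phase d} (hz : z ∈ kineticCylinder d 1) :
    kineticCylinder d 1 ∈ 𝓝[Iic 0 ×ˢ univ] z := by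
  rw [mem_kineticCylinder_one] at hz
  have ho : IsOpen ({w : Phase d | -1 < w.1} ∩ ({w | ‖w.2.1‖ < 1} ∩ {w | ‖w.2.2‖ < 1})) :=
    (isOpen_lt (by fun_prop) (by fun_prop)).inter
      ((isOpen_lt (by fun_prop) (by fun_prop)).inter (isOpen_lt (by fun_prop) (by fun_prop)))
  filter_upwards [mem_nhdsWithin_of_mem_nhds (ho.mem_nhds ⟨hz.1.1, hz.2⟩), self_mem_nhdsWithin]
    with w hw hw0
  exact mem_kineticCylinder_one.mpr ⟨⟨hw.1, hw0.1⟩, hw.2⟩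

/-- In `{t ≤ 0}` the cylinder and the complement of `K` are relatively open and cover; the extension
is continuous on each. -/
theorem continuousOn_indicator_of_compact_support {E : Type*} [NormedAddCommGroup E]
    {φ : Phase d → E} {K : Set (Phase d)} (hK : IsCompact K)
    (hφ : ContinuousOn φ (kineticCylinder d 1)) (h0 : ∀ z ∈ kineticCylinder d 1, z ∉ K → φ z = 0)
    (hKQ : K ⊆ kineticCylinder d 1) :
    ContinuousOn ((kineticCylinder d 1).indicator φ) (Iic 0 ×ˢ univ) ∧
      ∃ B, ∀ z, ‖(kineticCylinder d 1).indicator φ z‖ ≤ B := by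
  classical
  have hoff : ∀ z, z ∉ K → (kineticCylinder d 1).indicator φ z = 0 := by
    intro z hz
    by_cases hQ : z ∈ kineticCylinder d 1
    · rw [indicator_of_mem hQ, h0 z hQ hz]
    · rw [indicator_of_notMem hQ]
  refine ⟨fun z hz => ?_, ?_⟩
  · by_cases hQ : z ∈ kineticCylinder d 1
    · have hn := kineticCylinder_mem_nhdsWithin hQ
      have h1 : ContinuousWithinAt φ (Iic 0 ×ˢ univ) z :=
        (hφ z hQ).mono_of_mem_nhdsWithin hn
      refine h1.congr_of_eventuallyEq ?_ (indicator_of_mem hQ φ)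
      filter_upwards [hn] with w hw
      exact indicator_of_mem hw φ
    · have hzK : z ∉ K := fun h => hQ (hKQ h)
      have : ContinuousAt ((kineticCylinder d 1).indicator φ) z := by
        refine (continuousAt_const (y := (0 : E))).congr ?_
        filter_upwards [hK.isClosed.isOpen_compl.mem_nhds hzK] with w hw
        exact (hoff w hw).symm
      exact this.continuousWithinAt
  · obtain ⟨B, hB⟩ := hK.exists_bound_of_continuousOn (hφ.mono hKQ)
    refine ⟨max B 0, fun z => ?_⟩
    by_cases hz : z ∈ K
    · rw [indicator_of_mem (hKQ hz)]
      exact (hB z hz).trans (le_max_left _ _)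
    · rw [hoff z hz, norm_zero]
      exact le_max_right _ _

variable {f : Phase d → ℝ} {K : Set (Phase d)}

theorem continuous_transportCurve (z : Phase d) : Continuous (transportCurve z) := by
  unfold transportCurve
  fun_prop

theorem transportCurve_zero (z : Phase d) : transportCurve z 0 = z := by
  simp [transportCurve]

theorem transportDeriv_eq_zero (hK : IsCompact K)
    (h0 : ∀ z ∈ kineticCylinder d 1, z ∉ K → f z = 0) {z : Phase d}
    (hz : z ∈ kineticCylinder d 1) (hzK : z ∉ K) :
    transportDeriv (kineticCylinder d 1) f z = 0 := by
  unfold transportDeriv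
  have hev : (fun s => f (transportCurve z s)) =ᶠ[𝓝[{s | transportCurve z s ∈
      kineticCylinder d 1}] 0] fun _ => 0 := by
    have : transportCurve z ⁻¹' Kᶜ ∈ 𝓝 (0 : ℝ) := by
      apply (continuous_transportCurve z).continuousAt.preimage_mem_nhds
      rw [transportCurve_zero]
      exact hK.isClosed.isOpen_compl.mem_nhds hzK
    filter_upwards [mem_nhdsWithin_of_mem_nhds this, self_mem_nhdsWithin] with s hs hsQ
    exact h0 _ hsQ hs
  rw [hev.derivWithin_eq (by simp only [transportCurve_zero]; exact h0 z hz hzK)]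
  simp

/-- Points with the same time and position and with a velocity close to that of a point of the
cylinder are in the cylinder. -/
theorem eventually_mem_kineticCylinder {z : Phase d} (hz : z ∈ kineticCylinder d 1) :
    ∀ᶠ v in 𝓝 z.2.2, (z.1, z.2.1, v) ∈ kineticCylinder d 1 := by
  rw [mem_kineticCylinder_one] at hz
  have : IsOpen {v : Vec d | ‖v‖ < 1} := isOpen_lt (by fun_prop) (by fun_prop)
  filter_upwards [this.mem_nhds hz.2.2] with v hv
  exact mem_kineticCylinder_one.mpr ⟨hz.1, hz.2.1, hv⟩

theorem eventually_slice_notMem (hK : IsCompact K) {z : Phase d} (hzK : z ∉ K) :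
    ∀ᶠ v in 𝓝 z.2.2, (z.1, z.2.1, v) ∉ K := by
  have hc : Continuous fun v : Vec d => ((z.1, z.2.1, v) : Phase d) := by fun_prop
  exact hc.continuousAt.preimage_mem_nhds (hK.isClosed.isOpen_compl.mem_nhds hzK)

theorem hessV_congr {f g : Phase d → ℝ} {z : Phase d}
    (h : ∀ᶠ v in 𝓝 z.2.2, f (z.1, z.2.1, v) = g (z.1, z.2.1, v)) : hessV f z = hessV g z := by
  have h' : (fun v => f (z.1, z.2.1, v)) =ᶠ[𝓝 z.2.2] fun v => g (z.1, z.2.1, v) := h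
  exact h'.fderiv.fderiv_eq

theorem hessV_zero (z : Phase d) : hessV (fun _ => 0) z = 0 := by
  simp [hessV]

theorem hessV_eq_zero (hK : IsCompact K)
    (h0 : ∀ z ∈ kineticCylinder d 1, z ∉ K → f z = 0) {z : Phase d}
    (hz : z ∈ kineticCylinder d 1) (hzK : z ∉ K) : hessV f z = 0 := by
  rw [← hessV_zero z]
  apply hessV_congr
  filter_upwards [eventually_mem_kineticCylinder hz, eventually_slice_notMem hK hzK] with v h1 h2
  exact h0 _ h1 h2

theorem indicator_eq_zero_of_notMem
    (h0 : ∀ z ∈ kineticCylinder d 1, z ∉ K → f z = 0) {z : Phase d} (hz : z ∉ K) :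
    (kineticCylinder d 1).indicator f z = 0 := by
  classical
  rw [indicator_apply]
  split_ifs with h
  · exact h0 z h hz
  · rfl

theorem contDiff_indicator (hf : KineticC2 1 f) (hK : IsCompact K) (hKQ : K ⊆ kineticCylinder d 1)
    (h0 : ∀ z ∈ kineticCylinder d 1, z ∉ K → f z = 0) (t : ℝ) (x : Vec d) :
    ContDiff ℝ 2 fun v => (kineticCylinder d 1).indicator f (t, x, v) := by
  rw [contDiff_iff_contDiffAt]
  intro v
  by_cases hQ : (t, x, v) ∈ kineticCylinder d 1
  · have hQ' := hQ
    obtain ⟨ht, hx, hv⟩ := hQ'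
    have h1 : ContDiffAt ℝ 2 (fun v => f (t, x, v)) v :=
      (hf.contDiffOn_v t ht x hx).contDiffAt (Metric.isOpen_ball.mem_nhds hv)
    refine h1.congr_of_eventuallyEq ?_
    filter_upwards [eventually_mem_kineticCylinder hQ] with w hw
    exact indicator_of_mem hw f
  · refine (contDiffAt_const (c := (0 : ℝ))).congr_of_eventuallyEq ?_
    filter_upwards [eventually_slice_notMem hK fun h => hQ (hKQ h)] with w hw
    exact indicator_eq_zero_of_notMem h0 hw

theorem hessV_indicator (hK : IsCompact K) (hKQ : K ⊆ kineticCylinder d 1)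
    (h0 : ∀ z ∈ kineticCylinder d 1, z ∉ K → f z = 0) (z : Phase d) :
    hessV ((kineticCylinder d 1).indicator f) z = (kineticCylinder d 1).indicator (hessV f) z := by
  by_cases hQ : z ∈ kineticCylinder d 1
  · rw [indicator_of_mem hQ]
    apply hessV_congr
    filter_upwards [eventually_mem_kineticCylinder hQ] with w hw
    exact indicator_of_mem hw f
  · rw [indicator_of_notMem hQ, ← hessV_zero z]
    apply hessV_congr
    filter_upwards [eventually_slice_notMem hK fun h => hQ (hKQ h)] with w hw
    exact indicator_eq_zero_of_notMem h0 hw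

/-- Strictly before the final time the one-sided derivative is two-sided. The straightened problem
needs it only for `τ > 0`, hence only at times below zero. -/
theorem hasDerivAt_indicator_transport (hf : KineticC2 1 f) (hK : IsCompact K)
    (hKQ : K ⊆ kineticCylinder d 1) (h0 : ∀ z ∈ kineticCylinder d 1, z ∉ K → f z = 0)
    {z : Phase d} (hz : z.1 < 0) :
    HasDerivAt (fun s => (kineticCylinder d 1).indicator f (transportCurve z s))
      ((kineticCylinder d 1).indicator (transportDeriv (kineticCylinder d 1) f) z) 0 := by
  by_cases hQ : z ∈ kineticCylinder d 1
  · rw [indicator_of_mem hQ]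
    have hnh : {s | transportCurve z s ∈ kineticCylinder d 1} ∈ 𝓝 (0 : ℝ) := by
      have h1 := kineticCylinder_mem_nhdsWithin hQ
      rw [nhdsWithin_eq_nhds.mpr (prod_mem_nhds (Iic_mem_nhds hz) univ_mem)] at h1
      apply (continuous_transportCurve z).continuousAt.preimage_mem_nhds
      rwa [transportCurve_zero]
    have h2 := (hf.transport_differentiable z hQ).hasDerivWithinAt.hasDerivAt hnh
    refine h2.congr_of_eventuallyEq ?_
    filter_upwards [hnh] with s hs
    exact indicator_of_mem hs f
  · rw [indicator_of_notMem hQ]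
    refine (hasDerivAt_const 0 (0 : ℝ)).congr_of_eventuallyEq ?_
    have : transportCurve z ⁻¹' Kᶜ ∈ 𝓝 (0 : ℝ) := by
      apply (continuous_transportCurve z).continuousAt.preimage_mem_nhds
      rw [transportCurve_zero]
      exact hK.isClosed.isOpen_compl.mem_nhds fun h => hQ (hKQ h)
    filter_upwards [this] with s hs
    exact indicator_eq_zero_of_notMem h0 hs

/-- First and second derivatives of a function of the velocity along a line. -/
theorem hasDerivAt_line_of_contDiff {φ : Vec d → ℝ} (hφ : ContDiff ℝ 2 φ) (v e : Vec d) (r : ℝ) :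
    HasDerivAt (fun r : ℝ => φ (v + r • e)) (fderiv ℝ φ (v + r • e) e) r ∧
    HasDerivAt (fun r : ℝ => fderiv ℝ φ (v + r • e) e)
      (fderiv ℝ (fderiv ℝ φ) (v + r • e) e e) r := by
  have hl : HasDerivAt (fun r : ℝ => v + r • e) e r := by
    simpa using ((hasDerivAt_id r).smul_const e).const_add v
  constructor
  · exact ((hφ.differentiable (by norm_num)).differentiableAt.hasFDerivAt).comp_hasDerivAt r hl
  · have h1 : ContDiff ℝ 1 (fderiv ℝ φ) := hφ.fderiv_right (by norm_num)
    have h2 := ((h1.differentiable (by norm_num)).differentiableAt.hasFDerivAt).comp_hasDerivAt r hl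
    exact h2.clm_apply (hasDerivAt_const r e) |>.congr_deriv (by simp)

theorem tendsto_secondDiff_of_contDiff {φ : Vec d → ℝ} (hφ : ContDiff ℝ 2 φ) (v e : Vec d) :
    Tendsto (fun ε : ℝ => (φ (v + ε • e) + φ (v + (-ε) • e) - 2 * φ v) / ε ^ 2) (𝓝[>] 0)
      (𝓝 (fderiv ℝ (fderiv ℝ φ) v e e)) := by
  have hcont : Continuous (fun r : ℝ => fderiv ℝ (fderiv ℝ φ) (v + r • e) e e) := by
    have h1 : ContDiff ℝ 1 (fderiv ℝ φ) := hφ.fderiv_right (by norm_num)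
    have h2 : Continuous (fderiv ℝ (fderiv ℝ φ)) := h1.continuous_fderiv (by norm_num)
    have h3 : Continuous fun r : ℝ => fderiv ℝ (fderiv ℝ φ) (v + r • e) := h2.comp (by fun_prop)
    exact (h3.clm_apply continuous_const).clm_apply continuous_const
  have h := tendsto_secondDiff (fun r => (hasDerivAt_line_of_contDiff hφ v e r).1)
    (fun r => (hasDerivAt_line_of_contDiff hφ v e r).2) hcont.continuousAt
  simpa only [zero_smul, add_zero] using h

theorem hessV_symm {f : Phase d → ℝ} {z : Phase d}
    (hf : ContDiffAt ℝ 2 (fun v => f (z.1, z.2.1, v)) z.2.2) (e e' : Vec d) :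
    hessV f z e e' = hessV f z e' e :=
  (hf.isSymmSndFDerivAt (by simp)).eq e e'

end ZeroExtension

/-! ### Passage to straightened coordinates. -/

section Straightening

variable {d : ℕ}

/-- A function of `(t, x, v)` along the transport field, backwards from time `t`. -/
def straighten {E : Type*} (t : ℝ) (φ : Phase d → E) (τ : ℝ) (y : Slice d) : E :=
  φ (t - τ, y.1 - τ • y.2, y.2)

/-- The source term of the equation with diffusion matrix `lam Id + ∑ k, u k ⊗ u k`, for given
transport derivative `p` and Hessian `H`. -/
noncomputable def sourceTerm (lam : ℝ) (u : Fin d → Vec d) (p : ℝ)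
    (H : Vec d →L[ℝ] Vec d →L[ℝ] ℝ) : ℝ :=
  p - (lam * ∑ i, H (EuclideanSpace.single i 1) (EuclideanSpace.single i 1) + ∑ k, H (u k) (u k))

/-- Moving along `kineticDir τ e` keeps `x - τ v` fixed and changes the velocity only, so the second
difference of `F τ` is one of `f` in velocity. The source is defined by the equation, so `u` is
arbitrary here; its choice matters only for the Hölder bound. -/
theorem straightSolution_of_kineticC2 {f : Phase d → ℝ} {K : Set (Phase d)} (hf : KineticC2 1 f)
    (hK : IsCompact K) (hKQ : K ⊆ kineticCylinder d 1)
    (h0 : ∀ z ∈ kineticCylinder d 1, z ∉ K → f z = 0) {t : ℝ} (ht : t ≤ 0) (lam : ℝ)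
    (u : ℝ → Fin d → Vec d) :
    StraightSolution lam u (straighten t ((kineticCylinder d 1).indicator f))
      (straighten t ((kineticCylinder d 1).indicator (transportDeriv (kineticCylinder d 1) f)))
      (fun τ y => sourceTerm lam (u τ)
        (straighten t ((kineticCylinder d 1).indicator (transportDeriv (kineticCylinder d 1) f)) τ y)
        (straighten t ((kineticCylinder d 1).indicator (hessV f)) τ y))
      (fun τ e y => straighten t ((kineticCylinder d 1).indicator (hessV f)) τ y e e) := by
  obtain ⟨c0, B0, hB0⟩ := continuousOn_indicator_of_compact_support hK hf.continuousOn h0 hKQ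
  obtain ⟨c1, B1, hB1⟩ := continuousOn_indicator_of_compact_support hK hf.transport_continuousOn
    (fun z => transportDeriv_eq_zero hK h0) hKQ
  obtain ⟨c2, B2, hB2⟩ := continuousOn_indicator_of_compact_support (φ := hessV f) hK
    hf.hess_continuousOn
    (fun z hz hzK => hessV_eq_zero hK h0 hz hzK) hKQ
  have hslice : ∀ {E : Type} [NormedAddCommGroup E] {φ : Phase d → E} {τ : ℝ}, 0 ≤ τ →
      ContinuousOn φ (Iic 0 ×ˢ univ) → Continuous (straighten t φ τ) := by
    intro E _ φ τ hτ hφ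
    refine continuousOn_univ.mp (hφ.comp (f := fun y : Slice d => (t - τ, y.1 - τ • y.2, y.2))
      (by fun_prop) fun y _ => ⟨?_, mem_univ _⟩)
    exact mem_Iic.mpr (by linarith)
  have hbound₂ : ∀ e z, |(kineticCylinder d 1).indicator (hessV f) z e e| ≤ B2 * ‖e‖ * ‖e‖ :=
    fun e z => (((kineticCylinder d 1).indicator (hessV f) z).le_opNorm₂ e e).trans
      (by gcongr; exact hB2 z)
  refine ⟨?_, fun τ hτ => hslice (le_of_lt hτ) c1, fun τ hτ e => ?_, ⟨B0, fun τ _ y => hB0 _⟩,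
    ⟨B1, fun τ _ y => hB1 _⟩, fun e => ⟨B2 * ‖e‖ * ‖e‖, fun τ _ y => hbound₂ e _⟩, ?_, ?_, ?_, ?_, ?_⟩
  · refine c0.comp (f := fun p : ℝ × Slice d => (t - p.1, p.2.1 - p.1 • p.2.2, p.2.2))
      (by fun_prop) fun p hp => ⟨?_, mem_univ _⟩
    have : (0 : ℝ) ≤ p.1 := hp.1
    exact mem_Iic.mpr (by linarith)
  · have := hslice (le_of_lt hτ) c2
    fun_prop
  · refine ⟨2, fun τ hτ y hy => ?_⟩
    have hnot : ((t - τ, y.1 - τ • y.2, y.2) : Phase d) ∉ kineticCylinder d 1 := by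
      rw [mem_kineticCylinder_one]
      rintro ⟨⟨ht1, -⟩, hx, hv⟩
      simp only at ht1 hx hv
      have hτ1 : τ < 1 := by linarith
      have h2 : ‖y.1‖ < 2 := by
        have := norm_add_le (y.1 - τ • y.2) (τ • y.2)
        rw [sub_add_cancel, norm_smul, Real.norm_of_nonneg hτ] at this
        nlinarith [norm_nonneg y.2]
      rw [Prod.norm_def] at hy
      exact absurd hy (not_lt.mpr (max_le h2.le (by linarith)))
    simp [straighten, indicator_of_notMem hnot]
  · intro τ hτ y
    have h1 := hasDerivAt_indicator_transport hf hK hKQ h0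
      (z := (t - τ, y.1 - τ • y.2, y.2)) (by simp only; linarith)
    have hlin : HasDerivAt (fun τ' : ℝ => τ - τ') (-1) τ := by
      simpa using (hasDerivAt_id τ).const_sub τ
    rw [← sub_self τ] at h1
    have h2 := h1.comp τ hlin
    refine (h2.congr_of_eventuallyEq (Eventually.of_forall fun τ' => ?_)).congr_deriv ?_
    · simp only [straighten, transportCurve, Function.comp_apply]
      congr 1
      refine Prod.ext ?_ (Prod.ext ?_ rfl)
      · simp only; ring
      · simp only; module
    · simp only [straighten, mul_neg, mul_one]
  · intro τ hτ e
    set φ : Slice d → Vec d → ℝ := fun y w =>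
      (kineticCylinder d 1).indicator f (t - τ, y.1 - τ • y.2, w) with hφ
    have hφc : ∀ y, ContDiff ℝ 2 (φ y) := fun y => contDiff_indicator hf hK hKQ h0 _ _
    have hval : ∀ y (r : ℝ), straighten t ((kineticCylinder d 1).indicator f) τ
        (y + r • kineticDir τ e) = φ y (y.2 + r • e) := by
      intro y r
      simp only [straighten, hφ, kineticDir, Prod.fst_add, Prod.snd_add, Prod.smul_fst,
        Prod.smul_snd]
      congr 3
      module
    have hval₂ : ∀ y (r : ℝ), fderiv ℝ (fderiv ℝ (φ y)) (y.2 + r • e) e e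
        = (kineticCylinder d 1).indicator (hessV f) (t - τ, y.1 - τ • y.2, y.2 + r • e) e e := by
      intro y r
      rw [← hessV_indicator hK hKQ h0]
      rfl
    have hd1 := fun y r => (hasDerivAt_line_of_contDiff (hφc y) y.2 e r).1
    have hd2 := fun y r => (hasDerivAt_line_of_contDiff (hφc y) y.2 e r).2
    have hval0 : ∀ y, straighten t ((kineticCylinder d 1).indicator f) τ y = φ y (y.2 + (0 : ℝ) • e) := by
      intro y
      rw [← hval y 0, zero_smul, add_zero]
    have hvaln : ∀ y (r : ℝ), straighten t ((kineticCylinder d 1).indicator f) τ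
        (y - r • kineticDir τ e) = φ y (y.2 + (-r) • e) := by
      intro y r
      rw [← hval y (-r), neg_smul, sub_eq_add_neg]
    refine ⟨⟨B2 * ‖e‖ * ‖e‖, ?_⟩, ?_⟩
    · have hpos : ∀ y (ε : ℝ), 0 < ε → |φ y (y.2 + ε • e) + φ y (y.2 + (-ε) • e)
          - 2 * φ y (y.2 + (0 : ℝ) • e)| ≤ B2 * ‖e‖ * ‖e‖ * ε ^ 2 := by
        intro y ε hε
        obtain ⟨ξ, -, hξ⟩ := exists_secondDiff_eq (hd1 y) (hd2 y) hε
        rw [hξ, hval₂, abs_mul, abs_of_pos (by positivity : 0 < ε ^ 2), mul_comm]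
        exact mul_le_mul_of_nonneg_right (hbound₂ e _) (sq_nonneg ε)
      intro y ε
      rw [hval, hvaln, hval0]
      rcases lt_trichotomy ε 0 with hε | hε | hε
      · have := hpos y (-ε) (by linarith)
        rw [neg_neg, neg_sq] at this
        rwa [add_comm (φ y (y.2 + ε • e))]
      · rw [hε, neg_zero, zero_pow two_ne_zero, mul_zero, ← two_mul, sub_self, abs_zero]
      · exact hpos y ε hε
    · intro y
      have h := tendsto_secondDiff_of_contDiff (hφc y) y.2 e
      have hy := hval₂ y 0
      rw [zero_smul, add_zero] at hy
      rw [hy] at h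
      refine h.congr fun ε => ?_
      rw [hval, hvaln, hval0, zero_smul, add_zero]
  · intro τ _ y
    simp only [sourceTerm]
    ring
  · intro τ hτ y
    have hnot : ((t - τ, y.1 - τ • y.2, y.2) : Phase d) ∉ kineticCylinder d 1 := by
      rw [mem_kineticCylinder_one]
      rintro ⟨⟨ht1, -⟩, -⟩
      simp only at ht1
      linarith
    simp [straighten, indicator_of_notMem hnot]

end Straightening

/-! ### The equation at every time. -/

section LimitSource

variable {d : ℕ}

theorem abs_sub_le_of_holderXV {F : Type*} [NormedAddCommGroup F] {p q : ℝ}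
    {Q : Set (Phase d)} {g : Phase d → F} (hg : holderXV p q Q g < ∞) {t : ℝ}
    {x v x' v' : Vec d} (h : (t, x, v) ∈ Q) (h' : (t, x', v') ∈ Q) (hx : ‖x - x'‖ < 1 / 2)
    (hv : ‖v - v'‖ < 1 / 2) :
    ‖g (t, x, v) - g (t, x', v')‖
      ≤ (holderXV p q Q g).toReal * (‖x - x'‖ ^ p + ‖v - v'‖ ^ q) := by
  by_cases hne : (x, v) = (x', v')
  · obtain ⟨rfl, rfl⟩ := Prod.mk.inj hne
    simp only [sub_self, norm_zero]
    positivity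
  have hle : ENNReal.ofReal (‖g (t, x, v) - g (t, x', v')‖ / (‖x - x'‖ ^ p + ‖v - v'‖ ^ q))
      ≤ holderXV p q Q g := by
    unfold holderXV
    exact le_iSup_of_le t <| le_iSup_of_le x <| le_iSup_of_le v <| le_iSup_of_le x' <|
      le_iSup_of_le v' <| le_iSup_of_le h <| le_iSup_of_le h' <| le_iSup_of_le hne <|
      le_iSup_of_le hx <| le_iSup_of_le hv le_rfl
  have hpos : 0 < ‖x - x'‖ ^ p + ‖v - v'‖ ^ q := by
    by_cases hxx : x = x'
    · have : v ≠ v' := fun hvv => hne (by rw [hxx, hvv])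
      have : 0 < ‖v - v'‖ := norm_pos_iff.mpr (sub_ne_zero.mpr this)
      positivity
    · have : 0 < ‖x - x'‖ := norm_pos_iff.mpr (sub_ne_zero.mpr hxx)
      positivity
  have := (ENNReal.ofReal_le_iff_le_toReal hg.ne).mp hle
  rwa [div_le_iff₀ hpos] at this

theorem tendsto_quadratic {ι : Type*} {l : Filter ι} {H : ι → Vec d →L[ℝ] Vec d →L[ℝ] ℝ}
    {H₀ : Vec d →L[ℝ] Vec d →L[ℝ] ℝ} {e : ι → Vec d} {e₀ : Vec d} (hH : Tendsto H l (𝓝 H₀))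
    (he : Tendsto e l (𝓝 e₀)) : Tendsto (fun n => H n (e n) (e n)) l (𝓝 (H₀ e₀ e₀)) := by
  have hev : Continuous fun P : (Vec d →L[ℝ] Vec d →L[ℝ] ℝ) × Vec d => P.1 P.2 P.2 := by
    fun_prop
  exact (hev.tendsto (H₀, e₀)).comp (hH.prodMk_nhds he)

/-- At every time the equation holds with some elliptic matrix and a source with the Hölder
constant of `g`, because it holds at almost every time and its left-hand side is continuous. -/
theorem exists_limit_source {Λ p q : ℝ} (hΛ : 0 < Λ)
    {a : ℝ → Matrix (Fin d) (Fin d) ℝ}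
    {f g : Phase d → ℝ} (ha : IsEllipticCoeff Λ a) (hf : KineticC2 1 f)
    (hg : holderXV p q (kineticCylinder d 1) g < ∞)
    (heq : SolvesHomogeneousKFP 1 a f g) {s : ℝ} (hs : s ∈ Ioc (-1 : ℝ) 0) :
    ∃ u : Fin d → Vec d, ∀ x v x' v' : Vec d, ‖x‖ < 1 → ‖v‖ < 1 → ‖x'‖ < 1 → ‖v'‖ < 1 →
      ‖x - x'‖ < 1 / 2 → ‖v - v'‖ < 1 / 2 →
      |sourceTerm Λ⁻¹ u (transportDeriv (kineticCylinder d 1) f (s, x, v)) (hessV f (s, x, v))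
        - sourceTerm Λ⁻¹ u (transportDeriv (kineticCylinder d 1) f (s, x', v'))
          (hessV f (s, x', v'))|
        ≤ (holderXV p q (kineticCylinder d 1) g).toReal * (‖x - x'‖ ^ p + ‖v - v'‖ ^ q) := by
  -- A set of full measure is dense, so every time, including `0`, is a limit of good times in `(-1,
  -- 0)`.
  have hdense := Measure.dense_of_ae heq
  have hcl : s ∈ closure (Ioo (-1 : ℝ) 0 ∩ {t : ℝ | ∀ x v : Vec d,
      (t, x, v) ∈ kineticCylinder d 1 → transportDeriv (kineticCylinder d 1) f (t, x, v) =
      (a t * hessVMatrix f (t, x, v)).trace + g (t, x, v)}) := by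
    have h1 := closure_mono (hdense.open_subset_closure_inter (isOpen_Ioo (a := (-1 : ℝ)) (b := 0)))
    rw [closure_closure, closure_Ioo (by norm_num)] at h1
    exact h1 ⟨hs.1.le, hs.2⟩
  obtain ⟨r, hr, hrs⟩ := mem_closure_iff_seq_limit.mp hcl
  choose w hwb hw using fun n => exists_trace_eq_sum_squares hΛ (ha.2 (r n))
  have hwmem : ∀ n, w n ∈ Metric.closedBall (0 : Fin d → Vec d) √(d * Λ) := by
    intro n
    rw [mem_closedBall_zero_iff, pi_norm_le_iff_of_nonneg (Real.sqrt_nonneg _)]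
    exact fun k => Real.le_sqrt_of_sq_le (hwb n k)
  -- One subsequence for the vectors serves all `(x, v)` at once, since the matrix depends on time
  -- only.
  obtain ⟨u, -, σ, hσ, hlim⟩ := (isCompact_closedBall _ _).tendsto_subseq hwmem
  refine ⟨u, ?_⟩
  have hmem : ∀ n {x v : Vec d}, ‖x‖ < 1 → ‖v‖ < 1 → (r n, x, v) ∈ kineticCylinder d 1 := by
    intro n x v hx hv
    exact mem_kineticCylinder_one.mpr ⟨⟨(hr n).1.1, (hr n).1.2.le⟩, hx, hv⟩
  have hgeq : ∀ n {x v : Vec d}, ‖x‖ < 1 → ‖v‖ < 1 → g (r n, x, v)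
      = sourceTerm Λ⁻¹ (w n) (transportDeriv (kineticCylinder d 1) f (r n, x, v))
        (hessV f (r n, x, v)) := by
    intro n x v hx hv
    have hm := hmem n hx hv
    have h1 := (hr n).2 x v hm
    have hsymm : ∀ e e', hessV f (r n, x, v) e e' = hessV f (r n, x, v) e' e := by
      refine hessV_symm ?_
      obtain ⟨m1, m2, m3⟩ := hm
      exact (hf.contDiffOn_v _ m1 _ m2).contDiffAt (Metric.isOpen_ball.mem_nhds m3)
    have h2 := hw n (hessV f (r n, x, v)) hsymm
    unfold hessVMatrix at h1
    rw [h2] at h1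
    rw [sourceTerm, h1]
    ring
  -- No continuity of `g` in time is assumed: its values converge along the subsequence because the
  -- equation expresses them through continuous quantities and the converging vectors.
  have hconv : ∀ {x v : Vec d}, ‖x‖ < 1 → ‖v‖ < 1 → Tendsto (fun n => g (r (σ n), x, v)) atTop
      (𝓝 (sourceTerm Λ⁻¹ u (transportDeriv (kineticCylinder d 1) f (s, x, v))
        (hessV f (s, x, v)))) := by
    intro x v hx hv
    simp only [hgeq _ hx hv]
    have hsm : (s, x, v) ∈ kineticCylinder d 1 := mem_kineticCylinder_one.mpr ⟨hs, hx, hv⟩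
    have hpt : Tendsto (fun n => ((r (σ n), x, v) : Phase d)) atTop
        (𝓝[kineticCylinder d 1] (s, x, v)) := by
      refine tendsto_nhdsWithin_iff.mpr ⟨?_, Eventually.of_forall fun n => hmem _ hx hv⟩
      exact (hrs.comp hσ.tendsto_atTop).prodMk_nhds tendsto_const_nhds
    have h1 : Tendsto (fun n => transportDeriv (kineticCylinder d 1) f (r (σ n), x, v)) atTop
        (𝓝 (transportDeriv (kineticCylinder d 1) f (s, x, v))) :=
      Tendsto.comp (hf.transport_continuousOn _ hsm) hpt
    have h2 : Tendsto (fun n => hessV f (r (σ n), x, v)) atTop (𝓝 (hessV f (s, x, v))) :=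
      Tendsto.comp (hf.hess_continuousOn _ hsm) hpt
    have h3 : ∀ k, Tendsto (fun n => w (σ n) k) atTop (𝓝 (u k)) := fun k =>
      (tendsto_pi_nhds.mp hlim) k
    unfold sourceTerm
    refine h1.sub ((Tendsto.const_mul _ (tendsto_finsetSum _ fun i _ => ?_)).add
      (tendsto_finsetSum _ fun k _ => ?_))
    · exact tendsto_quadratic h2 tendsto_const_nhds
    · exact tendsto_quadratic h2 (h3 k)
  intro x v x' v' hx hv hx' hv' hxx hvv
  refine le_of_tendsto ((hconv hx hv).sub (hconv hx' hv')).abs (Eventually.of_forall fun n => ?_)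
  exact abs_sub_le_of_holderXV hg (hmem _ hx hv) (hmem _ hx' hv') hxx hvv

end LimitSource

/-! ### Polarisation and the Hölder bound for the straightened source. -/

section Final

variable {d : ℕ}

theorem straighten_zero {E : Type*} (t : ℝ) (φ : Phase d → E) (y : Slice d) :
    straighten t φ 0 y = φ (t, y) := by
  simp [straighten]

/-- A symmetric bilinear form is bounded by the bound of its quadratic form. -/
theorem opNorm_le_of_quadratic_le {D : Vec d →L[ℝ] Vec d →L[ℝ] ℝ} (hD : ∀ e e', D e e' = D e' e)
    {B : ℝ} (hB : 0 ≤ B) (h : ∀ e, |D e e| ≤ B * ‖e‖ ^ 2) : ‖D‖ ≤ B := by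
  refine D.opNorm_le_bound₂ hB fun e e' => ?_
  set m := ‖e‖ * ‖e'‖ with hm
  rcases (by positivity : 0 ≤ m).eq_or_lt with hm0 | hm0
  · have : e = 0 ∨ e' = 0 := by
      rcases mul_eq_zero.mp (hm.symm.trans hm0.symm) with h | h
      · exact Or.inl (norm_eq_zero.mp h)
      · exact Or.inr (norm_eq_zero.mp h)
    rcases this with rfl | rfl <;> simp
  -- Rescaling to equal norms makes polarisation with the parallelogram law give the sharp constant.
  set p := ‖e'‖ • e with hp
  set q := ‖e‖ • e' with hq
  have hpn : ‖p‖ = m := by rw [hp, norm_smul, norm_norm, hm, mul_comm]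
  have hqn : ‖q‖ = m := by rw [hq, norm_smul, norm_norm, hm]
  have hpq : D p q = m * D e e' := by
    simp only [hp, hq, map_smul, smul_apply, smul_eq_mul, hm]
    ring
  have h4 : D (p + q) (p + q) - D (p - q) (p - q) = 4 * D p q := by
    simp only [map_add, map_sub, add_apply, sub_apply, hD q p]
    ring
  have hpar := parallelogram_law_with_norm ℝ p q
  rw [hpn, hqn] at hpar
  have habs : 4 * |D p q| ≤ 4 * (B * m ^ 2) := by
    calc 4 * |D p q| = |D (p + q) (p + q) - D (p - q) (p - q)| := by
          rw [h4, abs_mul]; norm_num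
      _ ≤ B * ‖p + q‖ ^ 2 + B * ‖p - q‖ ^ 2 := (abs_sub _ _).trans (add_le_add (h _) (h _))
      _ = B * (‖p + q‖ ^ 2 + ‖p - q‖ ^ 2) := by ring
      _ = _ := by rw [hpar]; ring
  rw [hpq, abs_mul, abs_of_pos hm0] at habs
  rw [Real.norm_eq_abs, mul_assoc, ← hm]
  have : m * |D e e'| ≤ m * (B * m) := by nlinarith
  exact le_of_mul_le_mul_left this hm0

/-- The vectors are chosen time by time with no regularity in `τ`, which is harmless since the
maximum principle uses only their sign effect. The factor `4` is that of
`holder_of_local_of_compact_support`, and the shear appears on substituting `x - τ v` for the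
position. -/
theorem exists_shearHolder_source {Λ α : ℝ} (hΛ : 0 < Λ) (hα : 0 < α)
    {a : ℝ → Matrix (Fin d) (Fin d) ℝ} {f g : Phase d → ℝ} (ha : IsEllipticCoeff Λ a)
    (hf : KineticC2 1 f) (hg : holderXV (α / 3) α (kineticCylinder d 1) g < ∞)
    (heq : SolvesHomogeneousKFP 1 a f g) {K : Set (Phase d)} (hK : IsCompact K)
    (hKQ : K ⊆ kineticCylinder d 1) (h0 : ∀ z ∈ kineticCylinder d 1, z ∉ K → f z = 0)
    {t : ℝ} (ht : t ≤ 0) :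
    ∃ u : ℝ → Fin d → Vec d, ∀ τ > 0,
      ShearHolder α (4 * (holderXV (α / 3) α (kineticCylinder d 1) g).toReal) τ
        (fun y => sourceTerm Λ⁻¹ (u τ)
          (straighten t ((kineticCylinder d 1).indicator
            (transportDeriv (kineticCylinder d 1) f)) τ y)
          (straighten t ((kineticCylinder d 1).indicator (hessV f)) τ y)) := by
  set N := (holderXV (α / 3) α (kineticCylinder d 1) g).toReal with hN
  have hN0 : 0 ≤ N := ENNReal.toReal_nonneg
  set P := (kineticCylinder d 1).indicator (transportDeriv (kineticCylinder d 1) f) with hP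
  set H := (kineticCylinder d 1).indicator (hessV f) with hH
  suffices hex : ∀ s ≤ (0 : ℝ), ∃ w : Fin d → Vec d, ∀ y y' : Slice d,
      |sourceTerm Λ⁻¹ w (P (s, y)) (H (s, y)) - sourceTerm Λ⁻¹ w (P (s, y')) (H (s, y'))|
        ≤ 4 * N * (‖y.1 - y'.1‖ ^ (α / 3) + ‖y.2 - y'.2‖ ^ α) by
    choose! w hw using hex
    refine ⟨fun τ => w (t - τ), fun τ hτ y h => ?_⟩
    have := hw (t - τ) (by linarith) ((y + h).1 - τ • (y + h).2, (y + h).2)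
      (y.1 - τ • y.2, y.2)
    simp only [Prod.fst_add, Prod.snd_add, add_sub_cancel_left] at this
    rwa [show y.1 + h.1 - τ • (y.2 + h.2) - (y.1 - τ • y.2) = h.1 - τ • h.2 by module] at this
  intro s hs
  by_cases hs1 : -1 < s
  · obtain ⟨w, hw⟩ := exists_limit_source hΛ ha hf hg heq ⟨hs1, hs⟩
    refine ⟨w, fun y y' => ?_⟩
    have hmem : ∀ y ∈ Metric.ball (0 : Slice d) 1, (s, y) ∈ kineticCylinder d 1 := by
      intro y hy
      rw [mem_ball_zero_iff, Prod.norm_def, max_lt_iff] at hy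
      exact mem_kineticCylinder_one.mpr ⟨⟨hs1, hs⟩, hy.1, hy.2⟩
    refine holder_of_local_of_compact_support (p := α / 3) (q := α) (by positivity) hα.le hN0
      (G := fun y => sourceTerm Λ⁻¹ w (P (s, y)) (H (s, y))) (hK.image continuous_snd) ?_ ?_ ?_ y y'
    · rintro _ ⟨z, hz, rfl⟩
      have := mem_kineticCylinder_one.mp (hKQ hz)
      rw [mem_ball_zero_iff, Prod.norm_def, max_lt_iff]
      exact this.2
    · intro y hy
      have hyK : (s, y) ∉ K := fun h => hy ⟨(s, y), h, rfl⟩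
      have hP0 : P (s, y) = 0 := by
        by_cases hQ : (s, y) ∈ kineticCylinder d 1
        · rw [hP, indicator_of_mem hQ, transportDeriv_eq_zero hK h0 hQ hyK]
        · rw [hP, indicator_of_notMem hQ]
      have hH0 : H (s, y) = 0 := by
        by_cases hQ : (s, y) ∈ kineticCylinder d 1
        · rw [hH, indicator_of_mem hQ, hessV_eq_zero hK h0 hQ hyK]
        · rw [hH, indicator_of_notMem hQ]
      simp [sourceTerm, hP0, hH0]
    · intro y hy y' hy' h1 h2
      have hb := mem_kineticCylinder_one.mp (hmem y hy)
      have hb' := mem_kineticCylinder_one.mp (hmem y' hy')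
      simp only [hP, hH, indicator_of_mem (hmem y hy), indicator_of_mem (hmem y' hy')]
      exact hw y.1 y.2 y'.1 y'.2 hb.2.1 hb.2.2 hb'.2.1 hb'.2.2 h1 h2
  · refine ⟨0, fun y y' => ?_⟩
    have hQ : ∀ y, ((s, y) : Phase d) ∉ kineticCylinder d 1 := fun y h =>
      hs1 (mem_kineticCylinder_one.mp h).1.1
    simp only [hP, hH, indicator_of_notMem (hQ _), sub_self, abs_zero]
    positivity

end Final

/-! ### Assembly of the Schauder estimate. -/

theorem proposition2p3 (d : ℕ) (α : ℝ) (hα : α ∈ Ioo (0 : ℝ) 1) (Λ : ℝ) (hΛ : 1 ≤ Λ) :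
    ∃ C : ℝ≥0, ∀ (a : ℝ → Matrix (Fin d) (Fin d) ℝ) (f g : Phase d → ℝ),
      IsEllipticCoeff Λ a →
      KineticC2 1 f →
      MemHolderXV (α / 3) α (kineticCylinder d 1) g →
      CompactSupportIn (kineticCylinder d 1) f →
      CompactSupportIn (kineticCylinder d 1) g →
      SolvesHomogeneousKFP 1 a f g →
      holderX ((2 + α) / 3) (kineticCylinder d 1) f
          + holderXV (α / 3) α (kineticCylinder d 1) (hessV f)
        ≤ C * holderXV (α / 3) α (kineticCylinder d 1) g := by
  obtain ⟨hα0, hα1⟩ := hα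
  have hΛ0 : 0 < Λ := by linarith
  have hl : 0 < Λ⁻¹ := by positivity
  have hl1 : Λ⁻¹ ≤ 1 := inv_le_one_of_one_le₀ hΛ
  obtain ⟨C₁, hC₁, hX⟩ := exists_position_holder_bound d hα0 hα1 hl hl1
  obtain ⟨C₂, hC₂, hV⟩ := exists_secondDiff_holder_bound d hα0 hα1 hl hl1
  -- The factors `4` come from the global Hölder constant `4 * N` of the source.
  refine ⟨(4 * C₁ + 4 * C₂).toNNReal, ?_⟩
  intro a f g ha hf hg hfs _ heq
  obtain ⟨K, hK, hKQ, h0⟩ := hfs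
  set N := (holderXV (α / 3) α (kineticCylinder d 1) g).toReal with hN
  have hN0 : 0 ≤ N := ENNReal.toReal_nonneg
  have hgN : holderXV (α / 3) α (kineticCylinder d 1) g = ENNReal.ofReal N :=
    (ENNReal.ofReal_toReal hg.2.ne).symm
  set fe := (kineticCylinder d 1).indicator f with hfe
  have hsx : ∀ t ≤ (0 : ℝ), ∀ (h : Vec d) (y : Slice d) (ρ : ℝ), 0 < ρ → ρ ≤ 1 → ‖h‖ = ρ ^ 3 →
      fe (t, y + (h, 0)) - fe (t, y) ≤ C₁ * (4 * N) * ρ ^ (2 + α) := by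
    intro t ht h y ρ hρ hρ1 hh
    obtain ⟨u, hu⟩ := exists_shearHolder_source hΛ0 hα0 ha hf hg.2 heq hK hKQ h0 ht
    have := hX u _ _ _ _ (4 * N) (straightSolution_of_kineticC2 hf hK hKQ h0 ht Λ⁻¹ u)
      (by positivity) hu h y ρ hρ hρ1 hh
    simpa only [straighten_zero] using this
  have hsv : ∀ t ≤ (0 : ℝ), ∀ (h y : Slice d) (e : Vec d) (ρ : ℝ), 0 < ρ → ρ ≤ 1 →
      ‖h.1‖ ≤ ρ ^ 3 → ‖h.2‖ ≤ ρ →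
      hessV fe (t, y + h) e e - hessV fe (t, y) e e ≤ C₂ * (4 * N) * ρ ^ α * ‖e‖ ^ 2 := by
    intro t ht h y e ρ hρ hρ1 hh1 hh2
    rcases eq_or_ne e 0 with rfl | he
    · simp
    obtain ⟨u, hu⟩ := exists_shearHolder_source hΛ0 hα0 ha hf hg.2 heq hK hKQ h0 ht
    have hb := hV u _ _ _ _ (4 * N) (straightSolution_of_kineticC2 hf hK hKQ h0 ht Λ⁻¹ u)
      (by positivity) hu h y
    have l1 := tendsto_secondDiff_of_contDiff (contDiff_indicator hf hK hKQ h0 t (y + h).1)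
      (y + h).2 e
    have l2 := tendsto_secondDiff_of_contDiff (contDiff_indicator hf hK hKQ h0 t y.1) y.2 e
    refine le_of_tendsto (l1.sub l2) ?_
    have hen : 0 < ‖e‖ := norm_pos_iff.mpr he
    -- The second difference bound is applied with step `ε • e`, of length below `ρ`; after division
    -- by `ε ^ 2` it passes to the limit, its constant being independent of `ε`.
    filter_upwards [Ioo_mem_nhdsGT (show (0 : ℝ) < ρ / ‖e‖ by positivity)] with ε hε
    have hε0 : 0 < ε := hε.1
    have hεn : ‖ε • e‖ = ε * ‖e‖ := by rw [norm_smul, Real.norm_of_nonneg hε0.le]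
    have := hb (ε • e) ρ hρ hρ1 hh1 hh2 (smul_ne_zero hε0.ne' he)
      (by rw [hεn]; exact ((lt_div_iff₀ hen).mp hε.2).le)
    rw [← sub_div, div_le_iff₀ (by positivity)]
    refine le_trans (le_of_eq ?_) (this.trans (le_of_eq ?_))
    · simp [straighten, sub_eq_add_neg]
    · rw [hεn]
      ring
  have hpart1 : holderX ((2 + α) / 3) (kineticCylinder d 1) f ≤ ENNReal.ofReal (4 * C₁ * N) := by
    unfold holderX
    refine iSup_le fun t => iSup_le fun x => iSup_le fun x' => iSup_le fun v => iSup_le fun hm =>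
      iSup_le fun hm' => iSup_le fun hne => iSup_le fun hd => ENNReal.ofReal_le_ofReal ?_
    have hpos : 0 < ‖x - x'‖ := norm_pos_iff.mpr (sub_ne_zero.mpr hne)
    have ht := (mem_kineticCylinder_one.mp hm).1.2
    set ρ := ‖x - x'‖ ^ (1 / 3 : ℝ) with hρ
    have hρ0 : 0 < ρ := by positivity
    have hρ1 : ρ ≤ 1 := Real.rpow_le_one hpos.le (by linarith) (by norm_num)
    have hρ3 : ‖x - x'‖ = ρ ^ 3 := by
      rw [hρ, ← Real.rpow_natCast, ← Real.rpow_mul hpos.le]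
      norm_num
    have hρα : ρ ^ (2 + α) = ‖x - x'‖ ^ ((2 + α) / 3) := by
      rw [hρ, ← Real.rpow_mul hpos.le]
      congr 1
      ring
    -- The estimates are one-sided; exchanging the two points gives the absolute value.
    have b1 := hsx t ht (x - x') (x', v) ρ hρ0 hρ1 hρ3
    have b2 := hsx t ht (x' - x) (x, v) ρ hρ0 hρ1 (by rw [norm_sub_rev, hρ3])
    simp only [Prod.mk_add_mk, add_sub_cancel, add_zero] at b1 b2
    rw [hfe, indicator_of_mem hm, indicator_of_mem hm', hρα] at b1 b2
    rw [div_le_iff₀ (by positivity), Real.norm_eq_abs, abs_le]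
    constructor <;> linarith
  have hpart2 : holderXV (α / 3) α (kineticCylinder d 1) (hessV f)
      ≤ ENNReal.ofReal (4 * C₂ * N) := by
    unfold holderXV
    refine iSup_le fun t => iSup_le fun x => iSup_le fun v => iSup_le fun x' => iSup_le fun v' =>
      iSup_le fun hm => iSup_le fun hm' => iSup_le fun hne => iSup_le fun hdx => iSup_le fun hdv =>
      ENNReal.ofReal_le_ofReal ?_
    have ht := (mem_kineticCylinder_one.mp hm).1.2
    -- The kinetic distance of the two points: `ρ ^ α` is one of the two terms of the Hölder
    -- denominator, hence at most their sum.
    set ρ := max (‖x - x'‖ ^ (1 / 3 : ℝ)) ‖v - v'‖ with hρ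
    have hρ0 : 0 < ρ := by
      by_cases hxx : x = x'
      · have hvv : v ≠ v' := fun hvv => hne (by rw [hxx, hvv])
        exact lt_max_of_lt_right (norm_pos_iff.mpr (sub_ne_zero.mpr hvv))
      · have : 0 < ‖x - x'‖ := norm_pos_iff.mpr (sub_ne_zero.mpr hxx)
        exact lt_max_of_lt_left (by positivity)
    have hρ1 : ρ ≤ 1 :=
      max_le (Real.rpow_le_one (norm_nonneg _) (by linarith) (by norm_num)) (by linarith)
    have hρ3 : ‖x - x'‖ ≤ ρ ^ 3 := by
      calc ‖x - x'‖ = (‖x - x'‖ ^ (1 / 3 : ℝ)) ^ 3 := by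
            rw [← Real.rpow_natCast, ← Real.rpow_mul (norm_nonneg _)]
            norm_num
        _ ≤ ρ ^ 3 := pow_le_pow_left₀ (by positivity) (le_max_left _ _) 3
    have hρα : ρ ^ α ≤ ‖x - x'‖ ^ (α / 3) + ‖v - v'‖ ^ α := by
      have n1 : 0 ≤ ‖x - x'‖ ^ (α / 3) := by positivity
      have n2 : 0 ≤ ‖v - v'‖ ^ α := by positivity
      rcases max_choice (‖x - x'‖ ^ (1 / 3 : ℝ)) ‖v - v'‖ with hmx | hmx
      · rw [hρ, hmx, ← Real.rpow_mul (norm_nonneg _), one_div_mul_eq_div]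
        linarith
      · rw [hρ, hmx]
        linarith
    have hden : 0 < ‖x - x'‖ ^ (α / 3) + ‖v - v'‖ ^ α :=
      lt_of_lt_of_le (by positivity) hρα
    have hessz : ∀ {z}, z ∈ kineticCylinder d 1 → hessV fe z = hessV f z := fun {z} hz => by
      rw [hfe, hessV_indicator hK hKQ h0, indicator_of_mem hz]
    have hsymm : ∀ z e e', hessV fe z e e' = hessV fe z e' e := fun z e e' =>
      hessV_symm (contDiff_indicator hf hK hKQ h0 _ _).contDiffAt e e'
    have hquad : ∀ e, |(hessV f (t, x, v) - hessV f (t, x', v')) e e|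
        ≤ C₂ * (4 * N) * ρ ^ α * ‖e‖ ^ 2 := by
      intro e
      have b1 := hsv t ht (x - x', v - v') (x', v') e ρ hρ0 hρ1 hρ3 (le_max_right _ _)
      have b2 := hsv t ht (x' - x, v' - v) (x, v) e ρ hρ0 hρ1
        (by rw [norm_sub_rev]; exact hρ3) (by rw [norm_sub_rev]; exact le_max_right _ _)
      simp only [Prod.mk_add_mk, add_sub_cancel] at b1 b2
      rw [hessz hm, hessz hm'] at b1 b2
      rw [sub_apply, sub_apply, abs_le]
      constructor <;> linarith
    have hnorm : ‖hessV f (t, x, v) - hessV f (t, x', v')‖ ≤ C₂ * (4 * N) * ρ ^ α := by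
      refine opNorm_le_of_quadratic_le (fun e e' => ?_) (by positivity) hquad
      rw [sub_apply, sub_apply, sub_apply, sub_apply, ← hessz hm, ← hessz hm', hsymm, hsymm _ e e']
    rw [div_le_iff₀ hden]
    refine hnorm.trans ?_
    calc C₂ * (4 * N) * ρ ^ α = 4 * C₂ * N * ρ ^ α := by ring
      _ ≤ _ := by gcongr
  refine (add_le_add hpart1 hpart2).trans (le_of_eq ?_)
  rw [hgN, ← ENNReal.ofReal_add (by positivity) (by positivity), ← add_mul,
    ENNReal.ofReal_mul (by positivity)]
  rfl
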